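/- Setting. Let $X,Y_1,\dots,Y_n$ ($n\ge 1$) be (real or complex) Hilbert spaces, let $Y=Y_1\times\cdots\times Y_n$ carry the norm $\|y\|=(\sum_i\|y_i\|^2)^{1/2}$, let $A_\dagger=(A_{\dagger,1},\dots,A_{\dagger,n}):X\to Y$ be bounded and linear, let $x_0\in X$, $y_\dagger\in Y$, and let $x_\dagger$ be the solution of $A_\dagger x=y_\dagger$ of minimal distance to $x_0$. Assume the source condition $x_\dagger-x_0=B_\dagger^\nu w$ for some $\nu>0$ and $w\in\mathcal N(A_\dagger)^\perp$, where $B_\dagger=n^{-1}A_\dagger^*A_\dagger$. The noisy data are $y^\delta=y_\dagger+\xi$ with $\|\xi\|=\delta\in(0,1)$. Method. Given a bounded linear operator $A=(A_1,\dots,A_n):X\to Y$, a constant step size $c_0>0$, a frequency $M\ge1$ and indices $i_0,i_1,\ldots\in\{1,\dots,n\}$, the iterates are $x_0^\delta=x_0$ and, for $K\ge 0$ and $0\le t<M$, $$x^\delta_{KM+t+1}=x^\delta_{KM+t}-c_0\Big(A_{i_{KM+t}}^*A_{i_{KM+t}}(x^\delta_{KM+t}-x^\delta_{KM})+\tfrac1n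 A^*(Ax^\delta_{KM}-y^\delta)\Big).$$ Put $e_k^\delta=x_k^\delta-x_\dagger$, $L=\max_i\|A_i\|^2$, $$\overline{C_0}=\max\big(\|A\|^{-1}(5Ln^{-1}M)^{-1/2},\,L^{-1}(10+\ln M)^{-1}\big),\qquad C_0=\big(100\sqrt L\,M\|A\|\ln(2e^2n\sqrt L\|A\|^{-1})\big)^{-1},$$ where $1/L$, $\overline{C_0}$ and $C_0$ are read as $+\infty$ if $A=0$. In the statements in expectation the indices are i.i.d. uniform on $\{1,\dots,n\}$, and $c_0$ satisfies $c_0\le L^{-1}$ and $c_0<\overline{C_0}$. The pathwise statements hold for every sequence of indices, and there $c_0$ satisfies $c_0\le L^{-1}$ and $c_0<C_0$. The constants $C$ below do not depend on $\delta\in(0,1)$, on the noise $\xi$ with $\|\xi\|=\delta$, on $k$, or on the index sequence. In (i) the operator $A$, and with it $L$, $\overline{C_0}$ and $C_0$, depends on $\delta$, while $c_0$ is fixed; the bounds hold for all those $\delta$ for which $c_0$ satisfies the step size conditions. (i) (rSVRG) Let $a>0$, let $A_\dagger$ be compact with singular value decomposition $A_\dagger=\sum_j\sigma_j\langle\varphi_j,\cdot\rangle\psi_j$,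 and let $A=\sum_{j:\,\sigma_j\ge a\delta^{b}}\sigma_j\langle\varphi_j,\cdot\rangle\psi_j$ with $b=(1+2\nu)^{-1}$. Then there is $C$ with $$\mathbb E[\|e_k^\delta\|^2]^{1/2}\le C\delta^{\frac{2\nu}{1+2\nu}}\qquad\text{for all } k\ge \delta^{-\frac{2\nu}{(1+2\nu)\min(\nu,1/2)}},$$ and for every $\epsilon\in(0,\frac12)$ there is $C$ with $$\|e_k^\delta\|\le C\delta^{\frac{2\nu}{1+2\nu}}\qquad\text{for all } k\ge \delta^{-\frac{2\nu}{(1+2\nu)\min(\nu,1/2-\epsilon)}}.$$ (ii) (SVRG) Let $A=A_\dagger$ and $0<\kappa_1\le\kappa_2$. There is $C$ such that for all integers $k$ with $\kappa_1\delta^{-\frac{2}{1+2\nu}}\le k\le\kappa_2\delta^{-\frac{2}{1+2\nu}}$: if $\nu\in(0,\frac12]$, then $\mathbb E[\|e_k^\delta\|^2]^{1/2}\le C\delta^{\frac{2\nu}{1+2\nu}}$; and if $\nu\in(0,\frac12)$, then $\|e_k^\delta\|\le C\delta^{\frac{2\nu}{1+2\nu}}$ (with $C$ depending on which of the two cases is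 considered). -/

import Mathlib

open Polynomial

noncomputable section

namespace SVRG

section FracPow

variable {𝕜 : Type*} [RCLike 𝕜] {H : Type*} [NormedAddCommGroup H] [InnerProductSpace 𝕜 H]

/-- The operator `p(T)` for a polynomial `p` with real coefficients. -/
def polyOp (T : H →L[𝕜] H) (p : ℝ[X]) : H →L[𝕜] H :=
  aeval T (p.map (algebraMap ℝ 𝕜))

/-- `S = f(T)` in the sense of the continuous functional calculus of a positive operator `T`
(whose spectrum lies in `[0, ‖T‖]`): `S` is the norm limit of `p(T)` as the polynomials `p`
tend to `f` uniformly on `[0, ‖T‖]`. -/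
def IsFunCalc (T : H →L[𝕜] H) (f : ℝ → ℝ) (S : H →L[𝕜] H) : Prop :=
  ∀ ε : ℝ, 0 < ε → ∃ p : ℝ[X],
    (∀ t ∈ Set.Icc (0 : ℝ) ‖T‖, |p.eval t - f t| ≤ ε) ∧ ‖polyOp T p - S‖ ≤ ε

open Classical in
/-- The fractional power `T ^ ν` of a positive bounded operator `T`, for `ν > 0`. -/
def fracPow (T : H →L[𝕜] H) (ν : ℝ) : H →L[𝕜] H :=
  if h : ∃ S, IsFunCalc T (fun t => t ^ ν) S then h.choose else 0

theorem polyOp_mul (T : H →L[𝕜] H) (p q : ℝ[X]) :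
    polyOp T (p * q) = polyOp T p * polyOp T q := by
  simp [polyOp]

theorem polyOp_sub (T : H →L[𝕜] H) (p q : ℝ[X]) :
    polyOp T (p - q) = polyOp T p - polyOp T q := by
  simp [polyOp]

variable [CompleteSpace H]

theorem polyOp_isSelfAdjoint {T : H →L[𝕜] H} (hT : IsSelfAdjoint T) (p : ℝ[X]) :
    IsSelfAdjoint (polyOp T p) := by
  induction p using Polynomial.induction_on' with
  | add p q hp hq =>
    have : polyOp T (p + q) = polyOp T p + polyOp T q := by simp [polyOp]
    rw [this]; exact hp.add hq
  | monomial k c =>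
    have : polyOp T (monomial k c) = (c : 𝕜) • T ^ k := by
      simp only [polyOp, map_monomial, aeval_monomial, Algebra.algebraMap_eq_smul_one]
      simp
    rw [this]
    refine IsSelfAdjoint.smul ?_ (hT.pow k)
    simp [isSelfAdjoint_iff]

theorem isUnit_of_re_inner {S : H →L[𝕜] H} {c : ℝ} (hc : 0 < c)
    (h : ∀ x, c * ‖x‖ ^ 2 ≤ RCLike.re (inner 𝕜 (S x) x)) : IsUnit S := by
  refine ContinuousLinearMap.isUnit_of_forall_le_norm_inner_map S (c := ⟨c, hc.le⟩) hc ?_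
  intro x
  refine le_trans ?_ (RCLike.re_le_norm _)
  have := h x
  change ‖x‖ ^ 2 * c ≤ _
  linarith

/-- If a real polynomial has no zero on `[0, ‖T‖]`, then `p(T)` is invertible. -/
theorem isUnit_polyOp {T : H →L[𝕜] H} (hT : T.IsPositive) (p : ℝ[X])
    (hp : ∀ t ∈ Set.Icc (0 : ℝ) ‖T‖, p.eval t ≠ 0) : IsUnit (polyOp T p) := by
  induction hd : p.natDegree using Nat.strong_induction_on generalizing p with
  | _ d ih =>
  by_cases hd0 : p.natDegree = 0
  · obtain ⟨c, rfl⟩ := natDegree_eq_zero.mp hd0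
    have hc : c ≠ 0 := by simpa using hp 0 ⟨le_rfl, norm_nonneg _⟩
    have h1 : polyOp T (C c) = algebraMap 𝕜 (H →L[𝕜] H) (c : 𝕜) := by simp [polyOp]
    rw [h1]
    exact (IsUnit.mk0 (c : 𝕜) (by exact_mod_cast hc)).map _
  have hp0 : p ≠ 0 := by rintro rfl; simp at hd0
  have key : ∀ q : ℝ[X], q ∣ p → 0 < q.natDegree → IsUnit (polyOp T q) →
      IsUnit (polyOp T p) := by
    rintro q ⟨g, rfl⟩ hq hu
    rw [polyOp_mul]
    refine hu.mul (ih g.natDegree ?_ g ?_ rfl)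
    · rw [← hd, natDegree_mul (left_ne_zero_of_mul hp0) (right_ne_zero_of_mul hp0)]
      omega
    · intro t ht h0
      exact hp t ht (by simp [h0])
  obtain ⟨z, hz⟩ := Complex.exists_root (f := p.map (algebraMap ℝ ℂ)) (by
    rw [degree_map]
    exact natDegree_pos_iff_degree_pos.mp (Nat.pos_of_ne_zero hd0))
  have hz' : aeval z p = 0 := by
    simpa [aeval_def, eval_map] using hz
  by_cases him : z.im = 0
  · have hzr : z = (z.re : ℂ) := by apply Complex.ext <;> simp [him]
    have hroot : p.eval z.re = 0 := by
      rw [hzr] at hz'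
      have h2 : aeval ((algebraMap ℝ ℂ) z.re) p = 0 := by simpa using hz'
      rw [aeval_algebraMap_apply] at h2
      simpa [coe_aeval_eq_eval] using h2
    have hnot : z.re ∉ Set.Icc (0 : ℝ) ‖T‖ := fun h => hp _ h hroot
    refine key (X - C z.re) (dvd_iff_isRoot.mpr hroot) (by simp) ?_
    have h1 : ∀ x, (polyOp T (X - C z.re)) x = T x - ((z.re : ℝ) : 𝕜) • x := by
      intro x
      simp [polyOp, Algebra.algebraMap_eq_smul_one]
    have h2 : ∀ x, RCLike.re (inner 𝕜 ((polyOp T (X - C z.re)) x) x)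
        = RCLike.re (inner 𝕜 (T x) x) - z.re * ‖x‖ ^ 2 := by
      intro x
      rw [h1, inner_sub_left, inner_smul_left, map_sub, RCLike.conj_ofReal, RCLike.re_ofReal_mul,
        inner_self_eq_norm_sq]
    rcases lt_or_ge z.re 0 with hneg | hpos
    · refine isUnit_of_re_inner (c := -z.re) (by linarith) fun x => ?_
      rw [h2]
      have := hT.re_inner_nonneg_left x
      linarith
    · have hbig : ‖T‖ < z.re := by
        by_contra hle
        exact hnot ⟨hpos, not_lt.mp hle⟩
      rw [← IsUnit.neg_iff]
      refine isUnit_of_re_inner (c := z.re - ‖T‖) (by linarith) fun x => ?_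
      have h3 : RCLike.re (inner 𝕜 (T x) x) ≤ ‖T‖ * ‖x‖ ^ 2 := by
        calc RCLike.re (inner 𝕜 (T x) x) ≤ ‖inner 𝕜 (T x) x‖ := RCLike.re_le_norm _
          _ ≤ ‖T x‖ * ‖x‖ := norm_inner_le_norm _ _
          _ ≤ ‖T‖ * ‖x‖ * ‖x‖ := by gcongr; exact T.le_opNorm x
          _ = _ := by ring
      have h4 : RCLike.re (inner 𝕜 ((-polyOp T (X - C z.re)) x) x)
          = -(RCLike.re (inner 𝕜 (T x) x) - z.re * ‖x‖ ^ 2) := by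
        rw [← h2]; simp [inner_neg_left]
      rw [h4]; nlinarith
  · refine key _ (quadratic_dvd_of_aeval_eq_zero_im_ne_zero p hz' him) ?_ ?_
    · have : (X ^ 2 - C (2 * z.re) * X + C (‖z‖ ^ 2) : ℝ[X]).natDegree = 2 := by
        compute_degree!
      omega
    · set U : H →L[𝕜] H := polyOp T (X - C z.re) with hU
      have hUs : IsSelfAdjoint U := polyOp_isSelfAdjoint hT.isSelfAdjoint _
      have hq : (X ^ 2 - C (2 * z.re) * X + C (‖z‖ ^ 2) : ℝ[X])
          = (X - C z.re) * (X - C z.re) + C (z.im ^ 2) := by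
        rw [Complex.sq_norm, Complex.normSq_apply]
        simp only [map_mul, map_add, map_pow, map_ofNat]
        ring
      have h1 : ∀ x, polyOp T (X ^ 2 - C (2 * z.re) * X + C (‖z‖ ^ 2)) x
          = U (U x) + ((z.im ^ 2 : ℝ) : 𝕜) • x := by
        intro x
        have h5 : polyOp T ((X - C z.re) * (X - C z.re) + C (z.im ^ 2))
            = U * U + polyOp T (C (z.im ^ 2)) := by
          rw [hU, ← polyOp_mul]; simp [polyOp]
        have h7 : polyOp T (C (z.im ^ 2)) = ((z.im ^ 2 : ℝ) : 𝕜) • (1 : H →L[𝕜] H) := by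
          simp only [polyOp, map_C, aeval_C, Algebra.algebraMap_eq_smul_one]
        rw [hq, h5, h7]
        simp
      refine isUnit_of_re_inner (c := z.im ^ 2) (by positivity) fun x => ?_
      rw [h1, inner_add_left, inner_smul_left, map_add, RCLike.conj_ofReal, RCLike.re_ofReal_mul,
        inner_self_eq_norm_sq]
      have h6 : inner 𝕜 (U (U x)) x = inner 𝕜 (U x) (U x) := hUs.isSymmetric (U x) x
      rw [h6, inner_self_eq_norm_sq]
      nlinarith [sq_nonneg ‖U x‖]

/-- The norm bound of the functional calculus, on polynomials. -/
theorem norm_polyOp_le {T : H →L[𝕜] H} (hT : T.IsPositive) (p : ℝ[X]) {c : ℝ} (hc : 0 ≤ c)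
    (hp : ∀ t ∈ Set.Icc (0 : ℝ) ‖T‖, |p.eval t| ≤ c) : ‖polyOp T p‖ ≤ c := by
  by_contra! hlt
  set S := polyOp T p with hS
  have hSs : IsSelfAdjoint S := polyOp_isSelfAdjoint hT.isSelfAdjoint p
  have hnt : Nontrivial H := by
    by_contra hn
    rw [not_nontrivial_iff_subsingleton] at hn
    have : S = 0 := by ext x; exact Subsingleton.elim _ _
    rw [this, norm_zero] at hlt
    linarith
  have hu : ∀ s : ℝ, |s| = ‖S‖ → algebraMap ℝ 𝕜 s ∈ resolventSet 𝕜 S := by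
    intro s hs
    rw [spectrum.mem_resolventSet_iff]
    have h1 : algebraMap 𝕜 (H →L[𝕜] H) (algebraMap ℝ 𝕜 s) - S = polyOp T (C s - p) := by
      rw [polyOp_sub, hS]; simp [polyOp]
    rw [h1]
    refine isUnit_polyOp hT _ fun t ht h0 => ?_
    have h2 : s = p.eval t := by simpa [sub_eq_zero] using h0
    have h3 := hp t ht
    rw [← h2, hs] at h3
    linarith
  obtain ⟨ε, hε, h⟩ := S.abs_rayleighQuotient_le_of_norm_mem_resolventSet
    (hu ‖S‖ (abs_of_nonneg (norm_nonneg _)))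
    (by rw [← map_neg]; exact hu (-‖S‖) (by rw [abs_neg, abs_of_nonneg (norm_nonneg _)]))
  have h4 := S.norm_eq_iSup_rayleighQuotient hSs.isSymmetric
  have h5 := ciSup_le h
  linarith

/-- Continuous functions of a positive operator exist. -/
theorem exists_isFunCalc {T : H →L[𝕜] H} (hT : T.IsPositive) {f : ℝ → ℝ}
    (hf : ContinuousOn f (Set.Icc 0 ‖T‖)) : ∃ S, IsFunCalc T f S := by
  have hpos : ∀ m : ℕ, (0 : ℝ) < 1 / ((m : ℝ) + 1) := fun m => Nat.one_div_pos_of_nat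
  choose p hp using fun m : ℕ =>
    exists_polynomial_near_of_continuousOn 0 ‖T‖ f hf (1 / ((m : ℝ) + 1)) (hpos m)
  have hcau : CauchySeq fun m => polyOp T (p m) := by
    refine cauchySeq_of_le_tendsto_0 (fun m : ℕ => 2 * (1 / ((m : ℝ) + 1))) ?_ ?_
    · intro k l N hk hl
      rw [dist_eq_norm, ← polyOp_sub]
      refine norm_polyOp_le hT _ (by have := hpos N; linarith) fun t ht => ?_
      have h1 := hp k t ht
      have h2 := hp l t ht
      have h3 : 1 / ((k : ℝ) + 1) ≤ 1 / ((N : ℝ) + 1) := Nat.one_div_le_one_div hk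
      have h4 : 1 / ((l : ℝ) + 1) ≤ 1 / ((N : ℝ) + 1) := Nat.one_div_le_one_div hl
      rw [abs_lt] at h1 h2
      rw [eval_sub, abs_le]
      constructor <;> linarith
    · simpa using (tendsto_one_div_add_atTop_nhds_zero_nat (𝕜 := ℝ)).const_mul 2
  obtain ⟨S, hS⟩ := cauchySeq_tendsto_of_complete hcau
  refine ⟨S, fun ε hε => ?_⟩
  have h1 := (tendsto_iff_norm_sub_tendsto_zero.mp hS).eventually (gt_mem_nhds hε)
  have h2 := (tendsto_one_div_add_atTop_nhds_zero_nat (𝕜 := ℝ)).eventually (gt_mem_nhds hε)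
  obtain ⟨m, hm1, hm2⟩ := (h1.and h2).exists
  exact ⟨p m, fun t ht => ((hp m t ht).trans hm2).le, hm1.le⟩

/-- The operator with this property is unique. -/
theorem IsFunCalc.unique {T : H →L[𝕜] H} (hT : T.IsPositive) {f : ℝ → ℝ} {S S' : H →L[𝕜] H}
    (h : IsFunCalc T f S) (h' : IsFunCalc T f S') : S = S' := by
  rw [← sub_eq_zero, ← norm_le_zero_iff]
  refine le_of_forall_pos_le_add fun ε hε => ?_
  obtain ⟨p, hp, hpS⟩ := h (ε / 4) (by linarith)
  obtain ⟨q, hq, hqS⟩ := h' (ε / 4) (by linarith)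
  have h1 : ‖polyOp T p - polyOp T q‖ ≤ ε / 2 := by
    rw [← polyOp_sub]
    refine norm_polyOp_le hT _ (by linarith) fun t ht => ?_
    have h2 := abs_le.mp (hp t ht)
    have h3 := abs_le.mp (hq t ht)
    rw [eval_sub, abs_le]
    constructor <;> linarith
  have h4 : S - S' = (polyOp T p - polyOp T q) - (polyOp T p - S) + (polyOp T q - S') := by abel
  rw [h4]
  refine (norm_add_le _ _).trans ?_
  have := norm_sub_le (polyOp T p - polyOp T q) (polyOp T p - S)
  linarith

/-- `fracPow T ν` is the function `t ↦ t ^ ν` of `T`. -/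
theorem isFunCalc_fracPow {T : H →L[𝕜] H} (hT : T.IsPositive) {ν : ℝ} (hν : 0 < ν) :
    IsFunCalc T (fun t => t ^ ν) (fracPow T ν) := by
  have h : ∃ S, IsFunCalc T (fun t => t ^ ν) S :=
    exists_isFunCalc hT ((Real.continuous_rpow_const hν.le).continuousOn)
  rw [fracPow, dif_pos h]
  exact h.choose_spec

end FracPow

section SVD

variable {𝕜 : Type*} [RCLike 𝕜]
  {X : Type*} [NormedAddCommGroup X] [InnerProductSpace 𝕜 X]
  {Z : Type*} [NormedAddCommGroup Z] [InnerProductSpace 𝕜 Z] {ι : Type*}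

/-- `A x = ∑ i, σ i ⟨φ i, x⟩ ψ i` is a singular value decomposition of `A`. The index type is
arbitrary (infinite or finite), and singular values may vanish. -/
structure IsSVD (A : X →L[𝕜] Z) (σ : ι → ℝ) (φ : ι → X) (ψ : ι → Z) : Prop where
  nonneg : ∀ i, 0 ≤ σ i
  left_orthonormal : Orthonormal 𝕜 φ
  right_orthonormal : Orthonormal 𝕜 ψ
  hasSum : ∀ x, HasSum (fun i => (σ i : 𝕜) • inner 𝕜 (φ i) x • ψ i) (A x)

/-- The truncated singular value decomposition, retaining the singular values `σ i ≥ τ`.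
For compact `A` and `τ > 0` there are finitely many of them (`IsSVD.finite_le`). -/
def truncSVD (σ : ι → ℝ) (φ : ι → X) (ψ : ι → Z) (τ : ℝ) : X →L[𝕜] Z :=
  ∑ᶠ i ∈ {i | τ ≤ σ i}, (σ i : 𝕜) • InnerProductSpace.rankOne 𝕜 (ψ i) (φ i)

theorem IsSVD.apply_left {A : X →L[𝕜] Z} {σ : ι → ℝ} {φ : ι → X} {ψ : ι → Z}
    (h : IsSVD A σ φ ψ) (i : ι) : A (φ i) = (σ i : 𝕜) • ψ i := by
  classical
  refine (h.hasSum (φ i)).unique ?_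
  have h1 := hasSum_single (f := fun j => (σ j : 𝕜) • inner 𝕜 (φ j) (φ i) • ψ j) i (by
    intro j hj
    simp [h.left_orthonormal.2 hj])
  simpa [inner_self_eq_norm_sq_to_K, h.left_orthonormal.1 i] using h1

theorem IsSVD.finite_le {A : X →L[𝕜] Z} {σ : ι → ℝ} {φ : ι → X} {ψ : ι → Z}
    (h : IsSVD A σ φ ψ) (hA : IsCompactOperator A) {τ : ℝ} (hτ : 0 < τ) :
    {i | τ ≤ σ i}.Finite := by
  by_contra hinf
  have hinf' : {i | τ ≤ σ i}.Infinite := hinf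
  let e := hinf'.natEmbedding
  obtain ⟨K, hK, hsub⟩ := hA.image_subset_compact_of_bounded
    (Metric.isBounded_closedBall (x := (0 : X)) (r := 1))
  have hmem : ∀ m, A (φ (e m)) ∈ K := fun m => hsub ⟨φ (e m), by
    simp [h.left_orthonormal.1], rfl⟩
  obtain ⟨z, -, g, hg, hlim⟩ := hK.tendsto_subseq hmem
  obtain ⟨N, hN⟩ := Metric.cauchySeq_iff'.mp hlim.cauchySeq τ hτ
  have h1 := hN (N + 1) (Nat.le_succ N)
  have hne : (e (g (N + 1)) : ι) ≠ e (g N) := by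
    intro heq
    have := hg.injective (e.injective (Subtype.ext heq))
    omega
  have hi : τ ≤ σ (e (g (N + 1))) := (e (g (N + 1))).2
  simp only [Function.comp, h.apply_left, dist_eq_norm] at h1
  have h2 : ‖(σ (e (g (N + 1))) : 𝕜) • ψ (e (g (N + 1))) - (σ (e (g N)) : 𝕜) • ψ (e (g N))‖ ^ 2
      = σ (e (g (N + 1))) ^ 2 + σ (e (g N)) ^ 2 := by
    rw [@norm_sub_sq 𝕜, inner_smul_left, inner_smul_right, h.right_orthonormal.2 hne]
    simp [norm_smul, h.right_orthonormal.1]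
  have h3 : τ ^ 2 ≤ σ (e (g (N + 1))) ^ 2 := by gcongr
  nlinarith [sq_nonneg (σ (e (g N))), norm_nonneg
    ((σ (e (g (N + 1))) : 𝕜) • ψ (e (g (N + 1))) - (σ (e (g N)) : 𝕜) • ψ (e (g N)))]

end SVD

section Iteration

variable {𝕜 : Type*} [RCLike 𝕜] {n : ℕ}
  {X : Type*} [NormedAddCommGroup X] [InnerProductSpace 𝕜 X]
  {Y : Fin n → Type*} [∀ i, NormedAddCommGroup (Y i)] [∀ i, InnerProductSpace 𝕜 (Y i)]

/-- `xd` is the minimum-norm solution of `A x = y` relative to `x0`. -/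
def IsMinNormSolution (A : X →L[𝕜] PiLp 2 Y) (y : PiLp 2 Y) (x0 xd : X) : Prop :=
  A xd = y ∧ ∀ x, A x = y → ‖xd - x0‖ ≤ ‖x - x0‖

/-- The `i`-th component `A_i : X → Y_i` of `A`. -/
def comp (A : X →L[𝕜] PiLp 2 Y) (i : Fin n) : X →L[𝕜] Y i :=
  (PiLp.proj 2 Y i).comp A

/-- `L = max_i ‖A_i‖ ^ 2`. -/
def maxSq (A : X →L[𝕜] PiLp 2 Y) : ℝ := ⨆ i, ‖comp A i‖ ^ 2

/-- The step size threshold for convergence in expectation. -/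
def expThreshold (A : X →L[𝕜] PiLp 2 Y) (M : ℕ) : ℝ :=
  max (‖A‖⁻¹ * (5 * maxSq A * (n : ℝ)⁻¹ * M) ^ (-(1 / 2) : ℝ))
    ((maxSq A)⁻¹ * (10 + Real.log M)⁻¹)

/-- The step size threshold for pathwise convergence. -/
def pathThreshold (A : X →L[𝕜] PiLp 2 Y) (M : ℕ) : ℝ :=
  (100 * √(maxSq A) * M * ‖A‖ * Real.log (2 * Real.exp 1 ^ 2 * n * √(maxSq A) * ‖A‖⁻¹))⁻¹

/-- `c₀ ≤ L⁻¹` and `c₀` lies below the threshold for convergence in expectation. Both bounds are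
`+∞`, hence void, when `A = 0`. -/
def StepOKExp (A : X →L[𝕜] PiLp 2 Y) (M : ℕ) (c₀ : ℝ) : Prop :=
  0 < c₀ ∧ (A ≠ 0 → c₀ ≤ (maxSq A)⁻¹ ∧ c₀ < expThreshold A M)

/-- `c₀ ≤ L⁻¹` and `c₀` lies below the threshold for pathwise convergence. Both bounds are
`+∞`, hence void, when `A = 0`. -/
def StepOKPath (A : X →L[𝕜] PiLp 2 Y) (M : ℕ) (c₀ : ℝ) : Prop :=
  0 < c₀ ∧ (A ≠ 0 → c₀ ≤ (maxSq A)⁻¹ ∧ c₀ < pathThreshold A M)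

variable [CompleteSpace X] [∀ i, CompleteSpace (Y i)]

/-- `n⁻¹ A* A`. -/
def normalOp (A : X →L[𝕜] PiLp 2 Y) : X →L[𝕜] X :=
  (n : 𝕜)⁻¹ • (A.adjoint.comp A)

/-- The full gradient `n⁻¹ A* (A x - y)`. -/
def fullGrad (A : X →L[𝕜] PiLp 2 Y) (y : PiLp 2 Y) (x : X) : X :=
  (n : 𝕜)⁻¹ • A.adjoint (A x - y)

/-- The inner loop started at the anchor point `z`: the iterate after `t` steps, where `j s` is
the index drawn in step `s`. -/
def innerLoop (A : X →L[𝕜] PiLp 2 Y) (y : PiLp 2 Y) (c₀ : ℝ) (j : ℕ → Fin n) (z : X) : ℕ → X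
  | 0 => z
  | t + 1 =>
    let x := innerLoop A y c₀ j z t
    x - (c₀ : 𝕜) • ((comp A (j t)).adjoint (comp A (j t) (x - z)) + fullGrad A y z)

/-- The anchor points `x_{KM}`. -/
def anchor (A : X →L[𝕜] PiLp 2 Y) (y : PiLp 2 Y) (x0 : X) (c₀ : ℝ) (M : ℕ) (j : ℕ → Fin n) :
    ℕ → X
  | 0 => x0
  | K + 1 => innerLoop A y c₀ (fun t => j (K * M + t)) (anchor A y x0 c₀ M j K) M

/-- The (regularized) SVRG iterate `x_k` for the operator `A`, data `y`, initial guess `x0`,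
constant step size `c₀`, anchor update frequency `M` and sequence of drawn indices `j`. -/
def iterate (A : X →L[𝕜] PiLp 2 Y) (y : PiLp 2 Y) (x0 : X) (c₀ : ℝ) (M : ℕ) (j : ℕ → Fin n)
    (k : ℕ) : X :=
  innerLoop A y c₀ (fun t => j (k / M * M + t)) (anchor A y x0 c₀ M j (k / M)) (k % M)

end Iteration

open MeasureTheory ProbabilityTheory in
/-- The indices `I 0, I 1, …` are drawn i.i.d. uniformly from the `n` indices. -/
structure IsUniformSampling {n : ℕ} {Ω : Type*} [MeasurableSpace Ω] (P : Measure Ω)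
    (I : ℕ → Ω → Fin n) : Prop where
  measurable : ∀ k, Measurable (I k)
  indep : iIndepFun I P
  uniform : ∀ k i, P (I k ⁻¹' {i}) = (n : ENNReal)⁻¹

open MeasureTheory in
/-- `E[‖x - xd‖²]^{1/2} ≤ r`, where the expectation exists. -/
def RMSErrorLE {X : Type*} [NormedAddCommGroup X] {Ω : Type*} [MeasurableSpace Ω] (P : Measure Ω)
    (x : Ω → X) (xd : X) (r : ℝ) : Prop :=
  Integrable (fun ω => ‖x ω - xd‖ ^ 2) P ∧ √(∫ ω, ‖x ω - xd‖ ^ 2 ∂P) ≤ r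

end SVRG

end

/-! Write `B = n⁻¹A*A`, `R = 1 - c₀B`, `N_i = A_i*A_i - B`. If `A*(A x_† - y_†) = 0`, the error
obeys `e_{k+1} = R e_k + c₀n⁻¹A*ξ - c₀N_{i_k}d_k`, where `d_k` is the increment of the iterate over
its anchor (`err_succ`). So SVRG is the Landweber iteration perturbed by the terms `N_{i_k}d_k`, and
its error is the Landweber error plus their accumulated effect. The condition on `A` is trivial for
`A = A_†`; for the truncation it holds because `A = A_†P` with an orthogonal projection `P`
commuting with `B_†` (`IsReducing`).

Landweber error. The source condition gives `k^(-ν)`, plus `τ^(2ν)` from what is cut off at level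
`τ` (`IsReducing.norm_resPoly_fracPow_le`). The noise contributes `√(c₀k) δ` in general
(`norm_geoPoly_noise_le`) and `δ/τ` after truncation (`IsReducing.norm_geoPoly_noise_le_div`). With
`τ = aδ^b`, respectively `k` of order `δ^(-2/(1+2ν))`, everything balances at `δ^(2ν/(1+2ν))`.

Perturbation in expectation. The `N_i` have mean zero, so variances add (`expect_landweber_sq_le`).
Let `q_K` be the mean square residual of the noise-free move over epoch `K`. Inside the epoch the
mean square residual of `d` is at most `5/4 q_K` (`incrMean_le`), and `q` satisfies a discrete
Volterra inequality with kernel mass below `1` and forcing `O(K^(-2))` (`epochMean_le`). Hence `q_K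
= O(K^(-3/2))` (`epochMean_decay`), and convolving with the variance kernel `1/(r+1)` gives a
variance `O(1/k)` (`expect_err_sq_le`).

Perturbation along a path. The maps `1 - c₀A_i*A_i` are nonexpansive, so `d` is controlled by the
gradient `g_K` at the anchor. The norms of `g_K` satisfy a Volterra inequality of kernel mass at
most `1/10`, whence `g_K = O(1/K + δ/√K)` (`exists_norm_grad_le`). Convolving with `1/√r` gives
`O(log k/√k + δ)` (`exists_norm_err_le`); the logarithm is why an `ε` is lost, or `ν < 1/2` is
needed.

Uniformity. In the regularized method `A` moves with `δ`, so no constant may depend on `A`. The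
condition `c₀L ≤ 1` makes this possible: it bounds `‖A‖² ≤ n/c₀` and `√L ≤ √(1/c₀)`, leaving only
`n`, `M`, `c₀` and `‖x₀ - x_†‖`. -/

set_option linter.unusedSectionVars false

noncomputable section

namespace SVRG

/-! ### Polynomial calculus of a positive operator. -/

section PolyOp

variable {𝕜 : Type*} [RCLike 𝕜] {H : Type*} [NormedAddCommGroup H] [InnerProductSpace 𝕜 H]

theorem polyOp_add (T : H →L[𝕜] H) (p q : ℝ[X]) :
    polyOp T (p + q) = polyOp T p + polyOp T q := by
  simp [polyOp]

theorem polyOp_one (T : H →L[𝕜] H) : polyOp T 1 = 1 := by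
  simp [polyOp]

theorem polyOp_X (T : H →L[𝕜] H) : polyOp T X = T := by
  simp [polyOp]

theorem polyOp_C (T : H →L[𝕜] H) (c : ℝ) : polyOp T (C c) = (c : 𝕜) • (1 : H →L[𝕜] H) := by
  simp [polyOp, Algebra.algebraMap_eq_smul_one]

theorem polyOp_mul_apply (T : H →L[𝕜] H) (p q : ℝ[X]) (x : H) :
    polyOp T (p * q) x = polyOp T p (polyOp T q x) := by
  rw [polyOp_mul]; rfl

theorem polyOp_X_mul_apply (T : H →L[𝕜] H) (p : ℝ[X]) (x : H) :
    polyOp T (X * p) x = T (polyOp T p x) := by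
  rw [polyOp_mul_apply, polyOp_X]

theorem polyOp_C_mul_apply (T : H →L[𝕜] H) (c : ℝ) (p : ℝ[X]) (x : H) :
    polyOp T (C c * p) x = (c : 𝕜) • polyOp T p x := by
  rw [polyOp_mul_apply, polyOp_C]; rfl

/-- Polynomials of `T` intertwine with every operator that intertwines `T`. -/
theorem polyOp_intertwine {H' : Type*} [NormedAddCommGroup H'] [InnerProductSpace 𝕜 H']
    {T : H →L[𝕜] H} {T' : H' →L[𝕜] H'} {S : H →L[𝕜] H'}
    (h : ∀ x, S (T x) = T' (S x)) (p : ℝ[X]) (x : H) :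
    S (polyOp T p x) = polyOp T' p (S x) := by
  induction p using Polynomial.induction_on generalizing x with
  | C a => simp [polyOp_C]
  | add p q hp hq => simp [polyOp_add, hp, hq]
  | monomial k a ih =>
    have e : (C a * X ^ (k + 1) : ℝ[X]) = X * (C a * X ^ k) := by ring
    rw [e, polyOp_X_mul_apply, polyOp_X_mul_apply, h, ih]

theorem polyOp_comm_apply (T : H →L[𝕜] H) (p q : ℝ[X]) (x : H) :
    polyOp T p (polyOp T q x) = polyOp T q (polyOp T p x) := by
  rw [← polyOp_mul_apply, ← polyOp_mul_apply, mul_comm]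

variable [CompleteSpace H]

theorem inner_polyOp_left {T : H →L[𝕜] H} (hT : T.IsPositive) (p : ℝ[X]) (x y : H) :
    inner 𝕜 (polyOp T p x) y = inner 𝕜 x (polyOp T p y) :=
  (polyOp_isSelfAdjoint hT.isSelfAdjoint p).isSymmetric x y

/-- Polynomials that are nonnegative on `[0, ‖T‖]` give positive operators. -/
theorem re_inner_polyOp_nonneg {T : H →L[𝕜] H} (hT : T.IsPositive) (p : ℝ[X])
    (hp : ∀ t ∈ Set.Icc (0 : ℝ) ‖T‖, 0 ≤ p.eval t) (x : H) :
    0 ≤ RCLike.re (inner 𝕜 x (polyOp T p x)) := by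
  obtain ⟨c, hc⟩ := (isCompact_Icc (a := (0 : ℝ)) (b := ‖T‖)).bddAbove_image
    (p.continuous.continuousOn)
  have hc' : ∀ t ∈ Set.Icc (0 : ℝ) ‖T‖, p.eval t ≤ c := fun t ht => hc ⟨t, ht, rfl⟩
  have hc0 : 0 ≤ c := (hp 0 ⟨le_rfl, norm_nonneg _⟩).trans (hc' 0 ⟨le_rfl, norm_nonneg _⟩)
  -- Positivity comes from the norm bound alone: `0 ≤ c - p ≤ c` on the spectral interval gives `⟨x,
  -- (c - p(T))x⟩ ≤ c‖x‖²`, that is `⟨x, p(T)x⟩ ≥ 0`.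
  have h1 : ‖polyOp T (C c - p)‖ ≤ c := by
    refine norm_polyOp_le hT _ hc0 fun t ht => ?_
    rw [eval_sub, eval_C, abs_le]
    have := hp t ht
    have := hc' t ht
    constructor <;> linarith
  have h2 : RCLike.re (inner 𝕜 x (polyOp T (C c - p) x)) ≤ c * ‖x‖ ^ 2 := by
    refine (RCLike.re_le_norm _).trans ((norm_inner_le_norm _ _).trans ?_)
    have := (polyOp T (C c - p)).le_of_opNorm_le h1 x
    nlinarith [norm_nonneg x]
  rw [polyOp_sub, polyOp_C] at h2
  simp only [sub_apply, smul_apply,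
    one_apply_eq_self, inner_sub_right, inner_smul_right, map_sub,
    RCLike.re_ofReal_mul, inner_self_eq_norm_sq] at h2
  linarith

theorem re_inner_polyOp_le {T : H →L[𝕜] H} (hT : T.IsPositive) (p q : ℝ[X])
    (hp : ∀ t ∈ Set.Icc (0 : ℝ) ‖T‖, p.eval t ≤ q.eval t) (x : H) :
    RCLike.re (inner 𝕜 x (polyOp T p x)) ≤ RCLike.re (inner 𝕜 x (polyOp T q x)) := by
  have := re_inner_polyOp_nonneg hT (q - p) (fun t ht => by simpa using hp t ht) x
  rw [polyOp_sub] at this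
  simpa [inner_sub_right] using this

end PolyOp

/-! ### The normal operator `n⁻¹A*A` and the centred component noise. -/

section NormalOp

open scoped ComplexOrder

variable {𝕜 : Type*} [RCLike 𝕜] {n : ℕ}
  {E : Type*} [NormedAddCommGroup E] [InnerProductSpace 𝕜 E] [CompleteSpace E]
  {Y : Fin n → Type*} [∀ i, NormedAddCommGroup (Y i)] [∀ i, InnerProductSpace 𝕜 (Y i)]
  [∀ i, CompleteSpace (Y i)]

theorem normalOp_apply (A : E →L[𝕜] PiLp 2 Y) (x : E) :
    normalOp A x = (n : 𝕜)⁻¹ • A.adjoint (A x) := rfl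

theorem adjoint_apply_apply (hn : 0 < n) (A : E →L[𝕜] PiLp 2 Y) (x : E) :
    A.adjoint (A x) = (n : 𝕜) • normalOp A x := by
  have : (n : 𝕜) ≠ 0 := by exact_mod_cast hn.ne'
  rw [normalOp_apply, smul_inv_smul₀ this]

theorem normalOp_isPositive (A : E →L[𝕜] PiLp 2 Y) : (normalOp A).IsPositive := by
  have h := ContinuousLinearMap.isPositive_adjoint_comp_self A
  have h2 : (0 : 𝕜) ≤ (n : 𝕜)⁻¹ := by
    rw [← RCLike.ofReal_natCast, ← RCLike.ofReal_inv, RCLike.ofReal_nonneg]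
    positivity
  exact h.smul_of_nonneg h2

theorem norm_normalOp (A : E →L[𝕜] PiLp 2 Y) : ‖normalOp A‖ = (n : ℝ)⁻¹ * ‖A‖ ^ 2 := by
  rw [normalOp, norm_smul, ContinuousLinearMap.norm_adjoint_comp_self, norm_inv,
    RCLike.norm_natCast]
  ring

/-- `n⁻¹ A A*`. -/
def dualOp (A : E →L[𝕜] PiLp 2 Y) : PiLp 2 Y →L[𝕜] PiLp 2 Y :=
  (n : 𝕜)⁻¹ • (A.comp A.adjoint)

theorem dualOp_apply (A : E →L[𝕜] PiLp 2 Y) (y : PiLp 2 Y) :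
    dualOp A y = (n : 𝕜)⁻¹ • A (A.adjoint y) := rfl

theorem dualOp_isPositive (A : E →L[𝕜] PiLp 2 Y) : (dualOp A).IsPositive := by
  have h := ContinuousLinearMap.isPositive_self_comp_adjoint A
  have h2 : (0 : 𝕜) ≤ (n : 𝕜)⁻¹ := by
    rw [← RCLike.ofReal_natCast, ← RCLike.ofReal_inv, RCLike.ofReal_nonneg]
    positivity
  exact h.smul_of_nonneg h2

theorem norm_dualOp (A : E →L[𝕜] PiLp 2 Y) : ‖dualOp A‖ = ‖normalOp A‖ := by
  have := ContinuousLinearMap.norm_adjoint_comp_self A.adjoint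
  rw [ContinuousLinearMap.adjoint_adjoint] at this
  rw [norm_normalOp, dualOp, norm_smul, this, norm_inv, RCLike.norm_natCast,
    LinearIsometryEquiv.norm_map]
  ring

theorem apply_polyOp_normalOp (A : E →L[𝕜] PiLp 2 Y) (p : ℝ[X]) (x : E) :
    A (polyOp (normalOp A) p x) = polyOp (dualOp A) p (A x) :=
  polyOp_intertwine (fun x => by simp [normalOp_apply, dualOp_apply]) p x

/-- `‖A p(B) x‖² = n ⟨x, B p(B)² x⟩`. -/
theorem norm_apply_polyOp_sq (hn : 0 < n) (A : E →L[𝕜] PiLp 2 Y) (p : ℝ[X]) (x : E) :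
    ‖A (polyOp (normalOp A) p x)‖ ^ 2
      = n * RCLike.re (inner 𝕜 x (polyOp (normalOp A) (X * p ^ 2) x)) := by
  have hB := normalOp_isPositive A
  have e : (X * p ^ 2 : ℝ[X]) = p * (X * p) := by ring
  rw [← inner_self_eq_norm_sq (𝕜 := 𝕜), ← ContinuousLinearMap.adjoint_inner_right,
    adjoint_apply_apply hn, inner_smul_right, e, polyOp_mul_apply, ← inner_polyOp_left hB,
    polyOp_X_mul_apply, ← RCLike.ofReal_natCast, RCLike.re_ofReal_mul]

/-- The squared norm is the quadratic form of `n t p(t)²` at `B`, which is monotone in `p²` on the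
spectral interval. -/
theorem norm_apply_polyOp_mono (hn : 0 < n) (A : E →L[𝕜] PiLp 2 Y) (p q : ℝ[X])
    (h : ∀ t ∈ Set.Icc (0 : ℝ) ‖normalOp A‖, p.eval t ^ 2 ≤ q.eval t ^ 2) (x : E) :
    ‖A (polyOp (normalOp A) p x)‖ ≤ ‖A (polyOp (normalOp A) q x)‖ := by
  refine le_of_sq_le_sq ?_ (norm_nonneg _)
  rw [norm_apply_polyOp_sq hn, norm_apply_polyOp_sq hn]
  refine mul_le_mul_of_nonneg_left (re_inner_polyOp_le (normalOp_isPositive A) _ _ ?_ x)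
    (by positivity)
  intro t ht
  simp only [eval_mul, eval_X, eval_pow]
  exact mul_le_mul_of_nonneg_left (h t ht) ht.1

theorem norm_apply_polyOp_le (hn : 0 < n) (A : E →L[𝕜] PiLp 2 Y) (p : ℝ[X]) {c : ℝ}
    (hc : 0 ≤ c) (h : ∀ t ∈ Set.Icc (0 : ℝ) ‖normalOp A‖, t * p.eval t ^ 2 ≤ c) (x : E) :
    ‖A (polyOp (normalOp A) p x)‖ ≤ √(n * c) * ‖x‖ := by
  refine le_of_sq_le_sq ?_ (by positivity)
  rw [norm_apply_polyOp_sq hn, mul_pow, Real.sq_sqrt (by positivity), mul_assoc]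
  refine mul_le_mul_of_nonneg_left ?_ (by positivity)
  refine (RCLike.re_le_norm _).trans ((norm_inner_le_norm _ _).trans ?_)
  have h1 : ‖polyOp (normalOp A) (X * p ^ 2)‖ ≤ c := by
    refine norm_polyOp_le (normalOp_isPositive A) _ hc fun t ht => ?_
    simp only [eval_mul, eval_X, eval_pow]
    rw [abs_of_nonneg (mul_nonneg ht.1 (sq_nonneg _))]
    exact h t ht
  have := (polyOp (normalOp A) (X * p ^ 2)).le_of_opNorm_le h1 x
  nlinarith [norm_nonneg x]

theorem norm_comp_polyOp_le (hn : 0 < n) (A : E →L[𝕜] PiLp 2 Y) (p : ℝ[X]) {c : ℝ}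
    (hc : 0 ≤ c) (h : ∀ t ∈ Set.Icc (0 : ℝ) ‖normalOp A‖, t * p.eval t ^ 2 ≤ c) :
    ‖A.comp (polyOp (normalOp A) p)‖ ≤ √(n * c) :=
  ContinuousLinearMap.opNorm_le_bound _ (by positivity) (norm_apply_polyOp_le hn A p hc h)

theorem norm_polyOp_adjoint_apply_le' (A : E →L[𝕜] PiLp 2 Y) (p : ℝ[X])
    (y : PiLp 2 Y) :
    ‖polyOp (normalOp A) p (A.adjoint y)‖ ≤ ‖A.comp (polyOp (normalOp A) p)‖ * ‖y‖ := by
  have h1 : (polyOp (normalOp A) p).comp A.adjoint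
      = (A.comp (polyOp (normalOp A) p)).adjoint := by
    rw [ContinuousLinearMap.adjoint_comp,
      (polyOp_isSelfAdjoint (normalOp_isPositive A).isSelfAdjoint p).adjoint_eq]
  have h2 := ((polyOp (normalOp A) p).comp A.adjoint).le_opNorm y
  rw [h1, LinearIsometryEquiv.norm_map, ← h1] at h2
  exact h2

theorem norm_polyOp_adjoint_apply_le (hn : 0 < n) (A : E →L[𝕜] PiLp 2 Y) (p : ℝ[X]) {c : ℝ}
    (hc : 0 ≤ c) (h : ∀ t ∈ Set.Icc (0 : ℝ) ‖normalOp A‖, t * p.eval t ^ 2 ≤ c)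
    (y : PiLp 2 Y) :
    ‖polyOp (normalOp A) p (A.adjoint y)‖ ≤ √(n * c) * ‖y‖ :=
  (norm_polyOp_adjoint_apply_le' A p y).trans
    (mul_le_mul_of_nonneg_right (norm_comp_polyOp_le hn A p hc h) (norm_nonneg _))

/-- Since `A p(B) A* = n (pX)(n⁻¹AA*)`, the calculus of the dual operator applies, and `‖n⁻¹AA*‖ =
‖B‖`. -/
theorem norm_apply_polyOp_adjoint_le (hn : 0 < n) (A : E →L[𝕜] PiLp 2 Y) (p : ℝ[X]) {c : ℝ}
    (hc : 0 ≤ c) (h : ∀ t ∈ Set.Icc (0 : ℝ) ‖normalOp A‖, t * |p.eval t| ≤ c)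
    (y : PiLp 2 Y) :
    ‖A (polyOp (normalOp A) p (A.adjoint y))‖ ≤ n * c * ‖y‖ := by
  have hn' : (n : 𝕜) ≠ 0 := by exact_mod_cast hn.ne'
  have h1 : A (polyOp (normalOp A) p (A.adjoint y))
      = (n : 𝕜) • polyOp (dualOp A) (p * X) y := by
    rw [apply_polyOp_normalOp, polyOp_mul_apply, polyOp_X, dualOp_apply, map_smul,
      smul_inv_smul₀ hn']
  rw [h1, norm_smul, RCLike.norm_natCast, mul_assoc]
  refine mul_le_mul_of_nonneg_left ?_ (by positivity)
  refine ContinuousLinearMap.le_of_opNorm_le _ ?_ y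
  refine norm_polyOp_le (dualOp_isPositive A) _ hc fun t ht => ?_
  rw [norm_dualOp] at ht
  rw [eval_mul, eval_X, abs_mul, abs_of_nonneg ht.1, mul_comm]
  exact h t ht

theorem maxSq_nonneg (A : E →L[𝕜] PiLp 2 Y) : 0 ≤ maxSq A :=
  Real.iSup_nonneg fun _ => sq_nonneg _

theorem norm_comp_sq_le (A : E →L[𝕜] PiLp 2 Y) (i : Fin n) : ‖comp A i‖ ^ 2 ≤ maxSq A :=
  le_ciSup (f := fun i => ‖comp A i‖ ^ 2) (Set.finite_range _).bddAbove i

theorem norm_comp_le (A : E →L[𝕜] PiLp 2 Y) (i : Fin n) : ‖comp A i‖ ≤ √(maxSq A) :=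
  Real.le_sqrt_of_sq_le (norm_comp_sq_le A i)

theorem comp_apply (A : E →L[𝕜] PiLp 2 Y) (i : Fin n) (x : E) : comp A i x = A x i := rfl

theorem norm_apply_sq_eq_sum (A : E →L[𝕜] PiLp 2 Y) (x : E) :
    ‖A x‖ ^ 2 = ∑ i, ‖comp A i x‖ ^ 2 :=
  PiLp.norm_sq_eq_of_L2 Y (A x)

theorem norm_sq_le_maxSq (A : E →L[𝕜] PiLp 2 Y) : ‖A‖ ^ 2 ≤ n * maxSq A := by
  have h : ‖A‖ ≤ √(n * maxSq A) := by
    refine A.opNorm_le_bound (by positivity) fun x => ?_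
    refine le_of_sq_le_sq ?_ (by positivity)
    rw [mul_pow, Real.sq_sqrt (mul_nonneg (by positivity) (maxSq_nonneg A)), norm_apply_sq_eq_sum]
    calc ∑ i, ‖comp A i x‖ ^ 2 ≤ ∑ _i : Fin n, maxSq A * ‖x‖ ^ 2 := by
          refine Finset.sum_le_sum fun i _ => ?_
          calc ‖comp A i x‖ ^ 2 ≤ (‖comp A i‖ * ‖x‖) ^ 2 := by
                gcongr; exact (comp A i).le_opNorm x
            _ = ‖comp A i‖ ^ 2 * ‖x‖ ^ 2 := by ring
            _ ≤ _ := by gcongr; exact norm_comp_sq_le A i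
      _ = _ := by simp; ring
  calc ‖A‖ ^ 2 ≤ √(n * maxSq A) ^ 2 := by gcongr
    _ = _ := Real.sq_sqrt (mul_nonneg (by positivity) (maxSq_nonneg A))

theorem norm_normalOp_le_maxSq (hn : 0 < n) (A : E →L[𝕜] PiLp 2 Y) :
    ‖normalOp A‖ ≤ maxSq A := by
  rw [norm_normalOp, inv_mul_le_iff₀ (by exact_mod_cast hn)]
  exact norm_sq_le_maxSq A

/-- The deviation `A_i* A_i - B` of a component gradient from the mean. -/
def noiseOp (A : E →L[𝕜] PiLp 2 Y) (i : Fin n) : E →L[𝕜] E :=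
  (comp A i).adjoint.comp (comp A i) - normalOp A

theorem noiseOp_apply (A : E →L[𝕜] PiLp 2 Y) (i : Fin n) (x : E) :
    noiseOp A i x = (comp A i).adjoint (comp A i x) - normalOp A x := rfl

theorem sum_adjoint_comp (A : E →L[𝕜] PiLp 2 Y) (y : PiLp 2 Y) :
    ∑ i, (comp A i).adjoint (y i) = A.adjoint y := by
  refine ext_inner_right 𝕜 fun v => ?_
  rw [sum_inner, ContinuousLinearMap.adjoint_inner_left, PiLp.inner_apply]
  refine Finset.sum_congr rfl fun i _ => ?_
  rw [ContinuousLinearMap.adjoint_inner_left, comp_apply]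

theorem sum_noiseOp (hn : 0 < n) (A : E →L[𝕜] PiLp 2 Y) (x : E) :
    ∑ i, noiseOp A i x = 0 := by
  have h := sum_adjoint_comp A (A x)
  simp only [noiseOp_apply, Finset.sum_sub_distrib, comp_apply]
  rw [h, adjoint_apply_apply hn, Finset.sum_const, Finset.card_univ, Fintype.card_fin,
    Nat.cast_smul_eq_nsmul, sub_self]

theorem adjoint_comp_eq (A : E →L[𝕜] PiLp 2 Y) (i : Fin n) (z : Y i) :
    (comp A i).adjoint z = A.adjoint (PiLp.single 2 i z) := by
  classical
  rw [← sum_adjoint_comp]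
  rw [Finset.sum_eq_single i]
  · simp
  · intro j _ hj
    simp [hj]
  · simp

variable {Z : Type*} [NormedAddCommGroup Z] [InnerProductSpace 𝕜 Z]

/-- `A_i*` is `A*` restricted to the isometrically embedded `i`-th factor. This form keeps `‖S A*‖`,
which decays when `S` is a power of `R`; the primed variant pays a factor `√L` and keeps `‖S‖`, for
use when `S` already contains `A`. -/
theorem norm_comp_adjoint_le (A : E →L[𝕜] PiLp 2 Y) (S : E →L[𝕜] Z) (i : Fin n) (z : Y i) :
    ‖S ((comp A i).adjoint z)‖ ≤ ‖S.comp A.adjoint‖ * ‖z‖ := by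
  have h := (S.comp A.adjoint).le_opNorm (PiLp.single 2 i z)
  rw [PiLp.norm_single] at h
  rw [adjoint_comp_eq]
  exact h

theorem norm_comp_adjoint_le' (A : E →L[𝕜] PiLp 2 Y) (S : E →L[𝕜] Z) (i : Fin n) (z : Y i) :
    ‖S ((comp A i).adjoint z)‖ ≤ ‖S‖ * √(maxSq A) * ‖z‖ := by
  refine (S.le_opNorm _).trans ?_
  rw [mul_assoc]
  refine mul_le_mul_of_nonneg_left ?_ (norm_nonneg _)
  refine ContinuousLinearMap.le_of_opNorm_le _ ?_ z
  rw [LinearIsometryEquiv.norm_map]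
  exact norm_comp_le A i

/-- A variance is at most the second moment: `N_i x` is `A_i*A_i x` minus its mean `Bx`, and
discarding the squared mean leaves `∑ ‖S A_i*(A_i x)‖²`. -/
theorem sum_norm_noiseOp_sq_le (hn : 0 < n) (A : E →L[𝕜] PiLp 2 Y) (S : E →L[𝕜] Z) {c : ℝ}
    (h : ∀ (i : Fin n) (z : Y i), ‖S ((comp A i).adjoint z)‖ ≤ c * ‖z‖) (x : E) :
    ∑ i, ‖S (noiseOp A i x)‖ ^ 2 ≤ c ^ 2 * ‖A x‖ ^ 2 := by
  have hpt : ∀ i, ‖S (noiseOp A i x)‖ ^ 2 = ‖S ((comp A i).adjoint (comp A i x))‖ ^ 2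
      - 2 * RCLike.re (inner 𝕜 (S (noiseOp A i x)) (S (normalOp A x)))
      - ‖S (normalOp A x)‖ ^ 2 := by
    intro i
    have e : (comp A i).adjoint (comp A i x) = noiseOp A i x + normalOp A x := by
      rw [noiseOp_apply]; abel
    rw [e, map_add, @norm_add_sq 𝕜]
    ring
  have h0 : ∑ i, RCLike.re (inner 𝕜 (S (noiseOp A i x)) (S (normalOp A x))) = 0 := by
    rw [← map_sum, ← sum_inner, ← map_sum, sum_noiseOp hn, map_zero, inner_zero_left, map_zero]
  calc ∑ i, ‖S (noiseOp A i x)‖ ^ 2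
      ≤ ∑ i, (‖S ((comp A i).adjoint (comp A i x))‖ ^ 2
      - 2 * RCLike.re (inner 𝕜 (S (noiseOp A i x)) (S (normalOp A x)))) := by
        refine Finset.sum_le_sum fun i _ => ?_
        rw [hpt i]
        linarith [sq_nonneg ‖S (normalOp A x)‖]
    _ = ∑ i, ‖S ((comp A i).adjoint (comp A i x))‖ ^ 2 := by
        rw [Finset.sum_sub_distrib, ← Finset.mul_sum, h0]; ring
    _ ≤ ∑ i, c ^ 2 * ‖comp A i x‖ ^ 2 := by
        refine Finset.sum_le_sum fun i _ => ?_
        rw [← mul_pow]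
        exact pow_le_pow_left₀ (norm_nonneg _) (h i _) 2
    _ = _ := by rw [← Finset.mul_sum, norm_apply_sq_eq_sum]

/-- Both `A_i*A_i` and `B` begin with a factor `A*`, so a smoothing operator `S` acts on `A*`; the
remaining factors are bounded by `√L` because `n⁻¹‖A‖ ≤ √L`. -/
theorem norm_noiseOp_le (hn : 0 < n) (A : E →L[𝕜] PiLp 2 Y) (S : E →L[𝕜] Z) (i : Fin n) (x : E) :
    ‖S (noiseOp A i x)‖ ≤ 2 * ‖S.comp A.adjoint‖ * √(maxSq A) * ‖x‖ := by
  have hn1 : (1 : ℝ) ≤ n := by exact_mod_cast hn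
  have hL := maxSq_nonneg A
  have h1 : ‖S ((comp A i).adjoint (comp A i x))‖ ≤ ‖S.comp A.adjoint‖ * (√(maxSq A) * ‖x‖) := by
    refine (norm_comp_adjoint_le A S i _).trans ?_
    gcongr
    exact (comp A i).le_of_opNorm_le (norm_comp_le A i) x
  have hA : (n : ℝ)⁻¹ * ‖A‖ ≤ √(maxSq A) := by
    rw [inv_mul_le_iff₀ (by positivity)]
    refine le_of_sq_le_sq ?_ (by positivity)
    rw [mul_pow, Real.sq_sqrt hL]
    have := norm_sq_le_maxSq A
    nlinarith [mul_nonneg hL (sub_nonneg.2 hn1)]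
  have h2 : ‖S (normalOp A x)‖ ≤ ‖S.comp A.adjoint‖ * (√(maxSq A) * ‖x‖) := by
    rw [normalOp_apply, map_smul, norm_smul, norm_inv, RCLike.norm_natCast]
    calc (n : ℝ)⁻¹ * ‖S (A.adjoint (A x))‖
        ≤ (n : ℝ)⁻¹ * (‖S.comp A.adjoint‖ * (‖A‖ * ‖x‖)) := by
          gcongr
          refine ((S.comp A.adjoint).le_opNorm (A x)).trans ?_
          gcongr
          exact A.le_opNorm x
      _ = ‖S.comp A.adjoint‖ * (((n : ℝ)⁻¹ * ‖A‖) * ‖x‖) := by ring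
      _ ≤ _ := by gcongr
  rw [noiseOp_apply, map_sub]
  refine (norm_sub_le _ _).trans ?_
  linarith

theorem norm_polyOp_comp_adjoint (A : E →L[𝕜] PiLp 2 Y) (p : ℝ[X]) :
    ‖(polyOp (normalOp A) p).comp A.adjoint‖ = ‖A.comp (polyOp (normalOp A) p)‖ := by
  have h1 : (polyOp (normalOp A) p).comp A.adjoint
      = (A.comp (polyOp (normalOp A) p)).adjoint := by
    rw [ContinuousLinearMap.adjoint_comp,
      (polyOp_isSelfAdjoint (normalOp_isPositive A).isSelfAdjoint p).adjoint_eq]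
  rw [h1, LinearIsometryEquiv.norm_map]

end NormalOp

/-! ### Scalar estimates: spectral suprema, series, and discrete convolutions. -/

section RealBounds

theorem one_sub_pow_le_exp {x : ℝ} (hx : x ≤ 1) (r : ℕ) : (1 - x) ^ r ≤ Real.exp (-(r * x)) := by
  have h : 1 - x ≤ Real.exp (-x) := by
    have := Real.add_one_le_exp (-x); linarith
  calc (1 - x) ^ r ≤ Real.exp (-x) ^ r := pow_le_pow_left₀ (by linarith) h r
    _ = _ := by rw [← Real.exp_nat_mul]; congr 1; ring

/-- Bernoulli: `(1 - x)^r (1 + rx) ≤ ((1 - x)(1 + x))^r ≤ 1`, to which `x(1 - x)^r ≤ x`-type terms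
are compared. -/
theorem mul_one_sub_pow_le {x : ℝ} (h0 : 0 ≤ x) (h1 : x ≤ 1) (r : ℕ) :
    x * (1 - x) ^ r ≤ 1 / (r + 1) := by
  have hB : 1 + r * x ≤ (1 + x) ^ r := one_add_mul_le_pow (by linarith) r
  have h2 : (1 - x) ^ r * (1 + x) ^ r ≤ 1 := by
    rw [← mul_pow]
    exact pow_le_one₀ (by nlinarith) (by nlinarith)
  have h3 : (1 - x) ^ r * (1 + r * x) ≤ 1 :=
    (mul_le_mul_of_nonneg_left hB (pow_nonneg (by linarith) r)).trans h2
  have h4 : (1 - x) ^ r ≤ 1 := pow_le_one₀ (by linarith) (by linarith)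
  have h5 : 0 ≤ (1 - x) ^ r := pow_nonneg (by linarith) r
  rw [le_div_iff₀ (by positivity)]
  nlinarith

theorem mul_exp_neg_le (y : ℝ) : y * Real.exp (-y) ≤ Real.exp (-1) := by
  have h : y ≤ Real.exp (y - 1) := by
    have := Real.add_one_le_exp (y - 1); linarith
  calc y * Real.exp (-y) ≤ Real.exp (y - 1) * Real.exp (-y) := by gcongr
    _ = _ := by rw [← Real.exp_add]; congr 1; ring

theorem exp_neg_one_le : Real.exp (-1) ≤ 2 / 5 := by
  rw [Real.exp_neg, inv_le_comm₀ (Real.exp_pos 1) (by norm_num)]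
  have := Real.exp_one_gt_d9
  norm_num at this ⊢
  linarith

theorem mul_one_sub_pow_two_mul_le {x : ℝ} (h0 : 0 ≤ x) (h1 : x ≤ 1) {r : ℕ} (hr : 0 < r) :
    x * (1 - x) ^ (2 * r) ≤ 1 / (5 * r) := by
  have hr' : (0 : ℝ) < r := by exact_mod_cast hr
  have h2 := one_sub_pow_le_exp h1 (2 * r)
  have h3 := (mul_exp_neg_le (((2 * r : ℕ) : ℝ) * x)).trans exp_neg_one_le
  push_cast at h2 h3
  rw [le_div_iff₀ (by positivity)]
  have h4 : x * (1 - x) ^ (2 * r) ≤ x * Real.exp (-(2 * r * x)) := by gcongr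
  nlinarith

theorem mul_one_sub_pow_sq_le {x : ℝ} (h0 : 0 ≤ x) (h1 : x ≤ 1) {r : ℕ} (hr : 0 < r) :
    (x * (1 - x) ^ r) ^ 2 ≤ (4 / 25) / r ^ 2 := by
  have hr' : (0 : ℝ) < r := by exact_mod_cast hr
  have h2 := one_sub_pow_le_exp h1 r
  have h3 := (mul_exp_neg_le (r * x)).trans exp_neg_one_le
  have h4 : x * (1 - x) ^ r ≤ x * Real.exp (-(r * x)) := by gcongr
  have h5 : x * (1 - x) ^ r ≤ (2 / 5) / r := by
    rw [le_div_iff₀ hr']; nlinarith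
  have h6 : 0 ≤ x * (1 - x) ^ r := mul_nonneg h0 (pow_nonneg (by linarith) r)
  calc (x * (1 - x) ^ r) ^ 2 ≤ ((2 / 5) / r) ^ 2 := by gcongr
    _ = _ := by ring

/-- Raise `u ≤ exp u` with `u = kx/ν` to the power `ν`, and use `(1 - x)^k ≤ exp(-kx)`. -/
theorem rpow_mul_one_sub_pow_le {ν x : ℝ} (hν : 0 < ν) (h0 : 0 ≤ x) (h1 : x ≤ 1) {k : ℕ}
    (hk : 0 < k) : x ^ ν * (1 - x) ^ k ≤ ν ^ ν * (k : ℝ) ^ (-ν) := by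
  have hk' : (0 : ℝ) < k := by exact_mod_cast hk
  have h2 := one_sub_pow_le_exp h1 k
  have h3 : k * x / ν ≤ Real.exp (k * x / ν) := by
    have := Real.add_one_le_exp (k * x / ν); linarith
  have h4 : (k * x / ν) ^ ν ≤ Real.exp (k * x) := by
    calc (k * x / ν) ^ ν ≤ Real.exp (k * x / ν) ^ ν :=
          Real.rpow_le_rpow (by positivity) h3 hν.le
      _ = Real.exp (k * x) := by
          rw [← Real.exp_mul]; congr 1; field_simp
  rw [Real.div_rpow (by positivity) hν.le, Real.mul_rpow hk'.le h0,
    div_le_iff₀ (Real.rpow_pos_of_pos hν ν)] at h4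
  have h5 : x ^ ν * (1 - x) ^ k ≤ x ^ ν * Real.exp (-(k * x)) := by gcongr
  refine h5.trans ?_
  have h6 : x ^ ν = (k : ℝ) ^ (-ν) * ((k : ℝ) ^ ν * x ^ ν) := by
    rw [← mul_assoc, ← Real.rpow_add hk']; simp
  rw [h6]
  calc (k : ℝ) ^ (-ν) * ((k : ℝ) ^ ν * x ^ ν) * Real.exp (-(k * x))
      ≤ (k : ℝ) ^ (-ν) * (Real.exp (k * x) * ν ^ ν) * Real.exp (-(k * x)) := by gcongr
    _ = ν ^ ν * (k : ℝ) ^ (-ν) * (Real.exp (k * x) * Real.exp (-(k * x))) := by ring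
    _ = _ := by rw [← Real.exp_add]; simp

theorem sum_le_of_le_const {N : ℕ} {f : ℕ → ℝ} {c : ℝ} (h : ∀ r < N, f r ≤ c) :
    ∑ r ∈ Finset.range N, f r ≤ N * c := by
  have := Finset.sum_le_card_nsmul (Finset.range N) f c (fun r hr => h r (Finset.mem_range.1 hr))
  simpa using this

theorem sum_inv_le (N : ℕ) :
    ∑ r ∈ Finset.range N, 1 / ((r : ℝ) + 1) ≤ 1 + Real.log N := by
  have h := harmonic_le_one_add_log N
  have e : ((harmonic N : ℚ) : ℝ) = ∑ r ∈ Finset.range N, 1 / ((r : ℝ) + 1) := by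
    simp [harmonic]
  rwa [e] at h

theorem sum_inv_sqrt_le (N : ℕ) :
    ∑ r ∈ Finset.range N, 1 / √((r : ℝ) + 1) ≤ 2 * √N := by
  induction N with
  | zero => simp
  | succ N ih =>
    rw [Finset.sum_range_succ]
    have h1 : (0 : ℝ) < √((N : ℝ) + 1) := Real.sqrt_pos.2 (by positivity)
    have h2 : √((N : ℝ) + 1) ^ 2 = N + 1 := Real.sq_sqrt (by positivity)
    have h3 : √(N : ℝ) ^ 2 = N := Real.sq_sqrt (by positivity)
    have h4 : 1 / √((N : ℝ) + 1) ≤ 2 * √((N : ℝ) + 1) - 2 * √(N : ℝ) := by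
      rw [div_le_iff₀ h1]
      nlinarith [sq_nonneg (√((N : ℝ) + 1) - √(N : ℝ))]
    push_cast
    linarith

theorem sum_inv_sq_le (N : ℕ) :
    ∑ r ∈ Finset.range N, 1 / ((r : ℝ) + 1) ^ 2 ≤ 2 := by
  suffices h : ∑ r ∈ Finset.range N, 1 / ((r : ℝ) + 1) ^ 2 ≤ 2 - 1 / (N : ℝ) by
    have : (0 : ℝ) ≤ 1 / (N : ℝ) := by positivity
    linarith
  induction N with
  | zero => simp
  | succ N ih =>
    rw [Finset.sum_range_succ]
    rcases Nat.eq_zero_or_pos N with rfl | hN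
    · norm_num
    have hN : (0 : ℝ) < N := by exact_mod_cast hN
    have h : 1 / ((N : ℝ) + 1) ^ 2 ≤ 1 / (N : ℝ) - 1 / ((N : ℝ) + 1) := by
      have e : 1 / (N : ℝ) - 1 / ((N : ℝ) + 1) = 1 / (N * ((N : ℝ) + 1)) := by field_simp; ring
      rw [e]
      refine one_div_le_one_div_of_le (by positivity) (by nlinarith)
    push_cast
    linarith

/-- The telescoping step behind series of type `∑ r^(-3/2)`: with `s² = N` and `s'² = N + 1` it
bounds one term by a difference of `2/√N`. -/
theorem sq_sub_sq_div_cube_le {s s' : ℝ} (hs : 0 < s) (h : s ≤ s') :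
    (s' ^ 2 - s ^ 2) / (s' ^ 2 * s') ≤ 2 / s - 2 / s' := by
  have hs' : 0 < s' := hs.trans_le h
  rw [div_sub_div _ _ hs.ne' hs'.ne', div_le_div_iff₀ (by positivity) (by positivity)]
  have : 0 ≤ s' * (s' - s) * (2 * s' ^ 2 - s * (s' + s)) :=
    mul_nonneg (mul_nonneg hs'.le (by linarith)) (by nlinarith)
  nlinarith

theorem sum_inv_mul_sqrt_le (N : ℕ) :
    ∑ r ∈ Finset.range N, 1 / (((r : ℝ) + 1) * √((r : ℝ) + 1)) ≤ 3 := by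
  suffices h : ∑ r ∈ Finset.range N, 1 / (((r : ℝ) + 1) * √((r : ℝ) + 1)) ≤ 3 - 2 / √(N : ℝ) by
    have : (0 : ℝ) ≤ 2 / √(N : ℝ) := by positivity
    linarith
  induction N with
  | zero => simp
  | succ N ih =>
    rw [Finset.sum_range_succ]
    rcases Nat.eq_zero_or_pos N with rfl | hN
    · norm_num
    have hN : (0 : ℝ) < N := by exact_mod_cast hN
    have h1 : (0 : ℝ) < √((N : ℝ) + 1) := Real.sqrt_pos.2 (by positivity)
    have h1' : (0 : ℝ) < √(N : ℝ) := Real.sqrt_pos.2 (by positivity)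
    have h2 : √((N : ℝ) + 1) ^ 2 = N + 1 := Real.sq_sqrt (by positivity)
    have h3 : √(N : ℝ) ^ 2 = N := Real.sq_sqrt (by positivity)
    have h4 : √(N : ℝ) ≤ √((N : ℝ) + 1) := Real.sqrt_le_sqrt (by linarith)
    have h : 1 / (((N : ℝ) + 1) * √((N : ℝ) + 1)) ≤ 2 / √(N : ℝ) - 2 / √((N : ℝ) + 1) := by
      have := sq_sub_sq_div_cube_le h1' h4
      rw [h2, h3] at this
      simpa using this
    push_cast
    linarith

theorem cast_sub_one_sub {j k : ℕ} (h : j < k) : ((k - 1 - j : ℕ) : ℝ) + 1 = k - j := by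
  rw [Nat.sub_sub, add_comm 1 j, Nat.cast_sub h]; push_cast; ring

theorem sqrt_add_le {x y : ℝ} (hx : 0 ≤ x) (hy : 0 ≤ y) : √(x + y) ≤ √x + √y := by
  rw [Real.sqrt_le_left (by positivity)]
  nlinarith [Real.sq_sqrt hx, Real.sq_sqrt hy, mul_nonneg (Real.sqrt_nonneg x) (Real.sqrt_nonneg y)]

/-- With `x = k - j` and `y = j + 1`, `x + y = k + 1` gives `√(k+1) ≤ √x + √y`. This splits the
product `1/√x · 1/√y` into partial fractions with a gain of `1/√(k+1)`, and each piece sums to at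
most `2√k`. -/
theorem sum_sqrt_conv_sqrt_le (k : ℕ) :
    ∑ j ∈ Finset.range k, 1 / √(((k - 1 - j : ℕ) : ℝ) + 1) * (1 / √((j : ℝ) + 1)) ≤ 8 := by
  have h1 : ∀ j ∈ Finset.range k, 1 / √(((k - 1 - j : ℕ) : ℝ) + 1) * (1 / √((j : ℝ) + 1))
      ≤ 2 / √((k : ℝ) + 1) * (1 / √(((k - 1 - j : ℕ) : ℝ) + 1) + 1 / √((j : ℝ) + 1)) := by
    intro j hj
    have hjk := cast_sub_one_sub (Finset.mem_range.1 hj)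
    set x := ((k - 1 - j : ℕ) : ℝ) + 1
    have hx : 0 < x := by positivity
    set y := (j : ℝ) + 1
    have hy : 0 < y := by positivity
    have hs : √((k : ℝ) + 1) ≤ √x + √y := by
      have : (k : ℝ) + 1 = x + y := by rw [hjk]; ring
      rw [this]; exact sqrt_add_le hx.le hy.le
    have hx' := Real.sqrt_pos.2 hx
    have hy' := Real.sqrt_pos.2 hy
    have hk' : 0 < √((k : ℝ) + 1) := Real.sqrt_pos.2 (by positivity)
    have e : 1 / √x + 1 / √y = (√x + √y) * (1 / √x * (1 / √y)) := by field_simp; ring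
    rw [e, ← mul_assoc]
    refine le_mul_of_one_le_left (by positivity) ?_
    rw [div_mul_eq_mul_div, le_div_iff₀ hk']
    linarith
  refine (Finset.sum_le_sum h1).trans ?_
  rw [← Finset.mul_sum, Finset.sum_add_distrib,
    Finset.sum_range_reflect (fun j => 1 / √((j : ℝ) + 1)) k]
  have h2 := sum_inv_sqrt_le k
  have hk' : 0 < √((k : ℝ) + 1) := Real.sqrt_pos.2 (by positivity)
  have h3 : √(k : ℝ) ≤ √((k : ℝ) + 1) := Real.sqrt_le_sqrt (by linarith)
  rw [div_mul_eq_mul_div, div_le_iff₀ hk']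
  linarith

/-- The same splitting of `√(k+1)` yields a harmonic sum, the source of the logarithm, plus the
convolution bounded by `8`. -/
theorem sum_sqrt_conv_inv_le (k : ℕ) :
    ∑ j ∈ Finset.range k, 1 / √(((k - 1 - j : ℕ) : ℝ) + 1) * (1 / ((j : ℝ) + 1))
      ≤ (9 + Real.log k) / √((k : ℝ) + 1) := by
  have hk' : 0 < √((k : ℝ) + 1) := Real.sqrt_pos.2 (by positivity)
  rw [le_div_iff₀ hk', Finset.sum_mul]
  have h1 : ∀ j ∈ Finset.range k,
      1 / √(((k - 1 - j : ℕ) : ℝ) + 1) * (1 / ((j : ℝ) + 1)) * √((k : ℝ) + 1)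
      ≤ 1 / ((j : ℝ) + 1) + 1 / √(((k - 1 - j : ℕ) : ℝ) + 1) * (1 / √((j : ℝ) + 1)) := by
    intro j hj
    have hjk := cast_sub_one_sub (Finset.mem_range.1 hj)
    set x := ((k - 1 - j : ℕ) : ℝ) + 1
    have hx : 0 < x := by positivity
    set y := (j : ℝ) + 1
    have hy : 0 < y := by positivity
    have hs : √((k : ℝ) + 1) ≤ √x + √y := by
      have : (k : ℝ) + 1 = x + y := by rw [hjk]; ring
      rw [this]; exact sqrt_add_le hx.le hy.le
    have hx' := Real.sqrt_pos.2 hx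
    have hy' := Real.sqrt_pos.2 hy
    have hyy : √y * √y = y := Real.mul_self_sqrt hy.le
    calc 1 / √x * (1 / y) * √((k : ℝ) + 1) ≤ 1 / √x * (1 / y) * (√x + √y) := by gcongr
      _ = 1 / y + 1 / √x * (√y / y) := by field_simp
      _ = _ := by
        congr 2
        rw [div_eq_div_iff hy.ne' hy'.ne', hyy, one_mul]
  refine (Finset.sum_le_sum h1).trans ?_
  rw [Finset.sum_add_distrib]
  have := sum_inv_le k
  have := sum_sqrt_conv_sqrt_le k
  linarith

/-- Multiplying by `k + 1 = x + y` leaves `y^(-3/2) + x^(-1)y^(-1/2)`; the mixed term is at most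
`x^(-3/2) + y^(-3/2)`, and each of these series is at most `3`. -/
theorem sum_inv_conv_le (k : ℕ) :
    ∑ j ∈ Finset.range k, 1 / (((k - 1 - j : ℕ) : ℝ) + 1) * (1 / (((j : ℝ) + 1) * √((j : ℝ) + 1)))
      ≤ 9 / ((k : ℝ) + 1) := by
  rw [le_div_iff₀ (by positivity), Finset.sum_mul]
  have h1 : ∀ j ∈ Finset.range k,
      1 / (((k - 1 - j : ℕ) : ℝ) + 1) * (1 / (((j : ℝ) + 1) * √((j : ℝ) + 1))) * ((k : ℝ) + 1)
      ≤ 2 * (1 / (((j : ℝ) + 1) * √((j : ℝ) + 1)))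
        + 1 / ((((k - 1 - j : ℕ) : ℝ) + 1) * √(((k - 1 - j : ℕ) : ℝ) + 1)) := by
    intro j hj
    have hjk := cast_sub_one_sub (Finset.mem_range.1 hj)
    set x := ((k - 1 - j : ℕ) : ℝ) + 1
    have hx : 0 < x := by positivity
    set y := (j : ℝ) + 1
    have hy : 0 < y := by positivity
    have hx' := Real.sqrt_pos.2 hx
    have hy' := Real.sqrt_pos.2 hy
    have e : (k : ℝ) + 1 = x + y := by rw [hjk]; ring
    have h2 : 1 / (x * √y) ≤ 1 / (y * √y) + 1 / (x * √x) := by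
      rcases le_total x y with h | h
      · have : 1 / (x * √y) ≤ 1 / (x * √x) := by gcongr
        have : 0 < 1 / (y * √y) := by positivity
        linarith
      · have : 1 / (x * √y) ≤ 1 / (y * √y) := by gcongr
        have : 0 < 1 / (x * √x) := by positivity
        linarith
    calc 1 / x * (1 / (y * √y)) * ((k : ℝ) + 1) = 1 / (y * √y) + 1 / (x * √y) := by
          rw [e]; field_simp
      _ ≤ _ := by linarith
  refine (Finset.sum_le_sum h1).trans ?_
  rw [Finset.sum_add_distrib, ← Finset.mul_sum,
    Finset.sum_range_reflect (fun j => 1 / (((j : ℝ) + 1) * √((j : ℝ) + 1))) k]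
  have := sum_inv_mul_sqrt_le k
  linarith

/-- A bound for the `L²` kernels of the pathwise analysis. -/
theorem cube_mul_one_sub_pow_le {b c t : ℝ} (hc : 0 < c) (ht : 0 ≤ t) (htb : t ≤ b)
    (hcb : c * b ≤ 1) (r : ℕ) :
    t ^ 3 * ((1 - c * t) ^ r) ^ 2 ≤ (b / (1 + r * (c * b / 2))) ^ 3 := by
  have hb : 0 ≤ b := ht.trans htb
  have hx0 : 0 ≤ c * t := by positivity
  have hx1 : c * t ≤ 1 := (mul_le_mul_of_nonneg_left htb hc.le).trans hcb
  set x := c * t with hx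
  -- From `(1 - x)(1 + x/2)² = 1 - 3x²/4 - x³/4 ≤ 1` and Bernoulli. It turns the power into a
  -- rational function, after which monotonicity of `t ↦ t/(1 + rct/2)` replaces `t` by its upper
  -- bound `b`.
  have h1 : (1 - x) ^ r * (1 + r * (x / 2)) ^ 2 ≤ 1 := by
    have h2 : 1 + r * (x / 2) ≤ (1 + x / 2) ^ r := one_add_mul_le_pow (by linarith) r
    calc (1 - x) ^ r * (1 + r * (x / 2)) ^ 2 ≤ (1 - x) ^ r * ((1 + x / 2) ^ r) ^ 2 := by
          gcongr
      _ = ((1 - x) * (1 + x / 2) ^ 2) ^ r := by rw [mul_pow, ← pow_mul, ← pow_mul, mul_comm r 2]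
      _ ≤ 1 := pow_le_one₀ (mul_nonneg (by linarith) (sq_nonneg _)) (by nlinarith [pow_nonneg hx0 3])
  have hd : 1 ≤ 1 + r * (x / 2) := by
    have : 0 ≤ r * (x / 2) := by positivity
    linarith
  have h3 : ((1 - x) ^ r) ^ 2 * (1 + r * (x / 2)) ^ 3 ≤ 1 := by
    calc ((1 - x) ^ r) ^ 2 * (1 + r * (x / 2)) ^ 3
        ≤ ((1 - x) ^ r) ^ 2 * (1 + r * (x / 2)) ^ 4 := by gcongr; norm_num
      _ = ((1 - x) ^ r * (1 + r * (x / 2)) ^ 2) ^ 2 := by ring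
      _ ≤ 1 := pow_le_one₀ (mul_nonneg (pow_nonneg (by linarith) r) (sq_nonneg _)) h1
  have h4 : t / (1 + r * (x / 2)) ≤ b / (1 + r * (c * b / 2)) := by
    rw [div_le_div_iff₀ (by positivity) (by positivity), hx]
    nlinarith
  calc t ^ 3 * ((1 - x) ^ r) ^ 2
      = (t / (1 + r * (x / 2))) ^ 3 * (((1 - x) ^ r) ^ 2 * (1 + r * (x / 2)) ^ 3) := by
        field_simp
    _ ≤ (t / (1 + r * (x / 2))) ^ 3 * 1 := by gcongr
    _ ≤ _ := by rw [mul_one]; gcongr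

/-- The mass is of order `√b` without any logarithm: the term `r = 0` costs at most `√b` since `cb ≤
1`, and the others telescope against `4√b/√(1 + rcb/2)`. Keeping the factor `√b` is what later
produces `‖A‖` and matches the step size condition. -/
theorem sum_path_kernel_le {b c : ℝ} (hc : 0 < c) (hb : 0 ≤ b) (hcb : c * b ≤ 1) (N : ℕ) :
    ∑ r ∈ Finset.range N, c * √((b / (1 + r * (c * b / 2))) ^ 3) ≤ 5 * √b := by
  have hsq : ∀ r : ℕ, √((b / (1 + r * (c * b / 2))) ^ 3)
      = b / (1 + r * (c * b / 2)) * (√b / √(1 + r * (c * b / 2))) := by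
    intro r
    rw [← Real.sqrt_div hb, pow_succ, Real.sqrt_mul (by positivity), Real.sqrt_sq (by positivity)]
  cases N with
  | zero => simp
  | succ N =>
    suffices h : ∑ r ∈ Finset.range (N + 1), c * √((b / (1 + r * (c * b / 2))) ^ 3)
        ≤ √b * (5 - 4 / √(1 + N * (c * b / 2))) by
      refine h.trans ?_
      have : 0 ≤ √b * (4 / √(1 + N * (c * b / 2))) := by positivity
      linarith
    induction N with
    | zero =>
      have := hsq 0
      simp only [Nat.cast_zero, zero_mul, add_zero, div_one, Real.sqrt_one] at this
      simp only [zero_add, Finset.sum_range_one, Nat.cast_zero, zero_mul, add_zero, div_one,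
        Real.sqrt_one, this]
      nlinarith [Real.sqrt_nonneg b]
    | succ N ih =>
      rw [Finset.sum_range_succ, hsq]
      set g := c * b / 2 with hg
      have hg0 : 0 ≤ g := by positivity
      have ha : (0 : ℝ) < 1 + N * g := by positivity
      have ha' : (0 : ℝ) < 1 + ((N + 1 : ℕ) : ℝ) * g := by positivity
      have hs := Real.sqrt_pos.2 ha
      have hs' := Real.sqrt_pos.2 ha'
      have e1 := Real.sq_sqrt ha.le
      have e2 := Real.sq_sqrt ha'.le
      have hle : √(1 + N * g) ≤ √(1 + ((N + 1 : ℕ) : ℝ) * g) :=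
        Real.sqrt_le_sqrt (by push_cast; nlinarith)
      have hgs : √(1 + ((N + 1 : ℕ) : ℝ) * g) ^ 2 - √(1 + N * g) ^ 2 = g := by
        rw [e1, e2]; push_cast; ring
      have hcb' : c * b = 2 * g := by rw [hg]; ring
      have key : c * (b / (1 + ((N + 1 : ℕ) : ℝ) * g) * (√b / √(1 + ((N + 1 : ℕ) : ℝ) * g)))
          ≤ √b * (4 / √(1 + N * g) - 4 / √(1 + ((N + 1 : ℕ) : ℝ) * g)) := by
        have e3 : c * (b / (1 + ((N + 1 : ℕ) : ℝ) * g) * (√b / √(1 + ((N + 1 : ℕ) : ℝ) * g)))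
            = √b * ((c * b) / ((1 + ((N + 1 : ℕ) : ℝ) * g) * √(1 + ((N + 1 : ℕ) : ℝ) * g))) := by
          field_simp
        have := sq_sub_sq_div_cube_le hs hle
        rw [hgs, e2] at this
        rw [e3, hcb']
        refine mul_le_mul_of_nonneg_left ?_ (Real.sqrt_nonneg b)
        have e4 : 2 * g / ((1 + ((N + 1 : ℕ) : ℝ) * g) * √(1 + ((N + 1 : ℕ) : ℝ) * g))
          = 2 * (g / ((1 + ((N + 1 : ℕ) : ℝ) * g) * √(1 + ((N + 1 : ℕ) : ℝ) * g))) := by ring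
        rw [e4]
        have e5 : ∀ z : ℝ, 4 / z = 2 * (2 / z) := fun z => by ring
        rw [e5, e5]
        linarith
      linarith

/-- The long-range form of the kernel: the dependence on `b` is given up in favour of `c`, so that
the bound is uniform in the operator. -/
theorem path_kernel_le {b c : ℝ} (hc : 0 < c) (hb : 0 ≤ b) (hcb : c * b ≤ 1) (r : ℕ) :
    √((b / (1 + r * (c * b / 2))) ^ 3)
      ≤ (2 / c) * √(2 / c) * (1 / (((r : ℝ) + 1) * √((r : ℝ) + 1))) := by
  have h : b / (1 + r * (c * b / 2)) ≤ (2 / c) / ((r : ℝ) + 1) := by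
    rw [div_div, div_le_div_iff₀ (by positivity) (by positivity)]
    nlinarith
  calc √((b / (1 + r * (c * b / 2))) ^ 3) ≤ √(((2 / c) / ((r : ℝ) + 1)) ^ 3) :=
        Real.sqrt_le_sqrt (by gcongr)
    _ = (2 / c) / ((r : ℝ) + 1) * (√(2 / c) / √((r : ℝ) + 1)) := by
        rw [← Real.sqrt_div (by positivity), pow_succ, Real.sqrt_mul (by positivity),
          Real.sqrt_sq (by positivity)]
    _ = _ := by field_simp

end RealBounds

/-! ### Discrete Volterra inequalities with kernel of mass less than one. -/

section Volterra

variable {a b k : ℕ → ℝ} {ρ : ℝ}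

/-- `B/(1 - ρ)` is the fixed point of `x ↦ B + ρx`, so strong induction reproduces it. -/
theorem volterra_bounded (hk0 : ∀ m, 0 ≤ k m)
    (h : ∀ K, a K ≤ b K + ∑ J ∈ Finset.range K, k (K - 1 - J) * a J)
    (hk : ∀ N, ∑ m ∈ Finset.range N, k m ≤ ρ) (hρ : ρ < 1) {B : ℝ} (hB : 0 ≤ B)
    (hb : ∀ K, b K ≤ B) (K : ℕ) : a K ≤ B / (1 - ρ) := by
  induction K using Nat.strong_induction_on with
  | _ K ih =>
  have hB' : 0 ≤ B / (1 - ρ) := div_nonneg hB (by linarith)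
  have h1 : ∑ J ∈ Finset.range K, k (K - 1 - J) * a J ≤ ρ * (B / (1 - ρ)) := by
    calc ∑ J ∈ Finset.range K, k (K - 1 - J) * a J
        ≤ ∑ J ∈ Finset.range K, k (K - 1 - J) * (B / (1 - ρ)) :=
          Finset.sum_le_sum fun J hJ =>
            mul_le_mul_of_nonneg_left (ih J (Finset.mem_range.1 hJ)) (hk0 _)
      _ = (∑ J ∈ Finset.range K, k J) * (B / (1 - ρ)) := by
          rw [← Finset.sum_mul, Finset.sum_range_reflect k K]
      _ ≤ _ := mul_le_mul_of_nonneg_right (hk K) hB'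
  have h2 : B + ρ * (B / (1 - ρ)) = B / (1 - ρ) := by
    have : 1 - ρ ≠ 0 := by linarith
    field_simp; ring
  linarith [h K, hb K]

/-- Young's inequality in `ℓ¹`: after exchanging the order of summation the convolution has mass at
most `ρ ∑ a`, which is absorbed on the left. -/
theorem volterra_summable (ha0 : ∀ K, 0 ≤ a K)
    (h : ∀ K, a K ≤ b K + ∑ J ∈ Finset.range K, k (K - 1 - J) * a J)
    (hk : ∀ N, ∑ m ∈ Finset.range N, k m ≤ ρ) (hρ : ρ < 1) {B : ℝ}
    (hb : ∀ N, ∑ K ∈ Finset.range N, b K ≤ B) (N : ℕ) :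
    ∑ K ∈ Finset.range N, a K ≤ B / (1 - ρ) := by
  have h1 : ∑ K ∈ Finset.range N, ∑ J ∈ Finset.range K, k (K - 1 - J) * a J
      ≤ ρ * ∑ J ∈ Finset.range N, a J := by
    have e : ∑ K ∈ Finset.range N, ∑ J ∈ Finset.range K, k (K - 1 - J) * a J
        = ∑ J ∈ Finset.range N, ∑ K ∈ Finset.Ico (J + 1) N, k (K - 1 - J) * a J := by
      refine Finset.sum_comm' fun x y => ?_
      simp only [Finset.mem_range, Finset.mem_Ico]
      omega
    rw [e, Finset.mul_sum]
    refine Finset.sum_le_sum fun J _ => ?_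
    rw [← Finset.sum_mul]
    refine mul_le_mul_of_nonneg_right ?_ (ha0 J)
    rw [Finset.sum_Ico_eq_sum_range]
    refine le_of_eq_of_le (Finset.sum_congr rfl fun m _ => ?_) (hk (N - (J + 1)))
    congr 1
    omega
  have h2 : ∑ K ∈ Finset.range N, a K ≤ B + ρ * ∑ J ∈ Finset.range N, a J := by
    calc ∑ K ∈ Finset.range N, a K
        ≤ ∑ K ∈ Finset.range N, (b K + ∑ J ∈ Finset.range K, k (K - 1 - J) * a J) :=
          Finset.sum_le_sum fun K _ => h K
      _ ≤ _ := by rw [Finset.sum_add_distrib]; linarith [hb N]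
  rw [le_div_iff₀ (by linarith)]
  linarith

/-- Decay of the solutions of a Volterra inequality whose kernel has small mass: `w` is the rate,
and `u` bounds the kernel at long range. -/
theorem volterra_decay {w u : ℕ → ℝ} {D C₁ C₂ θ : ℝ} (ha0 : ∀ K, 0 ≤ a K) (hk0 : ∀ m, 0 ≤ k m)
    (h : ∀ K, a K ≤ b K + ∑ J ∈ Finset.range K, k (K - 1 - J) * a J)
    (hk : ∀ N, ∑ m ∈ Finset.range N, k m ≤ ρ) (hw : ∀ K, 0 ≤ w K)
    (hD : ∀ K, ∀ J < K, K + 1 ≤ 2 * (J + 1) → w J ≤ D * w K) (hD0 : 0 ≤ D)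
    (hu0 : ∀ K, 0 ≤ u K) (hu : ∀ K, ∀ J < K, 2 * (J + 1) < K + 1 → k (K - 1 - J) ≤ u K)
    (hθ : D * ρ ≤ θ) (hθ1 : θ < 1) (hC₁ : 0 ≤ C₁) (hC₂ : 0 ≤ C₂)
    (hb : ∀ K, b K ≤ C₁ * w K) (hfar : ∀ K, u K * ∑ J ∈ Finset.range K, a J ≤ C₂ * w K)
    (K : ℕ) : a K ≤ (C₁ + C₂) / (1 - θ) * w K := by
  induction K using Nat.strong_induction_on with
  | _ K ih =>
  set C := (C₁ + C₂) / (1 - θ) with hC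
  have hC0 : 0 ≤ C := div_nonneg (by linarith) (by linarith)
  have h1 : ∑ J ∈ Finset.range K, k (K - 1 - J) * a J
      ≤ ∑ J ∈ Finset.range K, (k (K - 1 - J) * (C * D * w K) + u K * a J) := by
    refine Finset.sum_le_sum fun J hJ => ?_
    have hJ := Finset.mem_range.1 hJ
    have hCDw : 0 ≤ C * D * w K := mul_nonneg (mul_nonneg hC0 hD0) (hw K)
    -- Recent terms: `w J ≤ D w K`, and the kernel mass leaves a factor `Dρ ≤ θ < 1` for the
    -- induction. Old terms: the kernel itself is below `u K`, and a crude bound on `∑ a J`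
    -- suffices.
    by_cases hJK : K + 1 ≤ 2 * (J + 1)
    · have h3 : a J ≤ C * D * w K := by
        refine (ih J hJ).trans ?_
        rw [mul_assoc]
        exact mul_le_mul_of_nonneg_left (hD K J hJ hJK) hC0
      have := mul_le_mul_of_nonneg_left h3 (hk0 (K - 1 - J))
      have := mul_nonneg (hu0 K) (ha0 J)
      linarith
    · have := mul_le_mul_of_nonneg_right (hu K J hJ (by omega)) (ha0 J)
      have := mul_nonneg (hk0 (K - 1 - J)) hCDw
      linarith
  have h2 : ∑ J ∈ Finset.range K, (k (K - 1 - J) * (C * D * w K) + u K * a J)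
      ≤ ρ * (C * D * w K) + C₂ * w K := by
    rw [Finset.sum_add_distrib, ← Finset.sum_mul, ← Finset.mul_sum,
      Finset.sum_range_reflect k K]
    have := mul_le_mul_of_nonneg_right (hk K) (mul_nonneg (mul_nonneg hC0 hD0) (hw K))
    linarith [hfar K]
  have h3 : ρ * (C * D * w K) ≤ θ * C * w K := by
    have := mul_le_mul_of_nonneg_right hθ (mul_nonneg hC0 (hw K))
    linarith
  have h4 : C₁ + C₂ = C * (1 - θ) := by
    have : 1 - θ ≠ 0 := by linarith
    rw [hC]; field_simp
  have h5 : C₁ * w K + C₂ * w K = C * (1 - θ) * w K := by rw [← h4]; ring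
  linarith [h K, hb K]

end Volterra

/-! ### Landweber polynomials and variation of constants. -/

/-- The residual polynomial `(1 - c t) ^ r` of the Landweber iteration. -/
def resPoly (c : ℝ) (r : ℕ) : ℝ[X] := (1 - C c * X) ^ r

/-- The filter polynomial `∑_{s < r} (1 - c t) ^ s` of the Landweber iteration. -/
def geoPoly (c : ℝ) (r : ℕ) : ℝ[X] := ∑ s ∈ Finset.range r, resPoly c s

theorem eval_resPoly (c : ℝ) (r : ℕ) (t : ℝ) : (resPoly c r).eval t = (1 - c * t) ^ r := by
  simp [resPoly]

theorem resPoly_zero (c : ℝ) : resPoly c 0 = 1 := by simp [resPoly]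

theorem resPoly_add (c : ℝ) (r s : ℕ) : resPoly c (r + s) = resPoly c r * resPoly c s :=
  pow_add _ _ _

theorem resPoly_succ (c : ℝ) (r : ℕ) : resPoly c (r + 1) = resPoly c r * resPoly c 1 :=
  resPoly_add c r 1

theorem eval_geoPoly (c : ℝ) (r : ℕ) (t : ℝ) :
    (geoPoly c r).eval t = ∑ s ∈ Finset.range r, (1 - c * t) ^ s := by
  simp [geoPoly, eval_finsetSum, eval_resPoly]

theorem geoPoly_zero (c : ℝ) : geoPoly c 0 = 0 := by simp [geoPoly]

theorem geoPoly_succ (c : ℝ) (r : ℕ) : geoPoly c (r + 1) = geoPoly c r + resPoly c r := by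
  simp [geoPoly, Finset.sum_range_succ]

theorem C_mul_X_mul_geoPoly (c : ℝ) (r : ℕ) : C c * X * geoPoly c r = 1 - resPoly c r := by
  induction r with
  | zero => simp [geoPoly_zero, resPoly_zero]
  | succ r ih =>
    rw [geoPoly_succ, mul_add, ih, resPoly_succ]
    simp only [resPoly, pow_one]
    ring

theorem geoPoly_succ' (c : ℝ) (r : ℕ) : geoPoly c (r + 1) = resPoly c 1 * geoPoly c r + 1 := by
  have h := C_mul_X_mul_geoPoly c r
  have e : resPoly c 1 = 1 - C c * X := by simp [resPoly]
  rw [geoPoly_succ, e, sub_mul, one_mul, h]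
  ring

section Landweber

variable {𝕜 : Type*} [RCLike 𝕜] {E : Type*} [NormedAddCommGroup E] [InnerProductSpace 𝕜 E]

theorem polyOp_resPoly_one_apply (T : E →L[𝕜] E) (c : ℝ) (x : E) :
    polyOp T (resPoly c 1) x = x - (c : 𝕜) • T x := by
  have e : resPoly c 1 = 1 - C c * X := by simp [resPoly]
  rw [e, polyOp_sub, polyOp_one, sub_apply, polyOp_C_mul_apply, polyOp_X]
  rfl

theorem polyOp_resPoly_zero_apply (T : E →L[𝕜] E) (c : ℝ) (x : E) :
    polyOp T (resPoly c 0) x = x := by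
  rw [resPoly_zero, polyOp_one]; rfl

theorem polyOp_geoPoly_zero_apply (T : E →L[𝕜] E) (c : ℝ) (x : E) :
    polyOp T (geoPoly c 0) x = 0 := by
  simp [geoPoly_zero, polyOp]

theorem polyOp_resPoly_succ_apply (T : E →L[𝕜] E) (c : ℝ) (r : ℕ) (x : E) :
    polyOp T (resPoly c (r + 1)) x = polyOp T (resPoly c r) (polyOp T (resPoly c 1) x) := by
  rw [resPoly_succ, polyOp_mul_apply]

theorem polyOp_geoPoly_succ_apply (T : E →L[𝕜] E) (c : ℝ) (r : ℕ) (x : E) :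
    polyOp T (geoPoly c (r + 1)) x
      = polyOp T (resPoly c 1) (polyOp T (geoPoly c r) x) + x := by
  rw [geoPoly_succ', polyOp_add, add_apply, polyOp_mul_apply, polyOp_one]
  rfl

/-- Variation of constants for the perturbed Landweber iteration. -/
theorem landweber_unroll (T : E →L[𝕜] E) (c : ℝ) {u v : ℕ → E} {G : E}
    (h : ∀ t, u (t + 1) = polyOp T (resPoly c 1) (u t) + G - v t) (t : ℕ) :
    u t = polyOp T (resPoly c t) (u 0) + polyOp T (geoPoly c t) G
      - ∑ s ∈ Finset.range t, polyOp T (resPoly c (t - 1 - s)) (v s) := by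
  induction t with
  | zero => simp [polyOp_resPoly_zero_apply, polyOp_geoPoly_zero_apply]
  | succ t ih =>
    have hs : ∑ s ∈ Finset.range (t + 1), polyOp T (resPoly c (t + 1 - 1 - s)) (v s)
        = polyOp T (resPoly c 1) (∑ s ∈ Finset.range t, polyOp T (resPoly c (t - 1 - s)) (v s))
          + v t := by
      rw [Finset.sum_range_succ, map_sum, Nat.add_sub_cancel, Nat.sub_self,
        polyOp_resPoly_zero_apply]
      congr 1
      refine Finset.sum_congr rfl fun s hs => ?_
      have := Finset.mem_range.1 hs
      rw [← polyOp_mul_apply, ← resPoly_add]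
      congr 3
      omega
    have hr : polyOp T (resPoly c (t + 1)) (u 0)
        = polyOp T (resPoly c 1) (polyOp T (resPoly c t) (u 0)) := by
      rw [polyOp_resPoly_succ_apply, polyOp_comm_apply]
    rw [h, ih, hs, polyOp_geoPoly_succ_apply, hr, map_sub, map_add]
    abel

end Landweber

/-! ### Error recursion of SVRG and its adaptedness to the index sequence. -/

section Recursion

variable {𝕜 : Type*} [RCLike 𝕜] {n : ℕ}
  {E : Type*} [NormedAddCommGroup E] [InnerProductSpace 𝕜 E] [CompleteSpace E]
  {Y : Fin n → Type*} [∀ i, NormedAddCommGroup (Y i)] [∀ i, InnerProductSpace 𝕜 (Y i)]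
  [∀ i, CompleteSpace (Y i)]

theorem iterate_mul (A : E →L[𝕜] PiLp 2 Y) (y : PiLp 2 Y) (x0 : E) (c₀ : ℝ) {M : ℕ} (hM : 0 < M)
    (j : ℕ → Fin n) (K : ℕ) : iterate A y x0 c₀ M j (K * M) = anchor A y x0 c₀ M j K := by
  simp [iterate, Nat.mul_div_cancel K hM, innerLoop]

theorem iterate_zero (A : E →L[𝕜] PiLp 2 Y) (y : PiLp 2 Y) (x0 : E) (c₀ : ℝ) (M : ℕ)
    (j : ℕ → Fin n) : iterate A y x0 c₀ M j 0 = x0 := by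
  simp [iterate, innerLoop, anchor]

theorem iterate_succ (A : E →L[𝕜] PiLp 2 Y) (y : PiLp 2 Y) (x0 : E) (c₀ : ℝ) {M : ℕ} (hM : 0 < M)
    (j : ℕ → Fin n) (k : ℕ) :
    iterate A y x0 c₀ M j (k + 1) = iterate A y x0 c₀ M j k - (c₀ : 𝕜) •
      ((comp A (j k)).adjoint (comp A (j k)
        (iterate A y x0 c₀ M j k - iterate A y x0 c₀ M j (k / M * M)))
        + fullGrad A y (iterate A y x0 c₀ M j (k / M * M))) := by
  have hk : k / M * M + k % M = k := by rw [mul_comm]; exact Nat.div_add_mod k M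
  have hlt := Nat.mod_lt k hM
  have key : iterate A y x0 c₀ M j (k + 1)
      = innerLoop A y c₀ (fun t => j (k / M * M + t)) (anchor A y x0 c₀ M j (k / M))
        (k % M + 1) := by
    rcases Nat.lt_or_ge (k % M + 1) M with h | h
    · have e : k + 1 = (k % M + 1) + k / M * M := by omega
      have h1 : (k + 1) / M = k / M := by
        rw [e, Nat.add_mul_div_right _ _ hM, Nat.div_eq_of_lt h, zero_add]
      have h2 : (k + 1) % M = k % M + 1 := by
        rw [e, Nat.add_mul_mod_self_right, Nat.mod_eq_of_lt h]
      rw [iterate, h1, h2]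
    · have hMe : k % M + 1 = M := by omega
      have e : k + 1 = (k / M + 1) * M := by rw [add_mul, one_mul]; omega
      rw [hMe, e, iterate_mul A y x0 c₀ hM, anchor]
  -- The space `Y i` depends on the index, so the index is replaced by generalizing it rather than
  -- by rewriting.
  have hstep : ∀ i, i = j k → ∀ x z : E,
      x - (c₀ : 𝕜) • ((comp A i).adjoint (comp A i (x - z)) + fullGrad A y z)
      = x - (c₀ : 𝕜) • ((comp A (j k)).adjoint (comp A (j k) (x - z)) + fullGrad A y z) := by
    rintro _ rfl x z; rfl
  rw [key, innerLoop, iterate_mul A y x0 c₀ hM]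
  exact hstep _ (by rw [hk]) _ _

variable {A : E →L[𝕜] PiLp 2 Y} {yd ξ : PiLp 2 Y} {x0 xd : E} {c₀ : ℝ} {M : ℕ}

theorem fullGrad_eq (hA : A.adjoint (A xd - yd) = 0) (z : E) :
    fullGrad A (yd + ξ) z = normalOp A (z - xd) - (n : 𝕜)⁻¹ • A.adjoint ξ := by
  have e : A z - (yd + ξ) = A (z - xd) + (A xd - yd) - ξ := by rw [map_sub]; abel
  rw [fullGrad, e, map_sub, map_add, hA, add_zero, smul_sub, normalOp_apply]

/-- The error `x_k - x_†` as a function of the index sequence. -/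
def err (A : E →L[𝕜] PiLp 2 Y) (y : PiLp 2 Y) (x0 xd : E) (c₀ : ℝ) (M : ℕ) (j : ℕ → Fin n)
    (k : ℕ) : E :=
  iterate A y x0 c₀ M j k - xd

theorem err_zero (y : PiLp 2 Y) (j : ℕ → Fin n) : err A y x0 xd c₀ M j 0 = x0 - xd := by
  rw [err, iterate_zero]

/-- The anchor gradient is `B(e_k - d_k) - n⁻¹A*ξ`, so the stochastic term `A_i*A_i d_k` combines
with `-B d_k` into the centred noise `N_i d_k`, and the drift is exactly Landweber. -/
theorem err_succ (hM : 0 < M) (hA : A.adjoint (A xd - yd) = 0) (j : ℕ → Fin n) (k : ℕ) :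
    err A (yd + ξ) x0 xd c₀ M j (k + 1)
      = polyOp (normalOp A) (resPoly c₀ 1) (err A (yd + ξ) x0 xd c₀ M j k)
        + (c₀ : 𝕜) • (n : 𝕜)⁻¹ • A.adjoint ξ
        - (c₀ : 𝕜) • noiseOp A (j k)
          (err A (yd + ξ) x0 xd c₀ M j k - err A (yd + ξ) x0 xd c₀ M j (k / M * M)) := by
  rw [polyOp_resPoly_one_apply, noiseOp_apply]
  simp only [err]
  rw [iterate_succ A (yd + ξ) x0 c₀ hM, fullGrad_eq hA]
  set a := iterate A (yd + ξ) x0 c₀ M j k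
  set b := iterate A (yd + ξ) x0 c₀ M j (k / M * M)
  have e : a - xd - (b - xd) = a - b := by abel
  have e2 : normalOp A (b - xd) = normalOp A (a - xd) - normalOp A (a - b) := by
    rw [← map_sub]; congr 1; abel
  rw [e, e2]
  simp only [smul_add, smul_sub]
  abel

/-- The increment over the anchor point. -/
def incr (A : E →L[𝕜] PiLp 2 Y) (y : PiLp 2 Y) (x0 xd : E) (c₀ : ℝ) (M : ℕ) (j : ℕ → Fin n)
    (k : ℕ) : E :=
  err A y x0 xd c₀ M j k - err A y x0 xd c₀ M j (k / M * M)

/-- The full gradient at the anchor point of epoch `K`. -/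
def grad (A : E →L[𝕜] PiLp 2 Y) (ξ : PiLp 2 Y) (y : PiLp 2 Y) (x0 xd : E) (c₀ : ℝ) (M : ℕ)
    (j : ℕ → Fin n) (K : ℕ) : E :=
  normalOp A (err A y x0 xd c₀ M j (K * M)) - (n : 𝕜)⁻¹ • A.adjoint ξ

theorem mul_add_div {t : ℕ} (K : ℕ) (ht : t < M) : (K * M + t) / M = K := by
  have hM : 0 < M := by omega
  rw [add_comm, Nat.add_mul_div_right _ _ hM, Nat.div_eq_of_lt ht, zero_add]

theorem incr_eq {t : ℕ} (y : PiLp 2 Y) (j : ℕ → Fin n) (K : ℕ) (ht : t < M) :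
    incr A y x0 xd c₀ M j (K * M + t)
      = err A y x0 xd c₀ M j (K * M + t) - err A y x0 xd c₀ M j (K * M) := by
  rw [incr, mul_add_div K ht]

/-- The recursion of the increments inside an epoch. -/
theorem sub_anchor_succ (hM : 0 < M) (hA : A.adjoint (A xd - yd) = 0) (j : ℕ → Fin n) (K : ℕ)
    {t : ℕ} (ht : t < M) :
    err A (yd + ξ) x0 xd c₀ M j (K * M + (t + 1)) - err A (yd + ξ) x0 xd c₀ M j (K * M)
      = polyOp (normalOp A) (resPoly c₀ 1) (incr A (yd + ξ) x0 xd c₀ M j (K * M + t))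
        - (c₀ : 𝕜) • grad A ξ (yd + ξ) x0 xd c₀ M j K
        - (c₀ : 𝕜) • noiseOp A (j (K * M + t)) (incr A (yd + ξ) x0 xd c₀ M j (K * M + t)) := by
  rw [← add_assoc, err_succ hM hA, incr_eq _ _ _ ht, mul_add_div K ht, grad]
  set a := err A (yd + ξ) x0 xd c₀ M j (K * M + t)
  set b := err A (yd + ξ) x0 xd c₀ M j (K * M)
  simp only [smul_sub, map_sub, polyOp_resPoly_one_apply]
  abel

/-- Adaptedness to the filtration of the indices, in deterministic form: dependence on the first `k`
coordinates plays the part of measurability. -/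
theorem dependsOn_err (hM : 0 < M) (hA : A.adjoint (A xd - yd) = 0) (k : ℕ) :
    DependsOn (fun j => err A (yd + ξ) x0 xd c₀ M j k) (Set.Iio k) := by
  induction k using Nat.strong_induction_on with
  | _ k ih =>
  intro j j' h
  cases k with
  | zero => simp [err_zero]
  | succ k =>
    have h1 := ih k (Nat.lt_succ_self k) (x := j) (y := j')
      (fun i hi => h i (Nat.lt_succ_of_lt hi))
    have hle : k / M * M ≤ k := Nat.div_mul_le_self k M
    have h2 := ih (k / M * M) (Nat.lt_succ_of_le hle) (x := j) (y := j')
      (fun i hi => h i (Nat.lt_succ_of_lt (lt_of_lt_of_le hi hle)))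
    simp only at h1 h2
    simp only [err_succ hM hA]
    rw [h1, h2, h k (Nat.lt_succ_self k)]

theorem dependsOn_incr (hM : 0 < M) (hA : A.adjoint (A xd - yd) = 0) (k : ℕ) :
    DependsOn (fun j => incr A (yd + ξ) x0 xd c₀ M j k) (Set.Iio k) := by
  intro j j' h
  have h1 := dependsOn_err (ξ := ξ) (x0 := x0) (c₀ := c₀) hM hA k h
  have hle : k / M * M ≤ k := Nat.div_mul_le_self k M
  have h2 := dependsOn_err (ξ := ξ) (x0 := x0) (c₀ := c₀) hM hA (k / M * M)
    (fun i hi => h i (lt_of_lt_of_le hi hle))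
  simp only at h1 h2
  simp only [incr, h1, h2]

theorem dependsOn_grad (hM : 0 < M) (hA : A.adjoint (A xd - yd) = 0) (K : ℕ) :
    DependsOn (fun j => grad A ξ (yd + ξ) x0 xd c₀ M j K) (Set.Iio (K * M)) := by
  intro j j' h
  have h1 := dependsOn_err (ξ := ξ) (x0 := x0) (c₀ := c₀) hM hA (K * M) h
  simp only at h1
  simp only [grad, h1]

end Recursion

open MeasureTheory ProbabilityTheory

/-! ### Expectations of functions of finitely many indices. -/

section Expectation

variable {n : ℕ} {Ω : Type*} [MeasurableSpace Ω] {P : Measure Ω} {I : ℕ → Ω → Fin n}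

/-- The expectation of a function of the index sequence. -/
def expect (P : Measure Ω) (I : ℕ → Ω → Fin n) (F : (ℕ → Fin n) → ℝ) : ℝ :=
  ∫ ω, F (fun k => I k ω) ∂P

/-- Such a function factors through a finite set, which makes measurability and integrability
automatic. The value `0` chosen for the later indices is irrelevant. -/
theorem exists_factor_of_dependsOn (hn : 0 < n) {β : Type*} {F : (ℕ → Fin n) → β} {k : ℕ}
    (hF : DependsOn F (Set.Iio k)) :
    ∃ G : (Finset.range k → Fin n) → β, ∀ j, F j = G (fun t => j t) := by
  classical
  refine ⟨fun z => F (fun t => if h : t ∈ Finset.range k then z ⟨t, h⟩ else ⟨0, hn⟩), fun j => ?_⟩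
  refine hF fun t ht => ?_
  have : t ∈ Finset.range k := Finset.mem_range.2 ht
  simp [this]

variable [IsProbabilityMeasure P]

theorem integrable_of_dependsOn (hn : 0 < n) (hI : IsUniformSampling P I) {F : (ℕ → Fin n) → ℝ}
    {k : ℕ} (hF : DependsOn F (Set.Iio k)) : Integrable (fun ω => F (fun k => I k ω)) P := by
  obtain ⟨G, hG⟩ := exists_factor_of_dependsOn hn hF
  have hZ : Measurable (fun ω (t : Finset.range k) => I t ω) :=
    measurable_pi_lambda _ fun t => hI.measurable t
  have : Integrable G (P.map (fun ω (t : Finset.range k) => I t ω)) := Integrable.of_finite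
  simp only [hG]
  exact this.comp_measurable hZ

/-- Conditioning on the first `k` indices. -/
theorem expect_succ (hn : 0 < n) (hI : IsUniformSampling P I) {F : (ℕ → Fin n) → ℝ}
    {k : ℕ} (hF : DependsOn F (Set.Iio (k + 1))) :
    expect P I F = expect P I (fun j => (n : ℝ)⁻¹ * ∑ i, F (Function.update j k i)) := by
  classical
  have hFi : ∀ i, DependsOn (fun j => F (Function.update j k i)) (Set.Iio k) := by
    intro i j j' h
    refine hF fun t ht => ?_
    rcases eq_or_ne t k with rfl | hne
    · simp
    · have : t < k := lt_of_le_of_ne (Nat.lt_succ_iff.1 ht) hne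
      simp [hne, h t this]
  -- Splitting by the value of the `k`-th index makes each summand a product of a function of `j k`
  -- and a function of the earlier indices, so independence applies termwise.
  have hsplit : ∀ j, F j = ∑ i, (if j k = i then (1 : ℝ) else 0) * F (Function.update j k i) := by
    intro j
    simp
  have hind : ∀ i, Measurable (fun ω => if I k ω = i then (1 : ℝ) else 0) := fun i =>
    (measurable_of_countable (fun a : Fin n => if a = i then (1 : ℝ) else 0)).comp (hI.measurable k)
  have hprob : ∀ i, ∫ ω, (if I k ω = i then (1 : ℝ) else 0) ∂P = (n : ℝ)⁻¹ := by
    intro i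
    have h1 : (fun ω => if I k ω = i then (1 : ℝ) else 0)
        = (I k ⁻¹' {i}).indicator (fun _ => (1 : ℝ)) := by
      ext ω; simp [Set.indicator_apply]
    rw [h1, integral_indicator_const _ (hI.measurable k (measurableSet_singleton i)),
      measureReal_def, hI.uniform k i]
    simp
  have hprod : ∀ i, ∫ ω, (if I k ω = i then (1 : ℝ) else 0)
      * F (Function.update (fun t => I t ω) k i) ∂P
      = (n : ℝ)⁻¹ * ∫ ω, F (Function.update (fun t => I t ω) k i) ∂P := by
    intro i
    obtain ⟨G, hG⟩ := exists_factor_of_dependsOn hn (hFi i)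
    have hindep := hI.indep.indepFun_finset {k} (Finset.range k) (by simp) hI.measurable
    have h2 := hindep.comp
      (φ := fun z : ({k} : Finset ℕ) → Fin n =>
        if z ⟨k, Finset.mem_singleton_self k⟩ = i then (1 : ℝ) else 0)
      (ψ := G) (measurable_of_countable _) (measurable_of_countable _)
    simp only [hG]
    rw [← hprob i]
    refine h2.integral_fun_mul_eq_mul_integral ?_ ?_
    · exact (hind i).aestronglyMeasurable
    · exact ((measurable_of_countable G).comp
        (measurable_pi_lambda _ fun t => hI.measurable t)).aestronglyMeasurable
  have hint : ∀ i, Integrable (fun ω => F (Function.update (fun t => I t ω) k i)) P :=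
    fun i => integrable_of_dependsOn hn hI (hFi i)
  have hint2 : ∀ i, Integrable (fun ω => (if I k ω = i then (1 : ℝ) else 0)
      * F (Function.update (fun t => I t ω) k i)) P := by
    intro i
    refine (hint i).bdd_mul (c := 1) (hind i).aestronglyMeasurable (Filter.Eventually.of_forall fun ω => ?_)
    split_ifs <;> simp
  simp only [expect]
  rw [integral_const_mul, integral_finsetSum _ fun i _ => hint i, Finset.mul_sum]
  simp_rw [← hprod]
  rw [← integral_finsetSum _ fun i _ => hint2 i]
  exact integral_congr_ae (Filter.Eventually.of_forall fun ω => hsplit _)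

theorem expect_add (hn : 0 < n) (hI : IsUniformSampling P I) {F G : (ℕ → Fin n) → ℝ}
    {k l : ℕ} (hF : DependsOn F (Set.Iio k)) (hG : DependsOn G (Set.Iio l)) :
    expect P I (fun j => F j + G j) = expect P I F + expect P I G :=
  integral_add (integrable_of_dependsOn hn hI hF) (integrable_of_dependsOn hn hI hG)

theorem expect_const_mul (c : ℝ) (F : (ℕ → Fin n) → ℝ) :
    expect P I (fun j => c * F j) = c * expect P I F :=
  integral_const_mul _ _

theorem expect_const (c : ℝ) : expect P I (fun _ => c) = c := by
  simp [expect]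

theorem expect_nonneg {F : (ℕ → Fin n) → ℝ} (h : ∀ j, 0 ≤ F j) : 0 ≤ expect P I F :=
  integral_nonneg fun _ => h _

theorem expect_mono (hn : 0 < n) (hI : IsUniformSampling P I) {F G : (ℕ → Fin n) → ℝ}
    {k l : ℕ} (hF : DependsOn F (Set.Iio k)) (hG : DependsOn G (Set.Iio l))
    (h : ∀ j, F j ≤ G j) : expect P I F ≤ expect P I G :=
  integral_mono (integrable_of_dependsOn hn hI hF) (integrable_of_dependsOn hn hI hG)
    fun _ => h _

end Expectation

/-! ### Variance of the perturbed Landweber iteration. -/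

section Variance

variable {𝕜 : Type*} [RCLike 𝕜] {n : ℕ}
  {E : Type*} [NormedAddCommGroup E] [InnerProductSpace 𝕜 E] [CompleteSpace E]
  {Y : Fin n → Type*} [∀ i, NormedAddCommGroup (Y i)] [∀ i, InnerProductSpace 𝕜 (Y i)]
  [∀ i, CompleteSpace (Y i)]
  {Z : Type*} [NormedAddCommGroup Z] [InnerProductSpace 𝕜 Z]
  {Ω : Type*} [MeasurableSpace Ω] {P : Measure Ω} [IsProbabilityMeasure P] {I : ℕ → Ω → Fin n}

theorem dependsOn_mono {β : Type*} {F : (ℕ → Fin n) → β} {k l : ℕ} (hkl : k ≤ l)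
    (hF : DependsOn F (Set.Iio k)) : DependsOn F (Set.Iio l) :=
  fun _ _ h => hF fun t ht => h t (lt_of_lt_of_le ht hkl)

theorem update_eq_of_dependsOn {β : Type*} {F : (ℕ → Fin n) → β} {k l : ℕ}
    (hF : DependsOn F (Set.Iio k)) (hkl : k ≤ l) (j : ℕ → Fin n) (i : Fin n) :
    F (Function.update j l i) = F j :=
  hF fun _ ht => Function.update_of_ne (ne_of_lt (lt_of_lt_of_le ht hkl)) _ _

/-- The variance decomposition of one step: the noise is centred. -/
theorem expect_norm_add_noise_sq_le (hn : 0 < n) (hI : IsUniformSampling P I)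
    (A : E →L[𝕜] PiLp 2 Y) (S : E →L[𝕜] Z) {k : ℕ} {a : (ℕ → Fin n) → Z} {d : (ℕ → Fin n) → E}
    (ha : DependsOn a (Set.Iio k)) (hd : DependsOn d (Set.Iio k)) {c κ : ℝ}
    (hS : ∀ x, ∑ i, ‖S (noiseOp A i x)‖ ^ 2 ≤ κ * ‖A x‖ ^ 2) :
    expect P I (fun j => ‖a j - S ((c : 𝕜) • noiseOp A (j k) (d j))‖ ^ 2)
      ≤ expect P I (fun j => ‖a j‖ ^ 2)
        + c ^ 2 * κ * expect P I (fun j => (n : ℝ)⁻¹ * ‖A (d j)‖ ^ 2) := by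
  have hdep : DependsOn (fun j : ℕ → Fin n => ‖a j - S ((c : 𝕜) • noiseOp A (j k) (d j))‖ ^ 2)
      (Set.Iio (k + 1)) := by
    intro j j' h
    have h1 := dependsOn_mono (Nat.le_succ k) ha h
    have h2 := dependsOn_mono (Nat.le_succ k) hd h
    have h3 : j k = j' k := h k (Nat.lt_succ_self k)
    simp only [h1, h2, h3]
  have hda : DependsOn (fun j => ‖a j‖ ^ 2) (Set.Iio k) := fun j j' h => by
    simp only [ha h]
  have hdd : DependsOn (fun j => (n : ℝ)⁻¹ * ‖A (d j)‖ ^ 2) (Set.Iio k) := fun j j' h => by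
    simp only [hd h]
  have hdd' : DependsOn (fun j => c ^ 2 * κ * ((n : ℝ)⁻¹ * ‖A (d j)‖ ^ 2)) (Set.Iio k) :=
    fun j j' h => by simp only [hd h]
  rw [← expect_const_mul, ← expect_add hn hI hda hdd', expect_succ hn hI hdep]
  have hpt : ∀ j : ℕ → Fin n, (n : ℝ)⁻¹ * ∑ i, ‖a (Function.update j k i)
      - S ((c : 𝕜) • noiseOp A ((Function.update j k i) k) (d (Function.update j k i)))‖ ^ 2
      ≤ ‖a j‖ ^ 2 + c ^ 2 * κ * ((n : ℝ)⁻¹ * ‖A (d j)‖ ^ 2) := by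
    intro j
    have hn' : (n : ℝ) ≠ 0 := by exact_mod_cast hn.ne'
    simp only [update_eq_of_dependsOn ha le_rfl, update_eq_of_dependsOn hd le_rfl,
      Function.update_self, map_smul]
    -- The cross terms vanish because `a` and `d` are fixed before index `k` is drawn and the noise
    -- averages to zero over `i`.
    have h0 : ∑ i, RCLike.re (inner 𝕜 (a j) ((c : 𝕜) • S (noiseOp A i (d j)))) = 0 := by
      rw [← map_sum, ← inner_sum, ← Finset.smul_sum, ← map_sum, sum_noiseOp hn]
      simp
    have h1 : ∑ i, ‖a j - (c : 𝕜) • S (noiseOp A i (d j))‖ ^ 2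
        = n * ‖a j‖ ^ 2 + c ^ 2 * ∑ i, ‖S (noiseOp A i (d j))‖ ^ 2 := by
      simp_rw [@norm_sub_sq 𝕜]
      rw [Finset.sum_add_distrib, Finset.sum_sub_distrib, ← Finset.mul_sum, h0, Finset.mul_sum]
      simp [norm_smul, mul_pow]
    rw [h1]
    have h2 := mul_le_mul_of_nonneg_left (hS (d j)) (sq_nonneg c)
    calc (n : ℝ)⁻¹ * (n * ‖a j‖ ^ 2 + c ^ 2 * ∑ i, ‖S (noiseOp A i (d j))‖ ^ 2)
        ≤ (n : ℝ)⁻¹ * (n * ‖a j‖ ^ 2 + c ^ 2 * (κ * ‖A (d j)‖ ^ 2)) := by gcongr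
      _ = _ := by field_simp
  refine expect_mono hn hI (k := k) (l := k) ?_ ?_ hpt
  · intro j j' h
    simp only [update_eq_of_dependsOn ha le_rfl, update_eq_of_dependsOn hd le_rfl,
      Function.update_self, ha h, hd h]
  · intro j j' h
    simp only [ha h, hd h]

/-- The variance decomposition of the perturbed Landweber iteration started at step `k₀`. -/
theorem expect_landweber_sq_le (hn : 0 < n) (hI : IsUniformSampling P I)
    (A : E →L[𝕜] PiLp 2 Y) {c : ℝ} {k₀ N : ℕ} {u d : (ℕ → Fin n) → ℕ → E} {G : (ℕ → Fin n) → E}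
    (hG : DependsOn G (Set.Iio k₀))
    (hu : ∀ t, DependsOn (fun j => u j t) (Set.Iio (k₀ + t)))
    (hd : ∀ t, DependsOn (fun j => d j t) (Set.Iio (k₀ + t)))
    (hrec : ∀ j, ∀ t < N, u j (t + 1) = polyOp (normalOp A) (resPoly c 1) (u j t) + G j
      - (c : 𝕜) • noiseOp A (j (k₀ + t)) (d j t))
    {t : ℕ} (ht : t ≤ N) (S : E →L[𝕜] Z) {V : (ℕ → Fin n) → Z} (hV : DependsOn V (Set.Iio k₀))
    {κ : ℕ → ℝ}
    (hκ : ∀ r x, ∑ i, ‖S (polyOp (normalOp A) (resPoly c r) (noiseOp A i x))‖ ^ 2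
      ≤ κ r * ‖A x‖ ^ 2) :
    expect P I (fun j => ‖S (u j t) + V j‖ ^ 2)
      ≤ expect P I (fun j => ‖S (polyOp (normalOp A) (resPoly c t) (u j 0)
          + polyOp (normalOp A) (geoPoly c t) (G j)) + V j‖ ^ 2)
        + c ^ 2 * ∑ s ∈ Finset.range t,
          κ (t - 1 - s) * expect P I (fun j => (n : ℝ)⁻¹ * ‖A (d j s)‖ ^ 2) := by
  induction t generalizing S V κ with
  | zero => simp [polyOp_resPoly_zero_apply, polyOp_geoPoly_zero_apply]
  | succ t ih =>
    have hdS : DependsOn (fun j => (S.comp (polyOp (normalOp A) (resPoly c 1))) (u j t)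
        + (S (G j) + V j)) (Set.Iio (k₀ + t)) := by
      intro j j' h
      have h1 := hu t h
      have h2 := dependsOn_mono (Nat.le_add_right k₀ t) hG h
      have h3 := dependsOn_mono (Nat.le_add_right k₀ t) hV h
      simp only at h1
      simp only [h1, h2, h3]
    have hstep := expect_norm_add_noise_sq_le (P := P) hn hI A S hdS (hd t) (c := c) (κ := κ 0)
      (fun x => by simpa [polyOp_resPoly_zero_apply] using hκ 0 x)
    have hV' : DependsOn (fun j => S (G j) + V j) (Set.Iio k₀) := fun j j' h => by
      simp only [hG h, hV h]
    have hκ' : ∀ r x, ∑ i, ‖(S.comp (polyOp (normalOp A) (resPoly c 1)))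
        (polyOp (normalOp A) (resPoly c r) (noiseOp A i x))‖ ^ 2 ≤ κ (r + 1) * ‖A x‖ ^ 2 := by
      intro r x
      refine le_of_eq_of_le (Finset.sum_congr rfl fun i _ => ?_) (hκ (r + 1) x)
      rw [polyOp_resPoly_succ_apply, polyOp_comm_apply]
      rfl
    -- The last step is peeled off and its propagator absorbed into the observable `S`. The shift
    -- `V`, known at the starting time, collects the drift `S G`; this is why both are generalized
    -- in the induction.
    have hih := ih (by omega) (S.comp (polyOp (normalOp A) (resPoly c 1))) hV' hκ'
    have e1 : expect P I (fun j => ‖S (u j (t + 1)) + V j‖ ^ 2)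
        = expect P I (fun j => ‖(S.comp (polyOp (normalOp A) (resPoly c 1))) (u j t)
          + (S (G j) + V j) - S ((c : 𝕜) • noiseOp A (j (k₀ + t)) (d j t))‖ ^ 2) := by
      congr 1
      funext j
      rw [hrec j t (by omega)]
      congr 2
      simp only [map_sub, map_add, ContinuousLinearMap.comp_apply]
      abel
    have e2 : expect P I (fun j => ‖S (polyOp (normalOp A) (resPoly c (t + 1)) (u j 0)
          + polyOp (normalOp A) (geoPoly c (t + 1)) (G j)) + V j‖ ^ 2)
        = expect P I (fun j => ‖(S.comp (polyOp (normalOp A) (resPoly c 1)))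
          (polyOp (normalOp A) (resPoly c t) (u j 0)
          + polyOp (normalOp A) (geoPoly c t) (G j)) + (S (G j) + V j)‖ ^ 2) := by
      congr 1
      funext j
      rw [polyOp_resPoly_succ_apply, polyOp_comm_apply, polyOp_geoPoly_succ_apply]
      congr 2
      simp only [map_add, ContinuousLinearMap.comp_apply]
      abel
    have e3 : ∑ s ∈ Finset.range (t + 1),
          κ (t + 1 - 1 - s) * expect P I (fun j => (n : ℝ)⁻¹ * ‖A (d j s)‖ ^ 2)
        = ∑ s ∈ Finset.range t,
          κ (t - 1 - s + 1) * expect P I (fun j => (n : ℝ)⁻¹ * ‖A (d j s)‖ ^ 2)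
          + κ 0 * expect P I (fun j => (n : ℝ)⁻¹ * ‖A (d j t)‖ ^ 2) := by
      rw [Finset.sum_range_succ]
      congr 1
      · refine Finset.sum_congr rfl fun s hs => ?_
        have := Finset.mem_range.1 hs
        congr 2
        omega
      · simp
    rw [e1, e2, e3]
    linarith

end Variance

theorem sqrt_le_of_one_le {x : ℝ} (hx : 1 ≤ x) : √x ≤ x :=
  Real.sqrt_le_iff.2 ⟨by linarith, by nlinarith⟩

theorem sum_range_mul_eq (F : ℕ → ℝ) (K M : ℕ) :
    ∑ s ∈ Finset.range (K * M), F s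
      = ∑ J ∈ Finset.range K, ∑ t ∈ Finset.range M, F (J * M + t) := by
  induction K with
  | zero => simp
  | succ K ih => rw [Finset.sum_range_succ, add_mul, one_mul, Finset.sum_range_add, ih]

/-! ### Step size conditions in expectation and the variance kernel. -/

section StepSize

variable {𝕜 : Type*} [RCLike 𝕜] {n : ℕ}
  {E : Type*} [NormedAddCommGroup E] [InnerProductSpace 𝕜 E] [CompleteSpace E]
  {Y : Fin n → Type*} [∀ i, NormedAddCommGroup (Y i)] [∀ i, InnerProductSpace 𝕜 (Y i)]
  [∀ i, CompleteSpace (Y i)] {A : E →L[𝕜] PiLp 2 Y} {c₀ : ℝ} {M : ℕ}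

theorem maxSq_zero : maxSq (0 : E →L[𝕜] PiLp 2 Y) = 0 := by
  simp [maxSq, comp]

theorem maxSq_pos (hA : A ≠ 0) : 0 < maxSq A := by
  refine lt_of_le_of_ne (maxSq_nonneg A) fun h => hA ?_
  have := norm_sq_le_maxSq A
  rw [← h, mul_zero] at this
  rw [← norm_eq_zero]
  nlinarith [norm_nonneg A]

theorem StepOKExp.mul_maxSq_le (h : StepOKExp A M c₀) : c₀ * maxSq A ≤ 1 := by
  by_cases hA : A = 0
  · rw [hA, maxSq_zero]; simp
  · exact (le_inv_mul_iff₀' (maxSq_pos hA)).1 (by simpa using (h.2 hA).1)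

theorem StepOKPath.mul_maxSq_le (h : StepOKPath A M c₀) : c₀ * maxSq A ≤ 1 := by
  by_cases hA : A = 0
  · rw [hA, maxSq_zero]; simp
  · exact (le_inv_mul_iff₀' (maxSq_pos hA)).1 (by simpa using (h.2 hA).1)

theorem mul_norm_normalOp_le (hn : 0 < n) (hc : 0 < c₀) (hcL : c₀ * maxSq A ≤ 1) :
    c₀ * ‖normalOp A‖ ≤ 1 :=
  (mul_le_mul_of_nonneg_left (norm_normalOp_le_maxSq hn A) hc.le).trans hcL

theorem mul_mem_Icc (hc : 0 < c₀) (hcB : c₀ * ‖normalOp A‖ ≤ 1) {t : ℝ}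
    (ht : t ∈ Set.Icc (0 : ℝ) ‖normalOp A‖) : 0 ≤ c₀ * t ∧ c₀ * t ≤ 1 :=
  ⟨mul_nonneg hc.le ht.1, (mul_le_mul_of_nonneg_left ht.2 hc.le).trans hcB⟩

/-- The kernel `n⁻¹ ‖A (1 - c₀ B) ^ r‖²` of the variance. -/
def kap (A : E →L[𝕜] PiLp 2 Y) (c₀ : ℝ) (r : ℕ) : ℝ :=
  (n : ℝ)⁻¹ * ‖A.comp (polyOp (normalOp A) (resPoly c₀ r))‖ ^ 2

theorem kap_nonneg (r : ℕ) : 0 ≤ kap A c₀ r := by unfold kap; positivity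

theorem norm_comp_resPoly_sq (hn : 0 < n) (r : ℕ) :
    ‖A.comp (polyOp (normalOp A) (resPoly c₀ r))‖ ^ 2 = n * kap A c₀ r := by
  have : (n : ℝ) ≠ 0 := by exact_mod_cast hn.ne'
  rw [kap]; field_simp

theorem kap_le (hn : 0 < n) {c : ℝ} (hc : 0 ≤ c) (r : ℕ)
    (h : ∀ t ∈ Set.Icc (0 : ℝ) ‖normalOp A‖, t * (1 - c₀ * t) ^ (2 * r) ≤ c) :
    kap A c₀ r ≤ c := by
  have h1 := norm_comp_polyOp_le hn A (resPoly c₀ r) hc fun t ht => by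
    rw [eval_resPoly, ← pow_mul, mul_comm r 2]; exact h t ht
  rw [kap, inv_mul_le_iff₀ (by exact_mod_cast hn)]
  calc ‖A.comp (polyOp (normalOp A) (resPoly c₀ r))‖ ^ 2 ≤ √(n * c) ^ 2 := by gcongr
    _ = n * c := Real.sq_sqrt (by positivity)

theorem kap_le_norm (hn : 0 < n) (hc : 0 < c₀) (hcB : c₀ * ‖normalOp A‖ ≤ 1) (r : ℕ) :
    kap A c₀ r ≤ ‖normalOp A‖ := by
  refine kap_le hn (norm_nonneg _) r fun t ht => ?_
  obtain ⟨h0, h1⟩ := mul_mem_Icc hc hcB ht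
  have : (1 - c₀ * t) ^ (2 * r) ≤ 1 := pow_le_one₀ (by linarith) (by linarith)
  calc t * (1 - c₀ * t) ^ (2 * r) ≤ t * 1 := mul_le_mul_of_nonneg_left this ht.1
    _ ≤ _ := by rw [mul_one]; exact ht.2

theorem kap_le_of_mul_le (hn : 0 < n) (hc : 0 < c₀) (hcB : c₀ * ‖normalOp A‖ ≤ 1) {r : ℕ} {a : ℝ}
    (ha : 0 ≤ a) (h : ∀ x, 0 ≤ x → x ≤ 1 → x * (1 - x) ^ (2 * r) ≤ a) :
    c₀ * kap A c₀ r ≤ a := by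
  have := kap_le (A := A) (c₀ := c₀) hn (c := a / c₀) (by positivity) r fun t ht => by
    obtain ⟨h0, h1⟩ := mul_mem_Icc hc hcB ht
    rw [le_div_iff₀ hc]
    have := h _ h0 h1
    linarith
  rw [le_div_iff₀ hc] at this
  linarith

theorem mul_kap_le_one (hn : 0 < n) (hc : 0 < c₀) (hcB : c₀ * ‖normalOp A‖ ≤ 1) (r : ℕ) :
    c₀ * kap A c₀ r ≤ 1 :=
  (mul_le_mul_of_nonneg_left (kap_le_norm hn hc hcB r) hc.le).trans hcB

theorem mul_kap_le (hn : 0 < n) (hc : 0 < c₀) (hcB : c₀ * ‖normalOp A‖ ≤ 1) (r : ℕ) :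
    c₀ * kap A c₀ r ≤ 1 / (r + 1) := by
  refine kap_le_of_mul_le hn hc hcB (by positivity) fun x h0 h1 => ?_
  refine (mul_one_sub_pow_le h0 h1 (2 * r)).trans ?_
  refine one_div_le_one_div_of_le (by positivity) ?_
  push_cast
  linarith [(Nat.cast_nonneg r : (0 : ℝ) ≤ r)]

/-- The step size condition in expectation bounds the mass of the variance kernel. -/
theorem StepOKExp.sum_kap_le (hn : 0 < n) (hM : 0 < M) (h : StepOKExp A M c₀) :
    c₀ ^ 2 * maxSq A * ∑ r ∈ Finset.range M, kap A c₀ r ≤ 1 / 5 := by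
  by_cases hA : A = 0
  · rw [hA, maxSq_zero]; norm_num
  have hc := h.1
  have hL := maxSq_pos hA
  have hcB := mul_norm_normalOp_le hn hc h.mul_maxSq_le
  have hn' : (0 : ℝ) < n := by exact_mod_cast hn
  have hM' : (0 : ℝ) < M := by exact_mod_cast hM
  have hA' : 0 < ‖A‖ := norm_pos_iff.2 hA
  have ht := (h.2 hA).2
  rw [expThreshold, lt_max_iff] at ht
  -- One case per term of the maximum. In the first, each kernel value is at most `‖B‖ = ‖A‖²/n`, so
  -- the sum is at most `M‖A‖²/n`. In the second, `c₀ kap r ≤ 1/(5r)` for `r ≥ 1` gives a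
  -- logarithmic sum, and `1 + (1 + log M)/5 ≤ (10 + log M)/5`.
  rcases ht with ht | ht
  · set x := 5 * maxSq A * (n : ℝ)⁻¹ * M with hx
    have hx0 : 0 < x := by positivity
    have hsx := Real.sqrt_pos.2 hx0
    rw [Real.rpow_neg hx0.le, ← Real.sqrt_eq_rpow, ← mul_inv, lt_inv_comm₀ hc (by positivity)] at ht
    have h1 : c₀ * (‖A‖ * √x) < 1 := by
      calc c₀ * (‖A‖ * √x) < c₀ * c₀⁻¹ := by gcongr
        _ = 1 := mul_inv_cancel₀ hc.ne'
    have h2 : (c₀ * (‖A‖ * √x)) ^ 2 ≤ 1 := pow_le_one₀ (by positivity) h1.le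
    rw [mul_pow, mul_pow, Real.sq_sqrt hx0.le, hx] at h2
    have h3 := sum_le_of_le_const (N := M) fun r _ => kap_le_norm hn hc hcB r
    rw [norm_normalOp] at h3
    calc c₀ ^ 2 * maxSq A * ∑ r ∈ Finset.range M, kap A c₀ r
        ≤ c₀ ^ 2 * maxSq A * (M * ((n : ℝ)⁻¹ * ‖A‖ ^ 2)) := by gcongr
      _ = (c₀ ^ 2 * (‖A‖ ^ 2 * (5 * maxSq A * (n : ℝ)⁻¹ * M))) / 5 := by ring
      _ ≤ 1 / 5 := by gcongr
  · have hlog : 0 ≤ Real.log M := Real.log_nonneg (by exact_mod_cast hM)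
    have h1 : c₀ * (maxSq A * (10 + Real.log M)) < 1 := by
      rw [← mul_inv, lt_inv_comm₀ hc (by positivity)] at ht
      calc c₀ * (maxSq A * (10 + Real.log M)) < c₀ * c₀⁻¹ := by gcongr
        _ = 1 := mul_inv_cancel₀ hc.ne'
    have h2 : c₀ * ∑ r ∈ Finset.range M, kap A c₀ r ≤ 1 + (1 / 5) * (1 + Real.log M) := by
      obtain ⟨m, rfl⟩ : ∃ m, M = m + 1 := ⟨M - 1, by omega⟩
      rw [Finset.sum_range_succ', mul_add, add_comm]
      refine add_le_add (mul_kap_le_one hn hc hcB 0) ?_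
      rw [Finset.mul_sum]
      calc ∑ r ∈ Finset.range m, c₀ * kap A c₀ (r + 1)
          ≤ ∑ r ∈ Finset.range m, (1 / 5) * (1 / ((r : ℝ) + 1)) := by
            refine Finset.sum_le_sum fun r _ => ?_
            have := kap_le_of_mul_le (A := A) hn hc hcB (r := r + 1) (a := 1 / (5 * (r + 1 : ℕ)))
              (by positivity) fun x h0 h1 => mul_one_sub_pow_two_mul_le h0 h1 (Nat.succ_pos r)
            refine this.trans (le_of_eq ?_)
            push_cast
            field_simp
        _ = (1 / 5) * ∑ r ∈ Finset.range m, 1 / ((r : ℝ) + 1) := by rw [Finset.mul_sum]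
        _ ≤ (1 / 5) * (1 + Real.log m) := by gcongr; exact sum_inv_le m
        _ ≤ _ := by
          have : Real.log m ≤ Real.log ((m + 1 : ℕ) : ℝ) := by
            rcases Nat.eq_zero_or_pos m with rfl | hm
            · simp
            · exact Real.log_le_log (by exact_mod_cast hm) (by push_cast; linarith)
          linarith
    calc c₀ ^ 2 * maxSq A * ∑ r ∈ Finset.range M, kap A c₀ r
        = c₀ * maxSq A * (c₀ * ∑ r ∈ Finset.range M, kap A c₀ r) := by ring
      _ ≤ c₀ * maxSq A * (1 + (1 / 5) * (1 + Real.log M)) := by gcongr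
      _ ≤ c₀ * maxSq A * ((10 + Real.log M) / 5) := by gcongr; linarith
      _ ≤ 1 / 5 := by linarith

end StepSize

/-! ### Mean square analysis: decay over epochs and the variance `O(1/k)`. -/

section Expectation

variable {𝕜 : Type*} [RCLike 𝕜] {n : ℕ}
  {E : Type*} [NormedAddCommGroup E] [InnerProductSpace 𝕜 E] [CompleteSpace E]
  {Y : Fin n → Type*} [∀ i, NormedAddCommGroup (Y i)] [∀ i, InnerProductSpace 𝕜 (Y i)]
  [∀ i, CompleteSpace (Y i)] {A : E →L[𝕜] PiLp 2 Y} {c₀ : ℝ} {M : ℕ}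
  {Ω : Type*} [MeasurableSpace Ω] {P : Measure Ω} [IsProbabilityMeasure P] {I : ℕ → Ω → Fin n}
  {yd ξ : PiLp 2 Y} {x0 xd : E}

/-- The mean square of the residual of the increments. -/
def incrMean (P : Measure Ω) (I : ℕ → Ω → Fin n) (A : E →L[𝕜] PiLp 2 Y) (y : PiLp 2 Y) (x0 xd : E)
    (c₀ : ℝ) (M : ℕ) (k : ℕ) : ℝ :=
  expect P I (fun j => (n : ℝ)⁻¹ * ‖A (incr A y x0 xd c₀ M j k)‖ ^ 2)

/-- The mean square of the residual of the deterministic move over an epoch. -/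
def epochMean (P : Measure Ω) (I : ℕ → Ω → Fin n) (A : E →L[𝕜] PiLp 2 Y) (ξ y : PiLp 2 Y)
    (x0 xd : E) (c₀ : ℝ) (M : ℕ) (K : ℕ) : ℝ :=
  expect P I (fun j => (n : ℝ)⁻¹ *
    ‖A (polyOp (normalOp A) (C c₀ * geoPoly c₀ M) (grad A ξ y x0 xd c₀ M j K))‖ ^ 2)

theorem epochMean_nonneg (y : PiLp 2 Y) (k : ℕ) : 0 ≤ epochMean P I A ξ y x0 xd c₀ M k :=
  expect_nonneg fun _ => by positivity

theorem geoPoly_mono (hc : 0 < c₀) (hcB : c₀ * ‖normalOp A‖ ≤ 1) {t : ℝ}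
    (ht : t ∈ Set.Icc (0 : ℝ) ‖normalOp A‖) {r s : ℕ} (hrs : r ≤ s) :
    0 ≤ (geoPoly c₀ r).eval t ∧ (geoPoly c₀ r).eval t ≤ (geoPoly c₀ s).eval t := by
  obtain ⟨h0, h1⟩ := mul_mem_Icc hc hcB ht
  rw [eval_geoPoly, eval_geoPoly]
  exact ⟨Finset.sum_nonneg fun _ _ => pow_nonneg (by linarith) _,
    Finset.sum_le_sum_of_subset_of_nonneg (Finset.range_mono hrs)
      fun _ _ _ => pow_nonneg (by linarith) _⟩

theorem sum_noise_resPoly_le (hn : 0 < n) (r : ℕ) (x : E) :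
    ∑ i, ‖A (polyOp (normalOp A) (resPoly c₀ r) (noiseOp A i x))‖ ^ 2
      ≤ n * maxSq A * kap A c₀ r * ‖A x‖ ^ 2 := by
  have h := sum_norm_noiseOp_sq_le hn A (A.comp (polyOp (normalOp A) (resPoly c₀ r)))
    (norm_comp_adjoint_le' A _) x
  rw [mul_pow, norm_comp_resPoly_sq hn, Real.sq_sqrt (maxSq_nonneg A)] at h
  refine h.trans (le_of_eq (by ring))

/-- The increment starts at zero, so unrolling from the anchor leaves a deterministic part, monotone
in `t` and hence at most the full-epoch move, plus a noise part of weight `1/5`. The factor `5/4` is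
the fixed point of `x = 1 + x/5`. -/
theorem incrMean_le (hn : 0 < n) (hM : 0 < M) (hI : IsUniformSampling P I)
    (hA : A.adjoint (A xd - yd) = 0) (h : StepOKExp A M c₀) (K : ℕ) {t : ℕ} (ht : t < M) :
    incrMean P I A (yd + ξ) x0 xd c₀ M (K * M + t)
      ≤ 5 / 4 * epochMean P I A ξ (yd + ξ) x0 xd c₀ M K := by
  have hc := h.1
  have hcB := mul_norm_normalOp_le hn hc h.mul_maxSq_le
  have hsum := h.sum_kap_le hn hM
  have hn' : (n : ℝ) ≠ 0 := by exact_mod_cast hn.ne'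
  have hL := maxSq_nonneg A
  have hq := epochMean_nonneg (P := P) (I := I) (A := A) (ξ := ξ) (x0 := x0) (xd := xd)
    (c₀ := c₀) (M := M) (yd + ξ) K
  induction t using Nat.strong_induction_on with
  | _ t ih =>
  have hdG : DependsOn (fun j => -((c₀ : 𝕜) • grad A ξ (yd + ξ) x0 xd c₀ M j K))
      (Set.Iio (K * M)) := fun j j' hj => by
    have := dependsOn_grad (x0 := x0) (c₀ := c₀) (ξ := ξ) hM hA K hj
    simp only at this
    simp only [this]
  have hdi : ∀ t, DependsOn (fun j => incr A (yd + ξ) x0 xd c₀ M j (K * M + t))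
      (Set.Iio (K * M + t)) := fun t => dependsOn_incr hM hA _
  have hdu : ∀ t, DependsOn (fun j => err A (yd + ξ) x0 xd c₀ M j (K * M + t)
      - err A (yd + ξ) x0 xd c₀ M j (K * M)) (Set.Iio (K * M + t)) := fun t j j' hj => by
    have h1 := dependsOn_err (x0 := x0) (c₀ := c₀) (ξ := ξ) hM hA (K * M + t) hj
    have h2 := dependsOn_mono (Nat.le_add_right _ t)
      (dependsOn_err (x0 := x0) (c₀ := c₀) (ξ := ξ) hM hA (K * M)) hj
    simp only at h1 h2
    simp only [h1, h2]
  have hmain := expect_landweber_sq_le (P := P) hn hI A (c := c₀) (N := M) hdG hdu hdi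
    (fun j s hs => by
      rw [sub_anchor_succ hM hA j K hs, incr_eq _ _ _ hs]
      abel) ht.le A (V := fun _ => 0) (fun _ _ _ => rfl) (κ := fun r => n * maxSq A * kap A c₀ r)
    (fun r x => sum_noise_resPoly_le hn r x)
  simp only [add_zero, sub_self, map_zero, zero_add] at hmain
  have hdet : expect P I (fun j => ‖A (polyOp (normalOp A) (geoPoly c₀ t)
      (-((c₀ : 𝕜) • grad A ξ (yd + ξ) x0 xd c₀ M j K)))‖ ^ 2)
      ≤ n * epochMean P I A ξ (yd + ξ) x0 xd c₀ M K := by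
    rw [epochMean, ← expect_const_mul]
    have hdg := dependsOn_grad (x0 := x0) (c₀ := c₀) (ξ := ξ) hM hA K
    refine expect_mono hn hI (k := K * M) (l := K * M) (fun j j' hj => ?_) (fun j j' hj => ?_)
      fun j => ?_
    · have := hdg hj
      simp only at this
      simp only [this]
    · have := hdg hj
      simp only at this
      simp only [this]
    · rw [mul_inv_cancel_left₀ hn', map_neg, map_neg, norm_neg, map_smul, ← polyOp_C_mul_apply]
      gcongr ?_ ^ 2
      refine norm_apply_polyOp_mono hn A _ _ (fun s hs => ?_) _
      obtain ⟨h0, h1⟩ := geoPoly_mono hc hcB hs ht.le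
      rw [eval_mul, eval_mul, eval_C]
      gcongr
  have hsum2 : c₀ ^ 2 * ∑ s ∈ Finset.range t, n * maxSq A * kap A c₀ (t - 1 - s)
      * expect P I (fun j => (n : ℝ)⁻¹ * ‖A (incr A (yd + ξ) x0 xd c₀ M j (K * M + s))‖ ^ 2)
      ≤ n * (1 / 4 * epochMean P I A ξ (yd + ξ) x0 xd c₀ M K) := by
    calc c₀ ^ 2 * ∑ s ∈ Finset.range t, n * maxSq A * kap A c₀ (t - 1 - s)
        * expect P I (fun j => (n : ℝ)⁻¹ * ‖A (incr A (yd + ξ) x0 xd c₀ M j (K * M + s))‖ ^ 2)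
        ≤ c₀ ^ 2 * ∑ s ∈ Finset.range t, n * maxSq A * kap A c₀ (t - 1 - s)
          * (5 / 4 * epochMean P I A ξ (yd + ξ) x0 xd c₀ M K) := by
          gcongr with s hs
          · exact mul_nonneg (by positivity) (kap_nonneg _)
          · have hs := Finset.mem_range.1 hs
            exact ih s hs (hs.trans ht)
      _ = n * ((c₀ ^ 2 * maxSq A * ∑ s ∈ Finset.range t, kap A c₀ s)
          * (5 / 4 * epochMean P I A ξ (yd + ξ) x0 xd c₀ M K)) := by
          rw [← Finset.sum_mul, ← Finset.mul_sum, Finset.sum_range_reflect (kap A c₀) t]; ring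
      _ ≤ n * (1 / 5 * (5 / 4 * epochMean P I A ξ (yd + ξ) x0 xd c₀ M K)) := by
          gcongr
          refine le_trans ?_ hsum
          gcongr
          intro r _ _
          exact kap_nonneg r
      _ = _ := by ring
  rw [incrMean, expect_const_mul, inv_mul_le_iff₀ (by positivity)]
  simp only [incr_eq _ _ _ ht]
  refine hmain.trans ((add_le_add hdet hsum2).trans (le_of_eq ?_))
  ring

/-- A bound for `sup_{0 ≤ y ≤ 1} (y (1 - y) ^ m) ^ 2`. -/
def peak (m : ℕ) : ℝ := if m = 0 then 1 else (4 / 25) / (m : ℝ) ^ 2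

theorem peak_nonneg (m : ℕ) : 0 ≤ peak m := by unfold peak; split_ifs <;> positivity

theorem le_peak {y : ℝ} (h0 : 0 ≤ y) (h1 : y ≤ 1) (m : ℕ) : (y * (1 - y) ^ m) ^ 2 ≤ peak m := by
  unfold peak
  split_ifs with hm
  · rw [hm, pow_zero, mul_one]; exact pow_le_one₀ h0 h1
  · exact mul_one_sub_pow_sq_le h0 h1 (Nat.pos_of_ne_zero hm)

theorem sum_peak_le (N : ℕ) : ∑ m ∈ Finset.range N, peak m ≤ 33 / 25 := by
  cases N with
  | zero => simp; norm_num
  | succ N =>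
    rw [Finset.sum_range_succ']
    have h : ∑ m ∈ Finset.range N, peak (m + 1)
        = (4 / 25) * ∑ m ∈ Finset.range N, 1 / ((m : ℝ) + 1) ^ 2 := by
      rw [Finset.mul_sum]
      refine Finset.sum_congr rfl fun m _ => ?_
      simp only [peak, Nat.succ_ne_zero, if_false]
      push_cast
      ring
    have h0 : peak 0 = 1 := by simp [peak]
    have := sum_inv_sq_le N
    rw [h, h0]
    linarith

theorem one_sub_pow_mem {x : ℝ} (h0 : 0 ≤ x) (h1 : x ≤ 1) (M : ℕ) :
    0 ≤ 1 - (1 - x) ^ M ∧ 1 - (1 - x) ^ M ≤ 1 := by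
  have h2 : (1 - x) ^ M ≤ 1 := pow_le_one₀ (by linarith) (by linarith)
  have h3 : 0 ≤ (1 - x) ^ M := pow_nonneg (by linarith) M
  constructor <;> linarith

/-- The polynomial `(1 - T) T ^ m` with `T = (1 - c₀ t) ^ M`. -/
theorem eval_epochPoly (m : ℕ) (t : ℝ) :
    ((1 - resPoly c₀ M) * resPoly c₀ (m * M)).eval t
      = (1 - (1 - c₀ * t) ^ M) * (1 - (1 - (1 - c₀ * t) ^ M)) ^ m := by
  rw [eval_mul, eval_sub, eval_one, eval_resPoly, eval_resPoly, mul_comm m M, pow_mul]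
  ring

/-- With `y = 1 - (1 - c₀t)^M ∈ [0, 1]` the polynomial is `y(1 - y)^m`: a whole epoch acts like one
Landweber step, so the bounds in `m` involve neither `M` nor `c₀`. -/
theorem norm_epochPoly_sq_le (hc : 0 < c₀) (hcB : c₀ * ‖normalOp A‖ ≤ 1) (m : ℕ) :
    ‖polyOp (normalOp A) ((1 - resPoly c₀ M) * resPoly c₀ (m * M))‖ ^ 2 ≤ peak m := by
  have h : ‖polyOp (normalOp A) ((1 - resPoly c₀ M) * resPoly c₀ (m * M))‖ ≤ √(peak m) := by
    refine norm_polyOp_le (normalOp_isPositive A) _ (Real.sqrt_nonneg _) fun t ht => ?_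
    obtain ⟨h0, h1⟩ := mul_mem_Icc hc hcB ht
    obtain ⟨h2, h3⟩ := one_sub_pow_mem h0 h1 M
    rw [eval_epochPoly]
    exact Real.abs_le_sqrt (le_peak h2 h3 m)
  calc _ ≤ √(peak m) ^ 2 := by gcongr
    _ = _ := Real.sq_sqrt (peak_nonneg m)

theorem norm_epochPoly_apply_le (hc : 0 < c₀) (hcB : c₀ * ‖normalOp A‖ ≤ 1) (K : ℕ) (x : E) :
    ‖polyOp (normalOp A) ((1 - resPoly c₀ M) * resPoly c₀ (K * M)) x‖ ≤ 1 / (K + 1) * ‖x‖ := by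
  refine ContinuousLinearMap.le_of_opNorm_le _ ?_ x
  refine norm_polyOp_le (normalOp_isPositive A) _ (by positivity) fun t ht => ?_
  obtain ⟨h0, h1⟩ := mul_mem_Icc hc hcB ht
  obtain ⟨h2, h3⟩ := one_sub_pow_mem h0 h1 M
  rw [eval_epochPoly, abs_of_nonneg (mul_nonneg h2 (pow_nonneg (by linarith) _))]
  exact mul_one_sub_pow_le h2 h3 K

theorem norm_apply_geoPoly_adjoint_le (hn : 0 < n) (hc : 0 < c₀) (hcB : c₀ * ‖normalOp A‖ ≤ 1)
    (K : ℕ) (y : PiLp 2 Y) :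
    ‖A (polyOp (normalOp A) (C c₀ * geoPoly c₀ M * resPoly c₀ (K * M)) (A.adjoint y))‖
      ≤ n * (1 / (K + 1)) * ‖y‖ := by
  refine norm_apply_polyOp_adjoint_le hn A _ (by positivity) (fun t ht => ?_) y
  obtain ⟨h0, h1⟩ := mul_mem_Icc hc hcB ht
  obtain ⟨h2, h3⟩ := one_sub_pow_mem h0 h1 M
  have e : t * |(C c₀ * geoPoly c₀ M * resPoly c₀ (K * M)).eval t|
      = |(X * (C c₀ * geoPoly c₀ M * resPoly c₀ (K * M))).eval t| := by
    rw [eval_mul (p := X), abs_mul, eval_X, abs_of_nonneg ht.1]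
  have e2 : X * (C c₀ * geoPoly c₀ M * resPoly c₀ (K * M))
      = (1 - resPoly c₀ M) * resPoly c₀ (K * M) := by
    rw [← C_mul_X_mul_geoPoly]; ring
  rw [e, e2, eval_epochPoly, abs_of_nonneg (mul_nonneg h2 (pow_nonneg (by linarith) _))]
  exact mul_one_sub_pow_le h2 h3 K

theorem norm_sq_le_div (hc : 0 < c₀) (hcL : c₀ * maxSq A ≤ 1) : ‖A‖ ^ 2 ≤ n / c₀ := by
  refine (norm_sq_le_maxSq A).trans ?_
  rw [le_div_iff₀ hc]
  have : (0 : ℝ) ≤ n := by positivity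
  nlinarith

/-- From `c₀ B ∑_{s<M} R^s = 1 - R^M`: the move over an epoch is a function of the anchor error, up
to a fixed noise term. -/
theorem grad_eq_epoch (j : ℕ → Fin n) (K : ℕ) :
    polyOp (normalOp A) (C c₀ * geoPoly c₀ M) (grad A ξ (yd + ξ) x0 xd c₀ M j K)
      = polyOp (normalOp A) (1 - resPoly c₀ M) (err A (yd + ξ) x0 xd c₀ M j (K * M))
        - polyOp (normalOp A) (C c₀ * geoPoly c₀ M) ((n : 𝕜)⁻¹ • A.adjoint ξ) := by
  have e : (1 - resPoly c₀ M : ℝ[X]) = C c₀ * geoPoly c₀ M * X := by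
    rw [← C_mul_X_mul_geoPoly]; ring
  rw [grad, map_sub, e, polyOp_mul_apply _ _ X, polyOp_X]

/-- Unroll the anchor error back to step `0`. The deterministic part is smoothed by `(1 -
R^M)R^(KM)` and is `O(1/(K+1))` in norm. The noise of epoch `J` enters with the inner kernel of mass
`1/5`, the epoch kernel `peak (K - 1 - J)`, and the factor `5/4` of `incrMean_le`, which together
give `1/4 * peak (K - 1 - J)`. -/
theorem epochMean_le (hn : 0 < n) (hM : 0 < M) (hI : IsUniformSampling P I)
    (hA : A.adjoint (A xd - yd) = 0) (h : StepOKExp A M c₀) {ρ : ℝ} (hρ : ‖x0 - xd‖ ≤ ρ)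
    (hξ : ‖ξ‖ ≤ 1) (K : ℕ) :
    epochMean P I A ξ (yd + ξ) x0 xd c₀ M K
      ≤ (n : ℝ)⁻¹ * (√(n / c₀) * ρ + 1) ^ 2 * (1 / ((K : ℝ) + 1) ^ 2)
        + ∑ J ∈ Finset.range K, 1 / 4 * peak (K - 1 - J)
          * epochMean P I A ξ (yd + ξ) x0 xd c₀ M J := by
  have hc := h.1
  have hcB := mul_norm_normalOp_le hn hc h.mul_maxSq_le
  have hsum := h.sum_kap_le hn hM
  have hn' : (n : ℝ) ≠ 0 := by exact_mod_cast hn.ne'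
  have hn𝕜 : (n : 𝕜) ≠ 0 := by exact_mod_cast hn.ne'
  have hL := maxSq_nonneg A
  set ζ : E := (n : 𝕜)⁻¹ • A.adjoint ξ with hζ
  set S : E →L[𝕜] PiLp 2 Y := A.comp (polyOp (normalOp A) (1 - resPoly c₀ M)) with hS
  have hκ : ∀ r x, ∑ i, ‖S (polyOp (normalOp A) (resPoly c₀ r) (noiseOp A i x))‖ ^ 2
      ≤ (n * maxSq A * kap A c₀ (r % M) * peak (r / M)) * ‖A x‖ ^ 2 := by
    intro r x
    have h1 := sum_norm_noiseOp_sq_le hn A (S.comp (polyOp (normalOp A) (resPoly c₀ r)))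
      (norm_comp_adjoint_le' A _) x
    -- Division of `r` by `M`: the remainder stays with `A` and feeds the kernel `kap` inside the
    -- epoch, while the quotient goes with `1 - R^M` and feeds `peak`.
    have h2 : ‖S.comp (polyOp (normalOp A) (resPoly c₀ r))‖
        ≤ ‖A.comp (polyOp (normalOp A) (resPoly c₀ (r % M)))‖
          * ‖polyOp (normalOp A) ((1 - resPoly c₀ M) * resPoly c₀ (r / M * M))‖ := by
      have e : S.comp (polyOp (normalOp A) (resPoly c₀ r))
          = (A.comp (polyOp (normalOp A) (resPoly c₀ (r % M)))).comp
            (polyOp (normalOp A) ((1 - resPoly c₀ M) * resPoly c₀ (r / M * M))) := by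
        have e1 : resPoly c₀ r = resPoly c₀ (r % M) * resPoly c₀ (r / M * M) := by
          rw [← resPoly_add, mul_comm (r / M), Nat.mod_add_div]
        have e2 : (1 - resPoly c₀ M) * resPoly c₀ r
            = resPoly c₀ (r % M) * ((1 - resPoly c₀ M) * resPoly c₀ (r / M * M)) := by
          rw [e1]; ring
        ext1 z
        simp only [hS, ContinuousLinearMap.comp_apply]
        rw [← polyOp_mul_apply, e2, polyOp_mul_apply]
      rw [e]
      exact ContinuousLinearMap.opNorm_comp_le _ _
    refine h1.trans ?_
    refine mul_le_mul_of_nonneg_right ?_ (sq_nonneg _)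
    rw [mul_pow, Real.sq_sqrt hL]
    calc ‖S.comp (polyOp (normalOp A) (resPoly c₀ r))‖ ^ 2 * maxSq A
        ≤ (‖A.comp (polyOp (normalOp A) (resPoly c₀ (r % M)))‖
          * ‖polyOp (normalOp A) ((1 - resPoly c₀ M) * resPoly c₀ (r / M * M))‖) ^ 2 * maxSq A := by
          gcongr
      _ = (n * kap A c₀ (r % M))
          * ‖polyOp (normalOp A) ((1 - resPoly c₀ M) * resPoly c₀ (r / M * M))‖ ^ 2 * maxSq A := by
          rw [mul_pow, norm_comp_resPoly_sq hn]
      _ ≤ (n * kap A c₀ (r % M)) * peak (r / M) * maxSq A := by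
          gcongr
          · exact mul_nonneg (by positivity) (kap_nonneg _)
          · exact norm_epochPoly_sq_le hc hcB _
      _ = _ := by ring
  have hmain := expect_landweber_sq_le (P := P) hn hI A (c := c₀) (k₀ := 0) (N := K * M)
    (u := fun j t => err A (yd + ξ) x0 xd c₀ M j t)
    (d := fun j t => incr A (yd + ξ) x0 xd c₀ M j t)
    (G := fun _ => (c₀ : 𝕜) • ζ) (fun _ _ _ => rfl)
    (fun t => by rw [zero_add]; exact dependsOn_err hM hA t)
    (fun t => by rw [zero_add]; exact dependsOn_incr hM hA t)
    (fun j s _ => by rw [zero_add, err_succ hM hA, incr]) le_rfl S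
    (V := fun _ => -A (polyOp (normalOp A) (C c₀ * geoPoly c₀ M) ζ)) (fun _ _ _ => rfl) hκ
  have hlhs : epochMean P I A ξ (yd + ξ) x0 xd c₀ M K = (n : ℝ)⁻¹ * expect P I (fun j =>
      ‖S (err A (yd + ξ) x0 xd c₀ M j (K * M))
        + -A (polyOp (normalOp A) (C c₀ * geoPoly c₀ M) ζ)‖ ^ 2) := by
    rw [epochMean, expect_const_mul]
    simp only [grad_eq_epoch, map_sub]
    simp only [hS, ContinuousLinearMap.comp_apply, sub_eq_add_neg, hζ]
  have hdet : ‖S (polyOp (normalOp A) (resPoly c₀ (K * M)) (x0 - xd)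
      + polyOp (normalOp A) (geoPoly c₀ (K * M)) ((c₀ : 𝕜) • ζ))
        + -A (polyOp (normalOp A) (C c₀ * geoPoly c₀ M) ζ)‖
      ≤ (√(n / c₀) * ρ + 1) * (1 / ((K : ℝ) + 1)) := by
    have e1 : S (polyOp (normalOp A) (resPoly c₀ (K * M)) (x0 - xd)
        + polyOp (normalOp A) (geoPoly c₀ (K * M)) ((c₀ : 𝕜) • ζ))
        + -A (polyOp (normalOp A) (C c₀ * geoPoly c₀ M) ζ)
        = A (polyOp (normalOp A) ((1 - resPoly c₀ M) * resPoly c₀ (K * M)) (x0 - xd))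
          - (n : 𝕜)⁻¹ • A (polyOp (normalOp A) (C c₀ * geoPoly c₀ M * resPoly c₀ (K * M))
            (A.adjoint ξ)) := by
      -- The two data noise contributions nearly cancel; what survives carries `R^(KM)` and
      -- therefore decays in `K`.
      have e2 : C c₀ * geoPoly c₀ M * resPoly c₀ (K * M)
          = C c₀ * geoPoly c₀ M - C c₀ * ((1 - resPoly c₀ M) * geoPoly c₀ (K * M)) := by
        have h1 := C_mul_X_mul_geoPoly c₀ M
        have h2 := C_mul_X_mul_geoPoly c₀ (K * M)
        linear_combination (C c₀ * geoPoly c₀ M) * h2 - C c₀ * geoPoly c₀ (K * M) * h1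
      have e3 : ∀ p : ℝ[X], (n : 𝕜)⁻¹ • A (polyOp (normalOp A) p (A.adjoint ξ))
          = A (polyOp (normalOp A) p ζ) := fun p => by rw [hζ, map_smul, map_smul]
      rw [e3, e2, polyOp_sub _ _ (C c₀ * ((1 - resPoly c₀ M) * geoPoly c₀ (K * M))), sub_apply,
        map_sub A, polyOp_C_mul_apply _ _ ((1 - resPoly c₀ M) * geoPoly c₀ (K * M)),
        polyOp_mul_apply _ (1 - resPoly c₀ M) (resPoly c₀ (K * M)),
        polyOp_mul_apply _ (1 - resPoly c₀ M) (geoPoly c₀ (K * M))]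
      simp only [hS, ContinuousLinearMap.comp_apply, map_add, map_smul]
      abel
    rw [e1]
    have hρ0 : 0 ≤ ρ := (norm_nonneg _).trans hρ
    have hA1 : ‖A‖ ≤ √(n / c₀) := Real.le_sqrt_of_sq_le (norm_sq_le_div hc h.mul_maxSq_le)
    have h3 : ‖A (polyOp (normalOp A) ((1 - resPoly c₀ M) * resPoly c₀ (K * M)) (x0 - xd))‖
        ≤ √(n / c₀) * (1 / ((K : ℝ) + 1) * ρ) := by
      refine (A.le_opNorm _).trans ?_
      gcongr
      refine (norm_epochPoly_apply_le hc hcB K _).trans ?_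
      gcongr
    have h4 : ‖(n : 𝕜)⁻¹ • A (polyOp (normalOp A) (C c₀ * geoPoly c₀ M * resPoly c₀ (K * M))
            (A.adjoint ξ))‖ ≤ 1 / ((K : ℝ) + 1) := by
      rw [norm_smul, norm_inv, RCLike.norm_natCast, inv_mul_le_iff₀ (by positivity)]
      refine (norm_apply_geoPoly_adjoint_le hn hc hcB K ξ).trans ?_
      exact mul_le_of_le_one_right (by positivity) hξ
    refine (norm_sub_le _ _).trans ((add_le_add h3 h4).trans (le_of_eq ?_))
    ring
  have hdet2 : expect P I (fun j => ‖S (polyOp (normalOp A) (resPoly c₀ (K * M))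
      (err A (yd + ξ) x0 xd c₀ M j 0)
      + polyOp (normalOp A) (geoPoly c₀ (K * M)) ((c₀ : 𝕜) • ζ))
        + -A (polyOp (normalOp A) (C c₀ * geoPoly c₀ M) ζ)‖ ^ 2)
      ≤ (√(n / c₀) * ρ + 1) ^ 2 * (1 / ((K : ℝ) + 1) ^ 2) := by
    simp only [err_zero]
    rw [expect_const]
    calc _ ≤ ((√(n / c₀) * ρ + 1) * (1 / ((K : ℝ) + 1))) ^ 2 := by gcongr
      _ = _ := by rw [mul_pow, div_pow, one_pow]
  have hsum2 : c₀ ^ 2 * ∑ s ∈ Finset.range (K * M),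
      n * maxSq A * kap A c₀ ((K * M - 1 - s) % M) * peak ((K * M - 1 - s) / M)
        * expect P I (fun j => (n : ℝ)⁻¹ * ‖A (incr A (yd + ξ) x0 xd c₀ M j s)‖ ^ 2)
      ≤ n * ∑ J ∈ Finset.range K, 1 / 4 * peak (K - 1 - J)
          * epochMean P I A ξ (yd + ξ) x0 xd c₀ M J := by
    rw [sum_range_mul_eq, Finset.mul_sum, Finset.mul_sum]
    refine Finset.sum_le_sum fun J hJ => ?_
    have hJ := Finset.mem_range.1 hJ
    have hq := epochMean_nonneg (P := P) (I := I) (A := A) (ξ := ξ) (x0 := x0) (xd := xd)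
      (c₀ := c₀) (M := M) (yd + ξ) J
    calc c₀ ^ 2 * ∑ t ∈ Finset.range M,
          n * maxSq A * kap A c₀ ((K * M - 1 - (J * M + t)) % M)
            * peak ((K * M - 1 - (J * M + t)) / M)
            * expect P I (fun j => (n : ℝ)⁻¹ * ‖A (incr A (yd + ξ) x0 xd c₀ M j (J * M + t))‖ ^ 2)
        ≤ c₀ ^ 2 * ∑ t ∈ Finset.range M,
          n * maxSq A * kap A c₀ (M - 1 - t) * peak (K - 1 - J)
            * (5 / 4 * epochMean P I A ξ (yd + ξ) x0 xd c₀ M J) := by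
          refine mul_le_mul_of_nonneg_left (Finset.sum_le_sum fun t ht => ?_) (sq_nonneg _)
          have ht := Finset.mem_range.1 ht
          have e : K * M - 1 - (J * M + t) = (K - 1 - J) * M + (M - 1 - t) := by
            obtain ⟨l, rfl⟩ : ∃ l, K = J + 1 + l := ⟨K - (J + 1), by omega⟩
            have : J + 1 + l - 1 - J = l := by omega
            rw [this, add_mul, add_mul, one_mul]
            omega
          have e2 : ((K - 1 - J) * M + (M - 1 - t)) % M = M - 1 - t := by
            rw [add_comm, Nat.add_mul_mod_self_right, Nat.mod_eq_of_lt (by omega)]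
          rw [e, mul_add_div _ (by omega), e2]
          have := incrMean_le (ξ := ξ) (x0 := x0) hn hM hI hA h J ht
          rw [incrMean] at this
          exact mul_le_mul_of_nonneg_left this
            (mul_nonneg (mul_nonneg (by positivity) (kap_nonneg _)) (peak_nonneg _))
      _ = n * ((c₀ ^ 2 * maxSq A * ∑ t ∈ Finset.range M, kap A c₀ t)
          * (5 / 4 * (peak (K - 1 - J) * epochMean P I A ξ (yd + ξ) x0 xd c₀ M J))) := by
          rw [← Finset.sum_mul, ← Finset.sum_mul, ← Finset.mul_sum,
            Finset.sum_range_reflect (kap A c₀) M]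
          ring
      _ ≤ n * (1 / 5
          * (5 / 4 * (peak (K - 1 - J) * epochMean P I A ξ (yd + ξ) x0 xd c₀ M J))) := by
          have := peak_nonneg (K - 1 - J)
          gcongr
      _ = _ := by ring
  rw [hlhs, inv_mul_le_iff₀ (by positivity)]
  refine hmain.trans ((add_le_add hdet2 hsum2).trans (le_of_eq ?_))
  field_simp

/-- The decay of the deterministic moves over an epoch, with a uniform constant. -/
theorem epochMean_decay (hn : 0 < n) (hM : 0 < M) (hI : IsUniformSampling P I)
    (hA : A.adjoint (A xd - yd) = 0) (h : StepOKExp A M c₀) {ρ : ℝ} (hρ : ‖x0 - xd‖ ≤ ρ)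
    (hξ : ‖ξ‖ ≤ 1) (K : ℕ) :
    epochMean P I A ξ (yd + ξ) x0 xd c₀ M K
      ≤ 80 * ((n : ℝ)⁻¹ * (√(n / c₀) * ρ + 1) ^ 2) * (1 / (((K : ℝ) + 1) * √((K : ℝ) + 1))) := by
  set B := (n : ℝ)⁻¹ * (√(n / c₀) * ρ + 1) ^ 2 with hB
  have hB0 : 0 ≤ B := by positivity
  have ha0 := fun K => epochMean_nonneg (P := P) (I := I) (A := A) (ξ := ξ) (x0 := x0) (xd := xd)
      (c₀ := c₀) (M := M) (yd + ξ) K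
  have hrec := epochMean_le (P := P) (ξ := ξ) hn hM hI hA h hρ hξ
  have hk0 : ∀ m, 0 ≤ 1 / 4 * peak m := fun m => mul_nonneg (by norm_num) (peak_nonneg m)
  have hk : ∀ N, ∑ m ∈ Finset.range N, 1 / 4 * peak m ≤ 33 / 100 := fun N => by
    rw [← Finset.mul_sum]; linarith [sum_peak_le N]
  have hsq : ∀ K : ℕ, 1 / ((K : ℝ) + 1) ^ 2 ≤ 1 / (((K : ℝ) + 1) * √((K : ℝ) + 1)) := fun K => by
    have h1 : √((K : ℝ) + 1) ≤ (K : ℝ) + 1 := 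
      sqrt_le_of_one_le (by linarith [(Nat.cast_nonneg K : (0 : ℝ) ≤ K)])
    have h2 : 0 < √((K : ℝ) + 1) := Real.sqrt_pos.2 (by positivity)
    rw [pow_two]
    gcongr
  -- Summability comes first, because the contribution of the old epochs needs a bound on `∑ a J`.
  have hS := volterra_summable ha0 hrec hk (by norm_num) (B := 2 * B) fun N => by
    rw [← Finset.mul_sum]
    have := mul_le_mul_of_nonneg_left (sum_inv_sq_le N) hB0
    linarith
  -- The exponent `3/2` is a compromise: its doubling constant `2√2` times the mass `33/100` stays
  -- below `19/20`, whereas exponent `2` would give `4 · 33/100 > 1`. Any exponent above `1` serves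
  -- the final convolution.
  have hdec := volterra_decay (w := fun K => 1 / (((K : ℝ) + 1) * √((K : ℝ) + 1)))
    (u := fun K => 1 / ((K : ℝ) + 1) ^ 2) (D := 2 * √2) (C₁ := B) (C₂ := 3 * B) (θ := 19 / 20)
    ha0 hk0 hrec hk (fun K => by positivity) ?_ (by positivity) (fun K => by positivity) ?_ ?_
    (by norm_num) hB0 (by positivity) (fun K => mul_le_mul_of_nonneg_left (hsq K) hB0) ?_ K
  · refine hdec.trans (le_of_eq ?_)
    rw [show (B + 3 * B) / (1 - 19 / 20) = 80 * B by ring]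
  · intro K J _ hJK
    have h1 : (K : ℝ) + 1 ≤ 2 * ((J : ℝ) + 1) := by exact_mod_cast hJK
    have h2 : √((K : ℝ) + 1) ≤ √2 * √((J : ℝ) + 1) := by
      rw [← Real.sqrt_mul (by norm_num)]; exact Real.sqrt_le_sqrt h1
    have h3 : 0 < √((J : ℝ) + 1) := Real.sqrt_pos.2 (by positivity)
    have h4 : 0 < √((K : ℝ) + 1) := Real.sqrt_pos.2 (by positivity)
    rw [mul_one_div, div_le_div_iff₀ (by positivity) (by positivity), one_mul]
    calc ((K : ℝ) + 1) * √((K : ℝ) + 1) ≤ (2 * ((J : ℝ) + 1)) * (√2 * √((J : ℝ) + 1)) := by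
          gcongr
      _ = _ := by ring
  · intro K J hJ hJK
    have h1 : K - 1 - J ≠ 0 := by omega
    -- An old epoch has lag at least `(K + 1)/3`; the case assumption forces `K ≥ 2`, which absorbs
    -- the offset.
    have h2 : (2 : ℝ) * ((K : ℝ) + 1) ≤ 6 * ((K - 1 - J : ℕ) : ℝ) := by
      have : 2 * (K + 1) ≤ 6 * (K - 1 - J) := by omega
      exact_mod_cast this
    have h3 : (0 : ℝ) < ((K - 1 - J : ℕ) : ℝ) := by exact_mod_cast Nat.pos_of_ne_zero h1
    simp only [peak, h1, if_false]
    rw [← mul_div_assoc, div_le_div_iff₀ (by positivity) (by positivity)]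
    have : ((K : ℝ) + 1) ^ 2 ≤ (3 * ((K - 1 - J : ℕ) : ℝ)) ^ 2 := by gcongr; linarith
    nlinarith
  · have : √2 ≤ 1.415 := by
      rw [Real.sqrt_le_left (by norm_num)]; norm_num
    norm_num at this ⊢
    linarith
  · intro K
    have h1 := hS K
    rw [mul_comm]
    refine mul_le_mul (h1.trans ?_) (hsq K) (by positivity) (by positivity)
    rw [div_le_iff₀ (by norm_num)]
    linarith

theorem cast_le_mul_div (hM : 0 < M) (s : ℕ) : (s : ℝ) + 1 ≤ M * (((s / M : ℕ) : ℝ) + 1) := by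
  have h1 := Nat.lt_div_mul_add hM (a := s)
  have : s + 1 ≤ M * (s / M + 1) := by rw [mul_add, mul_comm]; omega
  exact_mod_cast this

/-- Mean square error of SVRG: the error of the Landweber method plus a variance `O(1 / k)`. -/
theorem expect_err_sq_le (hn : 0 < n) (hM : 0 < M) (hI : IsUniformSampling P I)
    (hA : A.adjoint (A xd - yd) = 0) (h : StepOKExp A M c₀) {ρ : ℝ} (hρ : ‖x0 - xd‖ ≤ ρ)
    (hξ : ‖ξ‖ ≤ 1) (k : ℕ) :
    expect P I (fun j => ‖err A (yd + ξ) x0 xd c₀ M j k‖ ^ 2)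
      ≤ ‖polyOp (normalOp A) (resPoly c₀ k) (x0 - xd)
          + polyOp (normalOp A) (geoPoly c₀ k) ((c₀ : 𝕜) • (n : 𝕜)⁻¹ • A.adjoint ξ)‖ ^ 2
        + 900 * c₀ * n * M ^ 2 * ((n : ℝ)⁻¹ * (√(n / c₀) * ρ + 1) ^ 2) / (k + 1) := by
  have hc := h.1
  have hcB := mul_norm_normalOp_le hn hc h.mul_maxSq_le
  set B := (n : ℝ)⁻¹ * (√(n / c₀) * ρ + 1) ^ 2 with hB
  have hB0 : 0 ≤ B := by positivity
  have hM1 : (1 : ℝ) ≤ M := by exact_mod_cast hM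
  -- For the error itself the observable is the identity, so the decay `1/(r+1)` must come from `R^r
  -- A*`; no factor `√L` is spent here.
  have hκ : ∀ r x, ∑ i, ‖(ContinuousLinearMap.id 𝕜 E)
      (polyOp (normalOp A) (resPoly c₀ r) (noiseOp A i x))‖ ^ 2
      ≤ (n / c₀ * (1 / ((r : ℝ) + 1))) * ‖A x‖ ^ 2 := by
    intro r x
    have h1 := sum_norm_noiseOp_sq_le hn A (polyOp (normalOp A) (resPoly c₀ r))
      (norm_comp_adjoint_le A _) x
    rw [norm_polyOp_comp_adjoint, norm_comp_resPoly_sq hn] at h1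
    refine h1.trans (mul_le_mul_of_nonneg_right ?_ (sq_nonneg _))
    have h2 := mul_kap_le (A := A) hn hc hcB r
    rw [div_mul_eq_mul_div, le_div_iff₀ hc]
    calc n * kap A c₀ r * c₀ = n * (c₀ * kap A c₀ r) := by ring
      _ ≤ _ := by gcongr
  have hmain := expect_landweber_sq_le (P := P) hn hI A (c := c₀) (k₀ := 0) (N := k)
    (u := fun j t => err A (yd + ξ) x0 xd c₀ M j t)
    (d := fun j t => incr A (yd + ξ) x0 xd c₀ M j t)
    (G := fun _ => (c₀ : 𝕜) • (n : 𝕜)⁻¹ • A.adjoint ξ) (fun _ _ _ => rfl)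
    (fun t => by rw [zero_add]; exact dependsOn_err hM hA t)
    (fun t => by rw [zero_add]; exact dependsOn_incr hM hA t)
    (fun j s _ => by rw [zero_add, err_succ hM hA, incr]) le_rfl (ContinuousLinearMap.id 𝕜 E)
    (V := fun _ => 0) (fun _ _ _ => rfl) hκ
  simp only [add_zero, err_zero, ContinuousLinearMap.id_apply, expect_const] at hmain
  refine hmain.trans (add_le_add le_rfl ?_)
  -- Conversion from epochs to steps: `s + 1 ≤ M(s/M + 1)` costs `M^(3/2) ≤ M²`, and `100 = 5/4 ·
  -- 80`.
  have hf : ∀ s, incrMean P I A (yd + ξ) x0 xd c₀ M s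
      ≤ 100 * B * M ^ 2 * (1 / (((s : ℝ) + 1) * √((s : ℝ) + 1))) := by
    intro s
    have h1 := incrMean_le (ξ := ξ) (x0 := x0) hn hM hI hA h (s / M) (Nat.mod_lt s hM)
    rw [Nat.div_add_mod'] at h1
    have h2 := epochMean_decay (P := P) (ξ := ξ) hn hM hI hA h hρ hξ (s / M)
    set y := ((s / M : ℕ) : ℝ) + 1 with hy
    have hy0 : 0 < y := by positivity
    have hsy : (s : ℝ) + 1 ≤ M * y := cast_le_mul_div hM s
    have hsq : √((s : ℝ) + 1) ≤ M * √y := by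
      calc √((s : ℝ) + 1) ≤ √(M * y) := Real.sqrt_le_sqrt hsy
        _ = √M * √y := Real.sqrt_mul (by positivity) _
        _ ≤ M * √y := by gcongr; exact sqrt_le_of_one_le hM1
    have hy1 := Real.sqrt_pos.2 hy0
    have hs1 : 0 < √((s : ℝ) + 1) := Real.sqrt_pos.2 (by positivity)
    have h3 : 1 / (y * √y) ≤ M ^ 2 * (1 / (((s : ℝ) + 1) * √((s : ℝ) + 1))) := by
      rw [mul_one_div, div_le_div_iff₀ (by positivity) (by positivity), one_mul]
      calc ((s : ℝ) + 1) * √((s : ℝ) + 1) ≤ (M * y) * (M * √y) := by gcongr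
        _ = _ := by ring
    have h4 := mul_le_mul_of_nonneg_left h3 (by positivity : 0 ≤ 100 * B)
    linarith
  calc c₀ ^ 2 * ∑ s ∈ Finset.range k, n / c₀ * (1 / (((k - 1 - s : ℕ) : ℝ) + 1))
        * expect P I (fun j => (n : ℝ)⁻¹ * ‖A (incr A (yd + ξ) x0 xd c₀ M j s)‖ ^ 2)
      ≤ c₀ ^ 2 * ∑ s ∈ Finset.range k, n / c₀ * (1 / (((k - 1 - s : ℕ) : ℝ) + 1))
        * (100 * B * M ^ 2 * (1 / (((s : ℝ) + 1) * √((s : ℝ) + 1)))) := by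
        refine mul_le_mul_of_nonneg_left (Finset.sum_le_sum fun s _ => ?_) (sq_nonneg _)
        exact mul_le_mul_of_nonneg_left (hf s) (by positivity)
    _ = c₀ * n * (100 * B * M ^ 2) * ∑ s ∈ Finset.range k, 1 / (((k - 1 - s : ℕ) : ℝ) + 1)
        * (1 / (((s : ℝ) + 1) * √((s : ℝ) + 1))) := by
        rw [Finset.mul_sum, Finset.mul_sum]
        refine Finset.sum_congr rfl fun s _ => ?_
        field_simp
    _ ≤ c₀ * n * (100 * B * M ^ 2) * (9 / (k + 1)) := by
        gcongr
        exact sum_inv_conv_le k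
    _ = _ := by ring

end Expectation

/-! ### Pathwise analysis through the gradients at the anchors. -/

section Pathwise

variable {𝕜 : Type*} [RCLike 𝕜] {n : ℕ}
  {E : Type*} [NormedAddCommGroup E] [InnerProductSpace 𝕜 E] [CompleteSpace E]
  {Y : Fin n → Type*} [∀ i, NormedAddCommGroup (Y i)] [∀ i, InnerProductSpace 𝕜 (Y i)]
  [∀ i, CompleteSpace (Y i)] {A : E →L[𝕜] PiLp 2 Y} {c₀ : ℝ} {M : ℕ}
  {yd ξ : PiLp 2 Y} {x0 xd : E}

theorem norm_le_mul_sqrt_maxSq (hn : 0 < n) : ‖A‖ ≤ n * √(maxSq A) := by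
  have hn1 : (1 : ℝ) ≤ n := by exact_mod_cast hn
  have hL := maxSq_nonneg A
  refine le_of_sq_le_sq ?_ (by positivity)
  rw [mul_pow, Real.sq_sqrt hL]
  have := norm_sq_le_maxSq A
  nlinarith [mul_nonneg (mul_nonneg hL (sub_nonneg.2 hn1)) (zero_le_one.trans hn1)]

/-- The pathwise step size condition without the logarithm. -/
theorem StepOKPath.mul_norm_le (hn : 0 < n) (hM : 0 < M) (h : StepOKPath A M c₀) :
    c₀ * M * √(maxSq A) * ‖A‖ ≤ 1 / 100 := by
  by_cases hA : A = 0
  · rw [hA, norm_zero, mul_zero]; norm_num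
  have hc := h.1
  have hL := Real.sqrt_pos.2 (maxSq_pos hA)
  have hM' : (0 : ℝ) < M := by exact_mod_cast hM
  have hn' : (0 : ℝ) < n := by exact_mod_cast hn
  have hA' : 0 < ‖A‖ := norm_pos_iff.2 hA
  have ht := (h.2 hA).2
  rw [pathThreshold] at ht
  -- Only this lower bound on the logarithm is needed; it follows from `‖A‖ ≤ n√L` and `2e² ≥ e`.
  have hlog : 1 ≤ Real.log (2 * Real.exp 1 ^ 2 * n * √(maxSq A) * ‖A‖⁻¹) := by
    rw [Real.le_log_iff_exp_le (by positivity)]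
    have h1 : 1 ≤ n * √(maxSq A) * ‖A‖⁻¹ := by
      rw [← div_eq_mul_inv, one_le_div hA']; exact norm_le_mul_sqrt_maxSq hn
    have h2 : 1 ≤ Real.exp 1 := by simp
    calc Real.exp 1 ≤ 2 * Real.exp 1 ^ 2 * 1 := by nlinarith
      _ ≤ 2 * Real.exp 1 ^ 2 * (n * √(maxSq A) * ‖A‖⁻¹) := by gcongr
      _ = _ := by ring
  rw [lt_inv_comm₀ hc (by positivity)] at ht
  have h3 : 100 * √(maxSq A) * M * ‖A‖ * 1 ≤ c₀⁻¹ :=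
    (mul_le_mul_of_nonneg_left hlog (by positivity)).trans ht.le
  rw [le_div_iff₀ (by norm_num)]
  calc c₀ * M * √(maxSq A) * ‖A‖ * 100 = c₀ * (100 * √(maxSq A) * M * ‖A‖ * 1) := by ring
    _ ≤ c₀ * c₀⁻¹ := by gcongr
    _ = 1 := mul_inv_cancel₀ hc.ne'

/-- Expanding the square, the cross term gains `2c₀‖A_i x‖²`, while the quadratic term costs at most
`c₀²L‖A_i x‖² ≤ c₀‖A_i x‖²`. -/
theorem norm_sub_smul_adjoint_le (hc : 0 < c₀) (hcL : c₀ * maxSq A ≤ 1) (i : Fin n) (x : E) :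
    ‖x - (c₀ : 𝕜) • (comp A i).adjoint (comp A i x)‖ ≤ ‖x‖ := by
  refine le_of_sq_le_sq ?_ (norm_nonneg _)
  have h1 : ‖(comp A i).adjoint (comp A i x)‖ ^ 2 ≤ maxSq A * ‖comp A i x‖ ^ 2 := by
    have h := (comp A i).adjoint.le_opNorm (comp A i x)
    rw [LinearIsometryEquiv.norm_map] at h
    calc _ ≤ (‖comp A i‖ * ‖comp A i x‖) ^ 2 := by gcongr
      _ = ‖comp A i‖ ^ 2 * ‖comp A i x‖ ^ 2 := by ring
      _ ≤ _ := by gcongr; exact norm_comp_sq_le A i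
  have h2 : RCLike.re (inner 𝕜 x ((c₀ : 𝕜) • (comp A i).adjoint (comp A i x)))
      = c₀ * ‖comp A i x‖ ^ 2 := by
    rw [inner_smul_right, ContinuousLinearMap.adjoint_inner_right, RCLike.re_ofReal_mul,
      inner_self_eq_norm_sq]
  have h3 : ‖(c₀ : 𝕜) • (comp A i).adjoint (comp A i x)‖ ^ 2
      = c₀ ^ 2 * ‖(comp A i).adjoint (comp A i x)‖ ^ 2 := by
    rw [norm_smul, mul_pow, RCLike.norm_ofReal, sq_abs]
  rw [@norm_sub_sq 𝕜, h2, h3]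
  have h4 : c₀ ^ 2 * ‖(comp A i).adjoint (comp A i x)‖ ^ 2 ≤ c₀ * ‖comp A i x‖ ^ 2 := by
    calc c₀ ^ 2 * ‖(comp A i).adjoint (comp A i x)‖ ^ 2
        ≤ c₀ ^ 2 * (maxSq A * ‖comp A i x‖ ^ 2) := by gcongr
      _ = (c₀ * maxSq A) * (c₀ * ‖comp A i x‖ ^ 2) := by ring
      _ ≤ 1 * (c₀ * ‖comp A i x‖ ^ 2) := by gcongr
      _ = _ := one_mul _
  nlinarith [mul_nonneg hc.le (sq_nonneg ‖comp A i x‖)]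

/-- Each inner step is the nonexpansive map `1 - c₀A_i*A_i` followed by the constant shift `-c₀g_K`,
so the distance to the anchor grows at most linearly, whatever the indices. -/
theorem norm_sub_anchor_le (hM : 0 < M) (hA : A.adjoint (A xd - yd) = 0) (hc : 0 < c₀)
    (hcL : c₀ * maxSq A ≤ 1) (j : ℕ → Fin n) (K : ℕ) {t : ℕ} (ht : t ≤ M) :
    ‖err A (yd + ξ) x0 xd c₀ M j (K * M + t) - err A (yd + ξ) x0 xd c₀ M j (K * M)‖
      ≤ t * (c₀ * ‖grad A ξ (yd + ξ) x0 xd c₀ M j K‖) := by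
  induction t with
  | zero => simp
  | succ t ih =>
    have hih := ih (by omega)
    rw [sub_anchor_succ hM hA j K (by omega), incr_eq _ _ _ (by omega : t < M)]
    set d := err A (yd + ξ) x0 xd c₀ M j (K * M + t) - err A (yd + ξ) x0 xd c₀ M j (K * M)
    set g := grad A ξ (yd + ξ) x0 xd c₀ M j K
    have e : polyOp (normalOp A) (resPoly c₀ 1) d - (c₀ : 𝕜) • g
        - (c₀ : 𝕜) • noiseOp A (j (K * M + t)) d
        = (d - (c₀ : 𝕜) • (comp A (j (K * M + t))).adjoint (comp A (j (K * M + t)) d))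
          - (c₀ : 𝕜) • g := by
      rw [polyOp_resPoly_one_apply, noiseOp_apply, smul_sub]
      abel
    rw [e]
    refine (norm_sub_le _ _).trans ?_
    rw [norm_smul, RCLike.norm_ofReal, abs_of_pos hc]
    have := norm_sub_smul_adjoint_le hc hcL (j (K * M + t)) d
    push_cast
    linarith

theorem norm_incr_le (hM : 0 < M) (hA : A.adjoint (A xd - yd) = 0) (hc : 0 < c₀)
    (hcL : c₀ * maxSq A ≤ 1) (j : ℕ → Fin n) (s : ℕ) :
    ‖incr A (yd + ξ) x0 xd c₀ M j s‖
      ≤ M * (c₀ * ‖grad A ξ (yd + ξ) x0 xd c₀ M j (s / M)‖) := by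
  have hlt := Nat.mod_lt s hM
  have h := norm_sub_anchor_le (ξ := ξ) (x0 := x0) hM hA hc hcL j (s / M) hlt.le
  rw [← incr_eq _ _ _ hlt, Nat.div_add_mod'] at h
  refine h.trans ?_
  gcongr

theorem err_unroll (hM : 0 < M) (hA : A.adjoint (A xd - yd) = 0) (j : ℕ → Fin n) (k : ℕ) :
    err A (yd + ξ) x0 xd c₀ M j k = polyOp (normalOp A) (resPoly c₀ k) (x0 - xd)
      + polyOp (normalOp A) (geoPoly c₀ k) ((c₀ : 𝕜) • (n : 𝕜)⁻¹ • A.adjoint ξ)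
      - ∑ s ∈ Finset.range k, polyOp (normalOp A) (resPoly c₀ (k - 1 - s))
        ((c₀ : 𝕜) • noiseOp A (j s) (incr A (yd + ξ) x0 xd c₀ M j s)) := by
  have := landweber_unroll (normalOp A) c₀ (u := fun k => err A (yd + ξ) x0 xd c₀ M j k)
    (fun t => err_succ (ξ := ξ) (x0 := x0) hM hA j t) k
  rw [this, err_zero]
  rfl

/-- Applying `B` to the unrolled error. The accumulated data noise combines with `-n⁻¹A*ξ` into
`-R^(KM) n⁻¹A*ξ`, since `1 - c₀B ∑_{s<KM} R^s = R^(KM)`; the gradient therefore decays although the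
error does not. -/
theorem grad_unroll (hM : 0 < M) (hA : A.adjoint (A xd - yd) = 0) (j : ℕ → Fin n) (K : ℕ) :
    grad A ξ (yd + ξ) x0 xd c₀ M j K
      = polyOp (normalOp A) (X * resPoly c₀ (K * M)) (x0 - xd)
      - polyOp (normalOp A) (resPoly c₀ (K * M)) ((n : 𝕜)⁻¹ • A.adjoint ξ)
      - ∑ s ∈ Finset.range (K * M), polyOp (normalOp A) (X * resPoly c₀ (K * M - 1 - s))
        ((c₀ : 𝕜) • noiseOp A (j s) (incr A (yd + ξ) x0 xd c₀ M j s)) := by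
  rw [grad, err_unroll hM hA]
  generalize (n : 𝕜)⁻¹ • A.adjoint ξ = ζ
  have e : resPoly c₀ (K * M) = 1 - C c₀ * (X * geoPoly c₀ (K * M)) := by
    rw [← mul_assoc, C_mul_X_mul_geoPoly]; ring
  have e2 : polyOp (normalOp A) (resPoly c₀ (K * M)) ζ
      = ζ - normalOp A (polyOp (normalOp A) (geoPoly c₀ (K * M)) ((c₀ : 𝕜) • ζ)) := by
    rw [e, polyOp_sub, sub_apply, polyOp_one, polyOp_C_mul_apply, polyOp_X_mul_apply, map_smul,
      map_smul]
    rfl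
  simp only [e2, map_sub, map_add, map_sum, polyOp_X_mul_apply]
  abel

/-- The kernel of the pathwise recursion of the gradients. -/
def pathKernel (A : E →L[𝕜] PiLp 2 Y) (c₀ : ℝ) (M : ℕ) (r : ℕ) : ℝ :=
  2 * c₀ ^ 2 * M * √(maxSq A) * ‖A.comp (polyOp (normalOp A) (X * resPoly c₀ r))‖

theorem pathKernel_nonneg (r : ℕ) : 0 ≤ pathKernel A c₀ M r := by
  unfold pathKernel; positivity

theorem norm_comp_X_mul_resPoly_le (hn : 0 < n) (hc : 0 < c₀) (hcB : c₀ * ‖normalOp A‖ ≤ 1)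
    (r : ℕ) : ‖A.comp (polyOp (normalOp A) (X * resPoly c₀ r))‖
      ≤ √n * √((‖normalOp A‖ / (1 + r * (c₀ * ‖normalOp A‖ / 2))) ^ 3) := by
  rw [← Real.sqrt_mul (by positivity)]
  refine norm_comp_polyOp_le hn A _ (by positivity) fun t ht => ?_
  rw [eval_mul, eval_X, eval_resPoly, mul_pow, ← mul_assoc, ← pow_succ']
  exact cube_mul_one_sub_pow_le hc ht.1 ht.2 hcB r

/-- The spectral sum `5√‖B‖` together with `√n √‖B‖ = ‖A‖` gives `10 c₀M√L‖A‖`, exactly the quantity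
that the step size condition makes at most `1/10`. -/
theorem sum_pathKernel_le (hn : 0 < n) (hM : 0 < M) (h : StepOKPath A M c₀) (N : ℕ) :
    ∑ r ∈ Finset.range N, pathKernel A c₀ M r ≤ 1 / 10 := by
  have hc := h.1
  have hcB := mul_norm_normalOp_le hn hc h.mul_maxSq_le
  have hsq : √n * √‖normalOp A‖ = ‖A‖ := by
    have : (n : ℝ) ≠ 0 := by exact_mod_cast hn.ne'
    rw [← Real.sqrt_mul (by positivity), norm_normalOp, mul_inv_cancel_left₀ this,
      Real.sqrt_sq (norm_nonneg _)]
  calc ∑ r ∈ Finset.range N, pathKernel A c₀ M r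
      ≤ ∑ r ∈ Finset.range N, 2 * c₀ * M * √(maxSq A) * √n
        * (c₀ * √((‖normalOp A‖ / (1 + r * (c₀ * ‖normalOp A‖ / 2))) ^ 3)) := by
        refine Finset.sum_le_sum fun r _ => ?_
        have := mul_le_mul_of_nonneg_left (norm_comp_X_mul_resPoly_le (A := A) hn hc hcB r)
          (by positivity : 0 ≤ 2 * c₀ ^ 2 * M * √(maxSq A))
        rw [pathKernel]
        refine this.trans (le_of_eq (by ring))
    _ ≤ 2 * c₀ * M * √(maxSq A) * √n * (5 * √‖normalOp A‖) := by
        rw [← Finset.mul_sum]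
        gcongr
        exact sum_path_kernel_le hc (norm_nonneg _) hcB N
    _ = 10 * (c₀ * M * √(maxSq A) * (√n * √‖normalOp A‖)) := by ring
    _ ≤ 10 * (1 / 100) := by
        rw [hsq]; gcongr; exact h.mul_norm_le hn hM
    _ = _ := by norm_num

theorem sqrt_maxSq_le (hc : 0 < c₀) (hcL : c₀ * maxSq A ≤ 1) : √(maxSq A) ≤ √(1 / c₀) :=
  Real.sqrt_le_sqrt (by rw [le_div_iff₀ hc]; linarith)

theorem pathKernel_le (hn : 0 < n) (hc : 0 < c₀) (hcL : c₀ * maxSq A ≤ 1) (r : ℕ) :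
    pathKernel A c₀ M r ≤ 2 * c₀ ^ 2 * M * √(1 / c₀) * (√n * ((2 / c₀) * √(2 / c₀)))
      * (1 / (((r : ℝ) + 1) * √((r : ℝ) + 1))) := by
  have hcB := mul_norm_normalOp_le hn hc hcL
  rw [pathKernel]
  calc 2 * c₀ ^ 2 * M * √(maxSq A) * ‖A.comp (polyOp (normalOp A) (X * resPoly c₀ r))‖
      ≤ 2 * c₀ ^ 2 * M * √(1 / c₀)
        * (√n * ((2 / c₀) * √(2 / c₀) * (1 / (((r : ℝ) + 1) * √((r : ℝ) + 1))))) := by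
        gcongr
        · rw [le_div_iff₀ hc]; linarith
        · refine (norm_comp_X_mul_resPoly_le hn hc hcB r).trans ?_
          gcongr
          exact path_kernel_le hc (norm_nonneg _) hcB r
    _ = _ := by ring

/-- The noise at step `s` has size proportional to the gradient of its own epoch; this closes the
recursion on the gradients. -/
theorem norm_polyOp_noise_le (hn : 0 < n) (hM : 0 < M) (hA : A.adjoint (A xd - yd) = 0)
    (hc : 0 < c₀) (hcL : c₀ * maxSq A ≤ 1) (j : ℕ → Fin n) (p : ℝ[X]) (s : ℕ) :
    ‖polyOp (normalOp A) p ((c₀ : 𝕜) • noiseOp A (j s) (incr A (yd + ξ) x0 xd c₀ M j s))‖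
      ≤ 2 * c₀ ^ 2 * M * √(maxSq A) * ‖A.comp (polyOp (normalOp A) p)‖
        * ‖grad A ξ (yd + ξ) x0 xd c₀ M j (s / M)‖ := by
  rw [map_smul, norm_smul, RCLike.norm_ofReal, abs_of_pos hc]
  calc c₀ * ‖polyOp (normalOp A) p (noiseOp A (j s) (incr A (yd + ξ) x0 xd c₀ M j s))‖
      ≤ c₀ * (2 * ‖A.comp (polyOp (normalOp A) p)‖ * √(maxSq A)
        * (M * (c₀ * ‖grad A ξ (yd + ξ) x0 xd c₀ M j (s / M)‖))) := by
        gcongr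
        refine (norm_noiseOp_le hn A _ _ _).trans ?_
        rw [norm_polyOp_comp_adjoint]
        gcongr
        exact norm_incr_le hM hA hc hcL j s
    _ = _ := by ring

/-- The forcing term of the pathwise recursion. -/
theorem norm_grad_forcing_le (hn : 0 < n) (hM : 0 < M) (hc : 0 < c₀) (hcL : c₀ * maxSq A ≤ 1)
    {ρ : ℝ} (hρ : ‖x0 - xd‖ ≤ ρ) (K : ℕ) :
    ‖polyOp (normalOp A) (X * resPoly c₀ (K * M)) (x0 - xd)
      - polyOp (normalOp A) (resPoly c₀ (K * M)) ((n : 𝕜)⁻¹ • A.adjoint ξ)‖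
      ≤ ρ / c₀ * (1 / ((K : ℝ) + 1)) + √(1 / c₀) * (‖ξ‖ / √((K : ℝ) + 1)) := by
  have hcB := mul_norm_normalOp_le hn hc hcL
  have hn1 : (1 : ℝ) ≤ n := by exact_mod_cast hn
  have hM1 : (1 : ℝ) ≤ M := by exact_mod_cast hM
  have hKM : (K : ℝ) ≤ K * M := le_mul_of_one_le_right (by positivity) hM1
  refine (norm_sub_le _ _).trans (add_le_add ?_ ?_)
  · have h1 : ‖polyOp (normalOp A) (X * resPoly c₀ (K * M))‖ ≤ 1 / c₀ * (1 / ((K : ℝ) + 1)) := by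
      refine norm_polyOp_le (normalOp_isPositive A) _ (by positivity) fun t ht => ?_
      obtain ⟨h0, h1⟩ := mul_mem_Icc hc hcB ht
      rw [eval_mul, eval_X, eval_resPoly,
        abs_of_nonneg (mul_nonneg ht.1 (pow_nonneg (by linarith) _)), div_mul_eq_mul_div,
        le_div_iff₀ hc, one_mul]
      calc t * (1 - c₀ * t) ^ (K * M) * c₀ = (c₀ * t) * (1 - c₀ * t) ^ (K * M) := by ring
        _ ≤ 1 / (((K * M : ℕ) : ℝ) + 1) := mul_one_sub_pow_le h0 h1 _
        _ ≤ _ := one_div_le_one_div_of_le (by positivity) (by push_cast; linarith)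
    refine (ContinuousLinearMap.le_of_opNorm_le _ h1 _).trans ?_
    calc 1 / c₀ * (1 / ((K : ℝ) + 1)) * ‖x0 - xd‖ ≤ 1 / c₀ * (1 / ((K : ℝ) + 1)) * ρ := by gcongr
      _ = _ := by ring
  · rw [map_smul, norm_smul, norm_inv, RCLike.norm_natCast]
    have h2 := norm_polyOp_adjoint_apply_le hn A (resPoly c₀ (K * M))
      (c := 1 / c₀ * (1 / ((K : ℝ) + 1))) (by positivity) (fun t ht => by
        obtain ⟨h0, h1⟩ := mul_mem_Icc hc hcB ht
        rw [eval_resPoly, div_mul_eq_mul_div, le_div_iff₀ hc, one_mul, ← pow_mul]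
        calc t * (1 - c₀ * t) ^ (K * M * 2) * c₀ = (c₀ * t) * (1 - c₀ * t) ^ (K * M * 2) := by ring
          _ ≤ 1 / (((K * M * 2 : ℕ) : ℝ) + 1) := mul_one_sub_pow_le h0 h1 _
          _ ≤ _ := one_div_le_one_div_of_le (by positivity) (by push_cast; linarith)) ξ
    rw [inv_mul_le_iff₀ (by positivity)]
    refine h2.trans ?_
    rw [Real.sqrt_mul (by positivity), Real.sqrt_mul (by positivity),
      Real.sqrt_div (by norm_num : (0 : ℝ) ≤ 1) ((K : ℝ) + 1), Real.sqrt_one]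
    have := sqrt_le_of_one_le hn1
    calc √(n : ℝ) * (√(1 / c₀) * (1 / √((K : ℝ) + 1))) * ‖ξ‖
        ≤ n * (√(1 / c₀) * (1 / √((K : ℝ) + 1))) * ‖ξ‖ := by gcongr
      _ = _ := by ring

theorem norm_grad_le (hn : 0 < n) (hM : 0 < M) (hA : A.adjoint (A xd - yd) = 0)
    (hc : 0 < c₀) (hcL : c₀ * maxSq A ≤ 1) {ρ : ℝ} (hρ : ‖x0 - xd‖ ≤ ρ) (j : ℕ → Fin n) (K : ℕ) :
    ‖grad A ξ (yd + ξ) x0 xd c₀ M j K‖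
      ≤ (ρ / c₀ * (1 / ((K : ℝ) + 1)) + √(1 / c₀) * (‖ξ‖ / √((K : ℝ) + 1)))
        + ∑ J ∈ Finset.range K, (∑ t ∈ Finset.range M, pathKernel A c₀ M ((K - 1 - J) * M + t))
          * ‖grad A ξ (yd + ξ) x0 xd c₀ M j J‖ := by
  rw [grad_unroll hM hA]
  refine (norm_sub_le _ _).trans (add_le_add (norm_grad_forcing_le hn hM hc hcL hρ K) ?_)
  refine (norm_sum_le _ _).trans ?_
  rw [sum_range_mul_eq]
  refine Finset.sum_le_sum fun J hJ => ?_
  have hJ := Finset.mem_range.1 hJ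
  rw [← Finset.sum_range_reflect (fun t => pathKernel A c₀ M ((K - 1 - J) * M + t)) M,
    Finset.sum_mul]
  refine Finset.sum_le_sum fun t ht => ?_
  have ht := Finset.mem_range.1 ht
  refine (norm_polyOp_noise_le hn hM hA hc hcL j _ _).trans ?_
  have e : K * M - 1 - (J * M + t) = (K - 1 - J) * M + (M - 1 - t) := by
    obtain ⟨l, rfl⟩ : ∃ l, K = J + 1 + l := ⟨K - (J + 1), by omega⟩
    have : J + 1 + l - 1 - J = l := by omega
    rw [this, add_mul, add_mul, one_mul]
    omega
  rw [e, mul_add_div _ ht, pathKernel]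

/-- The decay of the gradients at the anchor points, uniformly in the operator. -/
theorem exists_norm_grad_le (𝕜 : Type*) [RCLike 𝕜] {n : ℕ} (hn : 0 < n)
    (E : Type*) [NormedAddCommGroup E] [InnerProductSpace 𝕜 E] [CompleteSpace E]
    (Y : Fin n → Type*) [∀ i, NormedAddCommGroup (Y i)] [∀ i, InnerProductSpace 𝕜 (Y i)]
    [∀ i, CompleteSpace (Y i)] {M : ℕ} (hM : 0 < M) {c₀ : ℝ} (hc : 0 < c₀) {ρ : ℝ} (hρ0 : 0 ≤ ρ) :
    ∃ C : ℝ, 0 ≤ C ∧ ∀ (A : E →L[𝕜] PiLp 2 Y) (yd ξ : PiLp 2 Y) (x0 xd : E),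
      A.adjoint (A xd - yd) = 0 → StepOKPath A M c₀ → ‖x0 - xd‖ ≤ ρ → ‖ξ‖ ≤ 1 →
      ∀ (j : ℕ → Fin n) (K : ℕ), ‖grad A ξ (yd + ξ) x0 xd c₀ M j K‖
        ≤ C * (1 / ((K : ℝ) + 1) + ‖ξ‖ / √((K : ℝ) + 1)) := by
  set κ := M * (2 * c₀ ^ 2 * M * √(1 / c₀) * (√n * ((2 / c₀) * √(2 / c₀)))) with hκ
  have hκ0 : 0 ≤ κ := by positivity
  set B := ρ / c₀ + √(1 / c₀) with hB
  have hB0 : 0 ≤ B := by positivity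
  set C₁ := B / (1 - 1 / 10) with hC₁
  have hC₁0 : 0 ≤ C₁ := div_nonneg hB0 (by norm_num)
  set C₂ := (B + 4 * κ * C₁) / (1 - 1 / 5) with hC₂
  have hC₂0 : 0 ≤ C₂ := div_nonneg (by positivity) (by norm_num)
  refine ⟨(B + 8 * κ * C₂) / (1 - 1 / 5), div_nonneg (by positivity) (by norm_num), ?_⟩
  intro A yd ξ x0 xd hA h hρ hξ j
  have hcL := h.mul_maxSq_le
  have hξ0 := norm_nonneg ξ
  have hsq1 : ∀ K : ℕ, 0 < √((K : ℝ) + 1) := fun K => Real.sqrt_pos.2 (by positivity)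
  have hsqle : ∀ K : ℕ, √((K : ℝ) + 1) ≤ (K : ℝ) + 1 := fun K =>
    sqrt_le_of_one_le (by linarith [(Nat.cast_nonneg K : (0 : ℝ) ≤ K)])
  have hone : ∀ K : ℕ, (1 : ℝ) ≤ √((K : ℝ) + 1) := fun K =>
    Real.one_le_sqrt.2 (by linarith [(Nat.cast_nonneg K : (0 : ℝ) ≤ K)])
  have hrec := norm_grad_le (ξ := ξ) hn hM hA hc hcL hρ j
  set a : ℕ → ℝ := fun K => ‖grad A ξ (yd + ξ) x0 xd c₀ M j K‖ with ha
  set k : ℕ → ℝ := fun m => ∑ t ∈ Finset.range M, pathKernel A c₀ M (m * M + t) with hkdef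
  have ha0 : ∀ K, 0 ≤ a K := fun K => norm_nonneg _
  have hk0 : ∀ m, 0 ≤ k m := fun m => Finset.sum_nonneg fun t _ => pathKernel_nonneg _
  have hk : ∀ N, ∑ m ∈ Finset.range N, k m ≤ 1 / 10 := fun N => by
    rw [hkdef, ← sum_range_mul_eq]; exact sum_pathKernel_le hn hM h _
  have hkle : ∀ m, k m ≤ κ * (1 / (((m : ℝ) + 1) * √((m : ℝ) + 1))) := by
    intro m
    rw [hκ, mul_assoc]
    refine sum_le_of_le_const fun t _ => (pathKernel_le hn hc hcL _).trans ?_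
    have hM1 : (1 : ℝ) ≤ M := by exact_mod_cast hM
    have h1 : (m : ℝ) ≤ ((m * M + t : ℕ) : ℝ) := by
      push_cast
      have : (m : ℝ) ≤ m * M := le_mul_of_one_le_right (by positivity) hM1
      have : (0 : ℝ) ≤ t := by positivity
      linarith
    have := hsq1 m
    gcongr
  have hkfar : ∀ K : ℕ, ∀ J < K, 2 * (J + 1) < K + 1 →
      k (K - 1 - J) ≤ 4 * κ * (1 / (((K : ℝ) + 1) * √((K : ℝ) + 1))) := by
    intro K J hJ hJK
    refine (hkle _).trans ?_
    have hm : (K : ℝ) + 1 ≤ 2 * (((K - 1 - J : ℕ) : ℝ) + 1) := by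
      have : K + 1 ≤ 2 * ((K - 1 - J) + 1) := by omega
      exact_mod_cast this
    have hs : √((K : ℝ) + 1) ≤ 2 * √(((K - 1 - J : ℕ) : ℝ) + 1) := by
      calc √((K : ℝ) + 1) ≤ √(2 ^ 2 * (((K - 1 - J : ℕ) : ℝ) + 1)) :=
            Real.sqrt_le_sqrt (by nlinarith)
        _ = _ := by rw [Real.sqrt_mul (by norm_num), Real.sqrt_sq (by norm_num)]
    have := hsq1 (K - 1 - J)
    have := hsq1 K
    have h4 : 1 / ((((K - 1 - J : ℕ) : ℝ) + 1) * √(((K - 1 - J : ℕ) : ℝ) + 1))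
        ≤ 4 * (1 / (((K : ℝ) + 1) * √((K : ℝ) + 1))) := by
      rw [mul_one_div, div_le_div_iff₀ (by positivity) (by positivity), one_mul]
      calc ((K : ℝ) + 1) * √((K : ℝ) + 1)
          ≤ (2 * (((K - 1 - J : ℕ) : ℝ) + 1)) * (2 * √(((K - 1 - J : ℕ) : ℝ) + 1)) := by gcongr
        _ = _ := by ring
    calc _ ≤ κ * (4 * (1 / (((K : ℝ) + 1) * √((K : ℝ) + 1)))) := by gcongr
      _ = _ := by ring
  have hsqD : ∀ K : ℕ, ∀ J < K, K + 1 ≤ 2 * (J + 1) → 1 / √((J : ℝ) + 1) ≤ 2 * (1 / √((K : ℝ) + 1)) := by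
    intro K J _ hJK
    have hm : (K : ℝ) + 1 ≤ 2 * ((J : ℝ) + 1) := by exact_mod_cast hJK
    have := hsq1 J
    rw [mul_one_div, div_le_div_iff₀ (hsq1 J) (hsq1 K), one_mul]
    calc √((K : ℝ) + 1) ≤ √(2 ^ 2 * ((J : ℝ) + 1)) :=
          Real.sqrt_le_sqrt (by nlinarith [(Nat.cast_nonneg J : (0 : ℝ) ≤ J)])
      _ = _ := by rw [Real.sqrt_mul (by norm_num), Real.sqrt_sq (by norm_num)]
  have hb1 : ∀ K : ℕ, ρ / c₀ * (1 / ((K : ℝ) + 1)) + √(1 / c₀) * (‖ξ‖ / √((K : ℝ) + 1))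
      ≤ B * (1 / √((K : ℝ) + 1)) := by
    intro K
    have := hsq1 K
    have h1 : 1 / ((K : ℝ) + 1) ≤ 1 / √((K : ℝ) + 1) := one_div_le_one_div_of_le this (hsqle K)
    rw [hB, add_mul]
    gcongr
  have hb0 : ∀ K : ℕ, ρ / c₀ * (1 / ((K : ℝ) + 1)) + √(1 / c₀) * (‖ξ‖ / √((K : ℝ) + 1)) ≤ B := by
    intro K
    refine (hb1 K).trans (mul_le_of_le_one_right hB0 ?_)
    rw [div_le_one (hsq1 K)]
    exact hone K
  have hb2 : ∀ K : ℕ, ρ / c₀ * (1 / ((K : ℝ) + 1)) + √(1 / c₀) * (‖ξ‖ / √((K : ℝ) + 1))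
      ≤ B * (1 / ((K : ℝ) + 1) + ‖ξ‖ / √((K : ℝ) + 1)) := by
    intro K
    rw [mul_add]
    have h1 : ρ / c₀ ≤ B := by rw [hB]; linarith [Real.sqrt_nonneg (1 / c₀)]
    have h2 : √(1 / c₀) ≤ B := by
      have : 0 ≤ ρ / c₀ := by positivity
      rw [hB]; linarith
    gcongr
  -- A bootstrap in three rounds, since the contribution of the old epochs, `K^(-3/2) ∑ a J`, is
  -- only as good as the bound on `a` already known. This first round gives boundedness.
  have hbdd := volterra_bounded hk0 hrec hk (by norm_num) hB0 hb0
  -- Second round: bounded gradients sum to `O(K)`, so the old epochs contribute `O(K^(-1/2))`. With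
  -- `D = 2` and mass `1/10`, `θ = 1/5`.
  have hdec1 := volterra_decay (w := fun K => 1 / √((K : ℝ) + 1))
    (u := fun K => 4 * κ * (1 / (((K : ℝ) + 1) * √((K : ℝ) + 1)))) (D := 2) (C₁ := B)
    (C₂ := 4 * κ * C₁) (θ := 1 / 5) ha0 hk0 hrec hk (fun K => by positivity) hsqD (by norm_num)
    (fun K => by positivity) hkfar (by norm_num) (by norm_num) hB0 (by positivity) hb1 (by
      intro K
      have h1 : ∑ J ∈ Finset.range K, a J ≤ ((K : ℝ) + 1) * C₁ := by
        refine (sum_le_of_le_const fun J _ => hbdd J).trans ?_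
        gcongr
        linarith
      have := hsq1 K
      calc 4 * κ * (1 / (((K : ℝ) + 1) * √((K : ℝ) + 1))) * ∑ J ∈ Finset.range K, a J
          ≤ 4 * κ * (1 / (((K : ℝ) + 1) * √((K : ℝ) + 1))) * (((K : ℝ) + 1) * C₁) := by gcongr
        _ = _ := by field_simp)
  -- Third round: the sum is now `O(√K)`, so the old epochs contribute `O(1/K)`, and the rate
  -- becomes that of the forcing term.
  refine volterra_decay (w := fun K => 1 / ((K : ℝ) + 1) + ‖ξ‖ / √((K : ℝ) + 1))
    (u := fun K => 4 * κ * (1 / (((K : ℝ) + 1) * √((K : ℝ) + 1)))) (D := 2) (C₁ := B)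
    (C₂ := 8 * κ * C₂) (θ := 1 / 5) ha0 hk0 hrec hk (fun K => by positivity) ?_ (by norm_num)
    (fun K => by positivity) hkfar (by norm_num) (by norm_num) hB0 (by positivity) hb2 ?_
  · intro K J hJ hJK
    have hm : (K : ℝ) + 1 ≤ 2 * ((J : ℝ) + 1) := by exact_mod_cast hJK
    have h1 : 1 / ((J : ℝ) + 1) ≤ 2 * (1 / ((K : ℝ) + 1)) := by
      rw [mul_one_div, div_le_div_iff₀ (by positivity) (by positivity), one_mul]
      exact hm
    have h2 := mul_le_mul_of_nonneg_left (hsqD K J hJ hJK) hξ0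
    simp only [div_eq_mul_one_div ‖ξ‖]
    linarith
  · intro K
    have h1 : ∑ J ∈ Finset.range K, a J ≤ C₂ * (2 * √((K : ℝ) + 1)) := by
      refine (Finset.sum_le_sum fun J _ => hdec1 J).trans ?_
      rw [← Finset.mul_sum]
      gcongr
      refine (sum_inv_sqrt_le K).trans ?_
      gcongr
      linarith
    have := hsq1 K
    calc 4 * κ * (1 / (((K : ℝ) + 1) * √((K : ℝ) + 1))) * ∑ J ∈ Finset.range K, a J
        ≤ 4 * κ * (1 / (((K : ℝ) + 1) * √((K : ℝ) + 1))) * (C₂ * (2 * √((K : ℝ) + 1))) := by gcongr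
      _ = 8 * κ * C₂ * (1 / ((K : ℝ) + 1)) := by field_simp; ring
      _ ≤ _ := by
        have : 0 ≤ ‖ξ‖ / √((K : ℝ) + 1) := by positivity
        gcongr
        linarith

/-- Pathwise error of SVRG: the error of the Landweber method plus a small perturbation. -/
theorem exists_norm_err_le (𝕜 : Type*) [RCLike 𝕜] {n : ℕ} (hn : 0 < n)
    (E : Type*) [NormedAddCommGroup E] [InnerProductSpace 𝕜 E] [CompleteSpace E]
    (Y : Fin n → Type*) [∀ i, NormedAddCommGroup (Y i)] [∀ i, InnerProductSpace 𝕜 (Y i)]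
    [∀ i, CompleteSpace (Y i)] {M : ℕ} (hM : 0 < M) {c₀ : ℝ} (hc : 0 < c₀) {ρ : ℝ} (hρ0 : 0 ≤ ρ) :
    ∃ C : ℝ, 0 ≤ C ∧ ∀ (A : E →L[𝕜] PiLp 2 Y) (yd ξ : PiLp 2 Y) (x0 xd : E),
      A.adjoint (A xd - yd) = 0 → StepOKPath A M c₀ → ‖x0 - xd‖ ≤ ρ → ‖ξ‖ ≤ 1 →
      ∀ (j : ℕ → Fin n) (k : ℕ), ‖err A (yd + ξ) x0 xd c₀ M j k‖
        ≤ ‖polyOp (normalOp A) (resPoly c₀ k) (x0 - xd)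
          + polyOp (normalOp A) (geoPoly c₀ k) ((c₀ : 𝕜) • (n : 𝕜)⁻¹ • A.adjoint ξ)‖
          + C * ((9 + Real.log k) / √((k : ℝ) + 1) + 8 * ‖ξ‖) := by
  obtain ⟨C, hC0, hC⟩ := exists_norm_grad_le 𝕜 hn E Y hM hc hρ0
  refine ⟨2 * c₀ ^ 2 * M * √(1 / c₀) * √(n * (1 / c₀)) * (C * M), by positivity, ?_⟩
  intro A yd ξ x0 xd hA h hρ hξ j k
  have hcL := h.mul_maxSq_le
  have hcB := mul_norm_normalOp_le hn hc hcL
  have hM1 : (1 : ℝ) ≤ M := by exact_mod_cast hM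
  have hξ0 := norm_nonneg ξ
  rw [err_unroll hM hA]
  refine (norm_sub_le _ _).trans (add_le_add le_rfl ((norm_sum_le _ _).trans ?_))
  set D := 2 * c₀ ^ 2 * M * √(1 / c₀) * √(n * (1 / c₀)) * (C * M) with hD
  -- Smoothing `‖A R^r‖ = O(1/√(r+1))` against the gradient decay, transferred from epochs to steps
  -- at the cost of a factor `M`; the two convolution bounds then finish.
  have hpt : ∀ s ∈ Finset.range k, ‖polyOp (normalOp A) (resPoly c₀ (k - 1 - s))
      ((c₀ : 𝕜) • noiseOp A (j s) (incr A (yd + ξ) x0 xd c₀ M j s))‖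
      ≤ D * (1 / √(((k - 1 - s : ℕ) : ℝ) + 1) * (1 / ((s : ℝ) + 1))
        + ‖ξ‖ * (1 / √(((k - 1 - s : ℕ) : ℝ) + 1) * (1 / √((s : ℝ) + 1)))) := by
    intro s _
    have hs1 : 0 < √((s : ℝ) + 1) := Real.sqrt_pos.2 (by positivity)
    have hg := hC A yd ξ x0 xd hA h hρ hξ j (s / M)
    have h1 : ‖A.comp (polyOp (normalOp A) (resPoly c₀ (k - 1 - s)))‖
        ≤ √(n * (1 / c₀)) * (1 / √(((k - 1 - s : ℕ) : ℝ) + 1)) := by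
      have := mul_kap_le (A := A) hn hc hcB (k - 1 - s)
      have h2 : kap A c₀ (k - 1 - s) ≤ 1 / c₀ * (1 / (((k - 1 - s : ℕ) : ℝ) + 1)) := by
        rw [div_mul_eq_mul_div, le_div_iff₀ hc, one_mul]; linarith
      refine le_of_sq_le_sq ?_ (by positivity)
      rw [norm_comp_resPoly_sq hn, mul_pow, Real.sq_sqrt (by positivity), div_pow, one_pow,
        Real.sq_sqrt (by positivity), mul_assoc]
      gcongr
    set y := ((s / M : ℕ) : ℝ) + 1 with hy
    have hy0 : 0 < y := by positivity
    have hsy : (s : ℝ) + 1 ≤ M * y := cast_le_mul_div hM s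
    have hyy := Real.sqrt_pos.2 hy0
    have hsq : √((s : ℝ) + 1) ≤ M * √y := by
      calc √((s : ℝ) + 1) ≤ √(M * y) := Real.sqrt_le_sqrt hsy
        _ = √M * √y := Real.sqrt_mul (by positivity) _
        _ ≤ M * √y := by gcongr; exact sqrt_le_of_one_le hM1
    have h3 : 1 / y ≤ M * (1 / ((s : ℝ) + 1)) := by
      rw [mul_one_div, div_le_div_iff₀ hy0 (by positivity), one_mul]; exact hsy
    have h4 : 1 / √y ≤ M * (1 / √((s : ℝ) + 1)) := by
      rw [mul_one_div, div_le_div_iff₀ hyy hs1, one_mul]; exact hsq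
    have h5 : 1 / y + ‖ξ‖ / √y ≤ M * (1 / ((s : ℝ) + 1) + ‖ξ‖ * (1 / √((s : ℝ) + 1))) := by
      have := mul_le_mul_of_nonneg_left h4 hξ0
      rw [div_eq_mul_one_div ‖ξ‖]
      linarith
    refine (norm_polyOp_noise_le hn hM hA hc hcL j _ s).trans ?_
    calc 2 * c₀ ^ 2 * M * √(maxSq A) * ‖A.comp (polyOp (normalOp A) (resPoly c₀ (k - 1 - s)))‖
          * ‖grad A ξ (yd + ξ) x0 xd c₀ M j (s / M)‖
        ≤ 2 * c₀ ^ 2 * M * √(1 / c₀) * (√(n * (1 / c₀)) * (1 / √(((k - 1 - s : ℕ) : ℝ) + 1)))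
          * (C * (M * (1 / ((s : ℝ) + 1) + ‖ξ‖ * (1 / √((s : ℝ) + 1))))) := by
          have := sqrt_maxSq_le hc hcL
          refine mul_le_mul (mul_le_mul (mul_le_mul_of_nonneg_left this (by positivity)) h1
            (norm_nonneg _) (by positivity)) (hg.trans ?_) (norm_nonneg _) (by positivity)
          gcongr
      _ = _ := by rw [hD]; ring
  refine (Finset.sum_le_sum hpt).trans ?_
  rw [← Finset.mul_sum, Finset.sum_add_distrib, ← Finset.mul_sum]
  have hA1 := sum_sqrt_conv_inv_le k
  have hA2 := mul_le_mul_of_nonneg_left (sum_sqrt_conv_sqrt_le k) hξ0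
  refine mul_le_mul_of_nonneg_left ?_ (by positivity)
  linarith

end Pathwise

/-! ### Landweber bias and noise under a reducing projection. -/

section Bias

variable {𝕜 : Type*} [RCLike 𝕜] {n : ℕ}
  {E : Type*} [NormedAddCommGroup E] [InnerProductSpace 𝕜 E] [CompleteSpace E]
  {Y : Fin n → Type*} [∀ i, NormedAddCommGroup (Y i)] [∀ i, InnerProductSpace 𝕜 (Y i)]
  [∀ i, CompleteSpace (Y i)] {Ad : E →L[𝕜] PiLp 2 Y} {P : E →L[𝕜] E} {c₀ : ℝ}

/-- `P` is an orthogonal projection that commutes with `B = n⁻¹ Ad* Ad`. -/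
structure IsReducing (Ad : E →L[𝕜] PiLp 2 Y) (P : E →L[𝕜] E) : Prop where
  proj : IsStarProjection P
  comm : ∀ x, P (normalOp Ad x) = normalOp Ad (P x)

theorem isReducing_one (Ad : E →L[𝕜] PiLp 2 Y) : IsReducing Ad 1 :=
  ⟨IsStarProjection.one _, fun _ => rfl⟩

theorem IsReducing.one_sub (h : IsReducing Ad P) : IsReducing Ad (1 - P) :=
  ⟨h.proj.one_sub, fun x => by simp [h.comm]⟩

theorem IsReducing.apply_apply (h : IsReducing Ad P) (x : E) : P (P x) = P x :=
  congrArg (fun S : E →L[𝕜] E => S x) h.proj.isIdempotentElem.eq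

theorem IsReducing.adjoint_eq (h : IsReducing Ad P) : P.adjoint = P :=
  h.proj.isSelfAdjoint.adjoint_eq

theorem IsReducing.norm_apply_le (h : IsReducing Ad P) (x : E) : ‖P x‖ ≤ ‖x‖ := by
  simpa using P.le_of_opNorm_le (IsStarProjection.norm_le P h.proj) x

theorem IsReducing.normalOp_comp_apply (h : IsReducing Ad P) (x : E) :
    normalOp (Ad.comp P) x = normalOp Ad (P x) := by
  have : normalOp (Ad.comp P) x = P (normalOp Ad (P x)) := by
    rw [normalOp_apply, normalOp_apply, ContinuousLinearMap.adjoint_comp, h.adjoint_eq, map_smul]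
    rfl
  rw [this, h.comm, h.apply_apply]

theorem IsReducing.norm_normalOp_comp_le (h : IsReducing Ad P) :
    ‖normalOp (Ad.comp P)‖ ≤ ‖normalOp Ad‖ := by
  rw [norm_normalOp, norm_normalOp]
  have h1 : ‖Ad.comp P‖ ≤ ‖Ad‖ := (Ad.opNorm_comp_le P).trans
    (mul_le_of_le_one_right (norm_nonneg _) (IsStarProjection.norm_le P h.proj))
  gcongr

theorem IsReducing.apply_polyOp (h : IsReducing Ad P) (p : ℝ[X]) (x : E) :
    P (polyOp (normalOp Ad) p x) = polyOp (normalOp (Ad.comp P)) p (P x) :=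
  polyOp_intertwine (fun x => by rw [h.comm, h.normalOp_comp_apply, h.apply_apply]) p x

/-- The residual `A_†(Px - x)` is orthogonal to the range of `A_†P` because `P` commutes with `B_†`.
Thus the regularized operator sees the exact data as consistent, and the error recursion holds
without a model error term. -/
theorem IsReducing.adjoint_residual_eq_zero (hn : 0 < n) (h : IsReducing Ad P) (x : E) :
    (Ad.comp P).adjoint ((Ad.comp P) x - Ad x) = 0 := by
  have : (Ad.comp P) x - Ad x = Ad (P x - x) := by rw [map_sub]; rfl
  rw [this, ContinuousLinearMap.adjoint_comp, h.adjoint_eq, ContinuousLinearMap.comp_apply,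
    adjoint_apply_apply hn, map_smul, h.comm, map_sub, h.apply_apply, sub_self, map_zero, smul_zero]

theorem norm_polyOp_resPoly_apply_le {A : E →L[𝕜] PiLp 2 Y} (hc : 0 < c₀)
    (hcB : c₀ * ‖normalOp A‖ ≤ 1) (k : ℕ) (x : E) :
    ‖polyOp (normalOp A) (resPoly c₀ k) x‖ ≤ ‖x‖ := by
  have h : ‖polyOp (normalOp A) (resPoly c₀ k)‖ ≤ 1 := by
    refine norm_polyOp_le (normalOp_isPositive A) _ zero_le_one fun t ht => ?_
    obtain ⟨h0, h1⟩ := mul_mem_Icc hc hcB ht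
    rw [eval_resPoly, abs_of_nonneg (pow_nonneg (by linarith) _)]
    exact pow_le_one₀ (by linarith) (by linarith)
  simpa using (polyOp (normalOp A) (resPoly c₀ k)).le_of_opNorm_le h x

/-- The approximation error under the source condition: decay `k ^ (-ν)` plus the part cut off by
the regularization. -/
theorem IsReducing.norm_resPoly_fracPow_le (h : IsReducing Ad P) {τ : ℝ} (hτ : 0 ≤ τ)
    (hcut : ∀ x, ‖Ad (x - P x)‖ ≤ τ * ‖x‖) (hc : 0 < c₀)
    (hcB : c₀ * ‖normalOp (Ad.comp P)‖ ≤ 1) {ν : ℝ} (hν : 0 < ν) {k : ℕ} (hk : 0 < k) (w : E) :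
    ‖polyOp (normalOp (Ad.comp P)) (resPoly c₀ k) (fracPow (normalOp Ad) ν w)‖
      ≤ (ν ^ ν * c₀ ^ (-ν) * (k : ℝ) ^ (-ν) + ((n : ℝ)⁻¹ * τ ^ 2) ^ ν) * ‖w‖ := by
  set B := normalOp (Ad.comp P) with hB
  set D := normalOp (Ad.comp (1 - P)) with hD
  have hQ := h.one_sub
  have hDτ : ‖D‖ ≤ (n : ℝ)⁻¹ * τ ^ 2 := by
    rw [hD, norm_normalOp]
    have : ‖Ad.comp (1 - P)‖ ≤ τ := ContinuousLinearMap.opNorm_le_bound _ hτ fun x => by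
      simpa using hcut x
    gcongr
  -- The fractional power is only a limit of polynomials in `B_†`, so the estimate is shown up to
  -- `3ε‖w‖`: one `ε` on each of the two reduced parts and one for the approximation of the
  -- operator.
  suffices H : ∀ ε : ℝ, 0 < ε →
      ‖polyOp B (resPoly c₀ k) (fracPow (normalOp Ad) ν w)‖
        ≤ (ν ^ ν * c₀ ^ (-ν) * (k : ℝ) ^ (-ν) + ((n : ℝ)⁻¹ * τ ^ 2) ^ ν) * ‖w‖
          + 3 * ε * ‖w‖ by
    refine le_of_forall_pos_le_add fun ε hε => (H (ε / (3 * (‖w‖ + 1))) (by positivity)).trans ?_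
    gcongr
    rw [mul_div_assoc', mul_div_mul_left _ _ three_ne_zero, div_mul_eq_mul_div,
      div_le_iff₀ (by positivity)]
    nlinarith [norm_nonneg w]
  intro ε hε
  obtain ⟨p, hp, hpS⟩ := isFunCalc_fracPow (normalOp_isPositive Ad) hν ε hε
  set S := fracPow (normalOp Ad) ν
  -- On the range of `P` the residual polynomial damps `t^ν`. On the complement it is only bounded
  -- by `1`, but there the spectrum lies below `n⁻¹τ²`.
  have e : S w = polyOp B p (P w) + polyOp D p ((1 - P) w)
      - (polyOp (normalOp Ad) p - S) w := by
    have h1 := h.apply_polyOp p w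
    have h2 := hQ.apply_polyOp p w
    rw [← h1, ← h2]
    simp
  have b1 : ‖polyOp B (resPoly c₀ k) (polyOp B p (P w))‖
      ≤ (ν ^ ν * c₀ ^ (-ν) * (k : ℝ) ^ (-ν) + ε) * ‖w‖ := by
    rw [← polyOp_mul_apply]
    refine (ContinuousLinearMap.le_of_opNorm_le _ (norm_polyOp_le (normalOp_isPositive _) _
      (by positivity) fun t ht => ?_) (P w)).trans
      (mul_le_mul_of_nonneg_left (h.norm_apply_le w) (by positivity))
    obtain ⟨h0, h1⟩ := mul_mem_Icc hc hcB ht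
    have h2 : |p.eval t| ≤ t ^ ν + ε := by
      have h3 := hp t ⟨ht.1, ht.2.trans h.norm_normalOp_comp_le⟩
      have h4 := Real.rpow_nonneg ht.1 ν
      rw [abs_le] at h3 ⊢
      constructor <;> linarith
    have h5 : 0 ≤ (1 - c₀ * t) ^ k := pow_nonneg (by linarith) _
    have h6 : (1 - c₀ * t) ^ k ≤ 1 := pow_le_one₀ (by linarith) (by linarith)
    have h7 : t ^ ν * (1 - c₀ * t) ^ k ≤ ν ^ ν * c₀ ^ (-ν) * (k : ℝ) ^ (-ν) := by
      have h8 := rpow_mul_one_sub_pow_le hν h0 h1 hk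
      rw [Real.mul_rpow hc.le ht.1] at h8
      have h9 : 0 < c₀ ^ ν := Real.rpow_pos_of_pos hc ν
      rw [Real.rpow_neg hc.le]
      calc t ^ ν * (1 - c₀ * t) ^ k = (c₀ ^ ν)⁻¹ * (c₀ ^ ν * t ^ ν * (1 - c₀ * t) ^ k) := by
            field_simp
        _ ≤ (c₀ ^ ν)⁻¹ * (ν ^ ν * (k : ℝ) ^ (-ν)) := by gcongr
        _ = _ := by ring
    rw [eval_mul, eval_resPoly, abs_mul, abs_of_nonneg h5]
    nlinarith
  have b2 : ‖polyOp B (resPoly c₀ k) (polyOp D p ((1 - P) w))‖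
      ≤ (((n : ℝ)⁻¹ * τ ^ 2) ^ ν + ε) * ‖w‖ := by
    refine (norm_polyOp_resPoly_apply_le hc hcB k _).trans ?_
    refine (ContinuousLinearMap.le_of_opNorm_le _ (norm_polyOp_le (normalOp_isPositive _) _
      (by positivity) fun t ht => ?_) _).trans
      (mul_le_mul_of_nonneg_left (hQ.norm_apply_le w) (by positivity))
    have h3 := hp t ⟨ht.1, ht.2.trans hQ.norm_normalOp_comp_le⟩
    have h4 := Real.rpow_nonneg ht.1 ν
    have h5 : t ^ ν ≤ ((n : ℝ)⁻¹ * τ ^ 2) ^ ν := Real.rpow_le_rpow ht.1 (ht.2.trans hDτ) hν.le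
    rw [abs_le] at h3 ⊢
    constructor <;> linarith
  have b3 : ‖polyOp B (resPoly c₀ k) ((polyOp (normalOp Ad) p - S) w)‖ ≤ ε * ‖w‖ :=
    (norm_polyOp_resPoly_apply_le hc hcB k _).trans (ContinuousLinearMap.le_of_opNorm_le _ hpS w)
  rw [e, map_sub, map_add]
  have := norm_sub_le (polyOp B (resPoly c₀ k) (polyOp B p (P w))
    + polyOp B (resPoly c₀ k) (polyOp D p ((1 - P) w)))
    (polyOp B (resPoly c₀ k) ((polyOp (normalOp Ad) p - S) w))
  have := norm_add_le (polyOp B (resPoly c₀ k) (polyOp B p (P w)))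
    (polyOp B (resPoly c₀ k) (polyOp D p ((1 - P) w)))
  linarith

theorem smul_smul_adjoint_eq (A : E →L[𝕜] PiLp 2 Y) (k : ℕ) (ξ : PiLp 2 Y) :
    polyOp (normalOp A) (geoPoly c₀ k) ((c₀ : 𝕜) • (n : 𝕜)⁻¹ • A.adjoint ξ)
      = (n : 𝕜)⁻¹ • polyOp (normalOp A) (C c₀ * geoPoly c₀ k) (A.adjoint ξ) := by
  rw [map_smul, map_smul, polyOp_C_mul_apply, smul_comm]

/-- Propagated noise of the Landweber method after `k` steps. -/
theorem norm_geoPoly_noise_le (hn : 0 < n) {A : E →L[𝕜] PiLp 2 Y} (hc : 0 < c₀)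
    (hcB : c₀ * ‖normalOp A‖ ≤ 1) (k : ℕ) (ξ : PiLp 2 Y) :
    ‖polyOp (normalOp A) (geoPoly c₀ k) ((c₀ : 𝕜) • (n : 𝕜)⁻¹ • A.adjoint ξ)‖
      ≤ √(c₀ * k) * ‖ξ‖ := by
  have hn1 : (1 : ℝ) ≤ n := by exact_mod_cast hn
  rw [smul_smul_adjoint_eq, norm_smul, norm_inv, RCLike.norm_natCast]
  have h := norm_polyOp_adjoint_apply_le hn A (C c₀ * geoPoly c₀ k) (c := c₀ * k)
    (by positivity) (fun t ht => ?_) ξ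
  · calc (n : ℝ)⁻¹ * ‖polyOp (normalOp A) (C c₀ * geoPoly c₀ k) (A.adjoint ξ)‖
        ≤ (n : ℝ)⁻¹ * (√(n * (c₀ * k)) * ‖ξ‖) := by gcongr
      _ = (n : ℝ)⁻¹ * √n * (√(c₀ * k) * ‖ξ‖) := by
        rw [Real.sqrt_mul (by positivity)]; ring
      _ ≤ 1 * (√(c₀ * k) * ‖ξ‖) := by
        gcongr
        rw [inv_mul_le_iff₀ (by positivity), mul_one]
        exact sqrt_le_of_one_le hn1
      _ = _ := one_mul _
  · obtain ⟨h0, h1⟩ := mul_mem_Icc hc hcB ht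
    have e : c₀ * t * (geoPoly c₀ k).eval t = 1 - (1 - c₀ * t) ^ k := by
      have := congrArg (eval t) (C_mul_X_mul_geoPoly c₀ k)
      simpa [eval_resPoly] using this
    have h2 := one_sub_pow_mem h0 h1 k
    have h3 := (geoPoly_mono hc hcB ht (Nat.zero_le k)).2
    rw [geoPoly_zero, eval_zero] at h3
    have h4 : (geoPoly c₀ k).eval t ≤ k := by
      rw [eval_geoPoly]
      calc ∑ s ∈ Finset.range k, (1 - c₀ * t) ^ s ≤ ∑ _s ∈ Finset.range k, (1 : ℝ) :=
            Finset.sum_le_sum fun s _ => pow_le_one₀ (by linarith) (by linarith)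
        _ = k := by simp
    rw [eval_mul, eval_C]
    calc t * (c₀ * (geoPoly c₀ k).eval t) ^ 2
        = c₀ * (c₀ * t * (geoPoly c₀ k).eval t) * (geoPoly c₀ k).eval t := by ring
      _ ≤ c₀ * 1 * k := by
        rw [e]; gcongr
        exact h2.2
      _ = _ := by ring

/-- Propagated noise of the Landweber method when the nonzero singular values are `≥ τ`. -/
theorem IsReducing.norm_geoPoly_noise_le_div (hn : 0 < n) (h : IsReducing Ad P) {τ : ℝ}
    (hτ : 0 < τ) (hlow : ∀ x, τ * ‖P x‖ ≤ ‖Ad (P x)‖) (hc : 0 < c₀)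
    (hcB : c₀ * ‖normalOp (Ad.comp P)‖ ≤ 1) (k : ℕ) (ξ : PiLp 2 Y) :
    ‖polyOp (normalOp (Ad.comp P)) (geoPoly c₀ k)
        ((c₀ : 𝕜) • (n : 𝕜)⁻¹ • (Ad.comp P).adjoint ξ)‖ ≤ ‖ξ‖ / τ := by
  set A := Ad.comp P with hA
  set v := polyOp (normalOp A) (geoPoly c₀ k) ((c₀ : 𝕜) • (n : 𝕜)⁻¹ • A.adjoint ξ) with hv
  have hn0 : (n : 𝕜) ≠ 0 := by exact_mod_cast hn.ne'
  -- The propagated noise stays in the range of `P`, where `τ‖v‖ ≤ ‖A_†v‖`; and `‖Av‖ ≤ ‖ξ‖` since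
  -- the filter satisfies `c₀t ∑_{s<k}(1 - c₀t)^s ≤ 1`.
  have hPv : P v = v := by
    have h1 : ∀ x, P (normalOp A x) = normalOp A (P x) := fun x => by
      rw [hA, h.normalOp_comp_apply, h.normalOp_comp_apply, h.comm]
    rw [hv, polyOp_intertwine h1]
    congr 1
    rw [map_smul, map_smul, hA, ContinuousLinearMap.adjoint_comp, h.adjoint_eq,
      ContinuousLinearMap.comp_apply, h.apply_apply]
  have hAv : ‖A v‖ ≤ ‖ξ‖ := by
    have h2 := norm_apply_polyOp_adjoint_le hn A (C c₀ * geoPoly c₀ k) zero_le_one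
      (fun t ht => ?_) ξ
    · rw [hv, smul_smul_adjoint_eq, map_smul, norm_smul, norm_inv, RCLike.norm_natCast,
        inv_mul_le_iff₀ (by exact_mod_cast hn)]
      simpa using h2
    · obtain ⟨h0, h1⟩ := mul_mem_Icc hc hcB ht
      have e : c₀ * t * (geoPoly c₀ k).eval t = 1 - (1 - c₀ * t) ^ k := by
        have := congrArg (eval t) (C_mul_X_mul_geoPoly c₀ k)
        simpa [eval_resPoly] using this
      have h3 := one_sub_pow_mem h0 h1 k
      rw [← abs_of_nonneg ht.1, ← abs_mul, abs_of_nonneg ht.1, eval_mul, eval_C, ← mul_assoc,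
        mul_comm t, e, abs_of_nonneg h3.1]
      exact h3.2
  rw [le_div_iff₀ hτ, mul_comm, ← hPv]
  refine (hlow v).trans ?_
  simpa [hA] using hAv

end Bias

/-! ### The truncated singular value decomposition as `A_†P` with `P` reducing. -/

section SVD

variable {𝕜 : Type*} [RCLike 𝕜] {E : Type*} [NormedAddCommGroup E] [InnerProductSpace 𝕜 E]
  {Z : Type*} [NormedAddCommGroup Z] [InnerProductSpace 𝕜 Z] {ι : Type*}
  {Ad : E →L[𝕜] Z} {σ : ι → ℝ} {φ : ι → E} {ψ : ι → Z}

theorem norm_sq_sum_smul_of_orthonormal {v : ι → E} (hv : Orthonormal 𝕜 v) (s : Finset ι)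
    (a : ι → 𝕜) : ‖∑ i ∈ s, a i • v i‖ ^ 2 = ∑ i ∈ s, ‖a i‖ ^ 2 := by
  rw [← inner_self_eq_norm_sq (𝕜 := 𝕜), hv.inner_sum, map_sum]
  refine Finset.sum_congr rfl fun i _ => ?_
  rw [RCLike.conj_mul, ← RCLike.ofReal_pow, RCLike.ofReal_re]

/-- If `x` has components only along singular values `≤ τ`, then `‖A x‖ ≤ τ ‖x‖`. -/
theorem IsSVD.norm_apply_le (h : IsSVD Ad σ φ ψ) {τ : ℝ} (hτ : 0 ≤ τ) {x : E}
    (hx : ∀ i, inner 𝕜 (φ i) x ≠ 0 → σ i ≤ τ) : ‖Ad x‖ ≤ τ * ‖x‖ := by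
  refine le_of_tendsto (h.hasSum x).norm (Filter.Eventually.of_forall fun s => ?_)
  refine le_of_sq_le_sq ?_ (by positivity)
  simp only [smul_smul]
  rw [norm_sq_sum_smul_of_orthonormal h.right_orthonormal, mul_pow]
  calc ∑ i ∈ s, ‖(σ i : 𝕜) * inner 𝕜 (φ i) x‖ ^ 2
      ≤ ∑ i ∈ s, τ ^ 2 * ‖inner 𝕜 (φ i) x‖ ^ 2 := by
        refine Finset.sum_le_sum fun i _ => ?_
        rw [norm_mul, mul_pow, RCLike.norm_ofReal, abs_of_nonneg (h.nonneg i)]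
        by_cases h0 : inner 𝕜 (φ i) x = 0
        · simp [h0]
        · have := hx i h0
          have := h.nonneg i
          gcongr
    _ = τ ^ 2 * ∑ i ∈ s, ‖inner 𝕜 (φ i) x‖ ^ 2 := by rw [Finset.mul_sum]
    _ ≤ τ ^ 2 * ‖x‖ ^ 2 := by
        gcongr
        exact h.left_orthonormal.sum_inner_products_le x

/-- The orthogonal projection onto the span of the `φ i`, `i ∈ s`. -/
def spanProj (𝕜 : Type*) [RCLike 𝕜] {E : Type*} [NormedAddCommGroup E] [InnerProductSpace 𝕜 E]
    {ι : Type*} (φ : ι → E) (s : Finset ι) : E →L[𝕜] E :=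
  ∑ i ∈ s, InnerProductSpace.rankOne 𝕜 (φ i) (φ i)

theorem spanProj_apply (s : Finset ι) (x : E) :
    spanProj 𝕜 φ s x = ∑ i ∈ s, inner 𝕜 (φ i) x • φ i := by
  simp [spanProj]

theorem inner_spanProj (hφ : Orthonormal 𝕜 φ) {s : Finset ι} {i : ι} (hi : i ∈ s) (x : E) :
    inner 𝕜 (φ i) (spanProj 𝕜 φ s x) = inner 𝕜 (φ i) x := by
  rw [spanProj_apply, hφ.inner_right_sum _ hi]

/-- As `A_†φ_i = σ_iψ_i`, truncating the series amounts to first projecting onto the retained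
singular vectors; all that follows uses this factorization. -/
theorem IsSVD.truncSVD_eq (h : IsSVD Ad σ φ ψ) {τ : ℝ} (hf : {i | τ ≤ σ i}.Finite) :
    truncSVD (𝕜 := 𝕜) σ φ ψ τ = Ad.comp (spanProj 𝕜 φ hf.toFinset) := by
  ext1 x
  rw [truncSVD, finsum_mem_eq_finite_toFinset_sum _ hf, ContinuousLinearMap.comp_apply,
    spanProj_apply, map_sum]
  simp only [sum_apply, smul_apply, InnerProductSpace.rankOne_apply, map_smul, h.apply_left]
  exact Finset.sum_congr rfl fun i _ => smul_comm _ _ _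

theorem IsSVD.norm_apply_sub_spanProj_le (h : IsSVD Ad σ φ ψ) {τ : ℝ} (hτ : 0 ≤ τ)
    (hf : {i | τ ≤ σ i}.Finite) (x : E) :
    ‖Ad (x - spanProj 𝕜 φ hf.toFinset x)‖ ≤ τ * ‖x - spanProj 𝕜 φ hf.toFinset x‖ := by
  refine h.norm_apply_le hτ fun i hi => ?_
  by_contra! hlt
  refine hi ?_
  rw [inner_sub_right, inner_spanProj h.left_orthonormal (hf.mem_toFinset.2 hlt.le), sub_self]

theorem IsSVD.le_norm_apply_spanProj (h : IsSVD Ad σ φ ψ) {τ : ℝ} (hτ : 0 ≤ τ) {s : Finset ι}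
    (hs : ∀ i ∈ s, τ ≤ σ i) (x : E) :
    τ * ‖spanProj 𝕜 φ s x‖ ≤ ‖Ad (spanProj 𝕜 φ s x)‖ := by
  refine le_of_sq_le_sq ?_ (norm_nonneg _)
  rw [mul_pow, spanProj_apply, map_sum]
  simp only [map_smul, h.apply_left, smul_smul]
  rw [norm_sq_sum_smul_of_orthonormal h.left_orthonormal,
    norm_sq_sum_smul_of_orthonormal h.right_orthonormal, Finset.mul_sum]
  refine Finset.sum_le_sum fun i hi => ?_
  rw [norm_mul, mul_pow, mul_comm, RCLike.norm_ofReal, abs_of_nonneg (h.nonneg i)]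
  have := hs i hi
  gcongr

theorem IsSVD.adjoint_right [CompleteSpace E] [CompleteSpace Z] (h : IsSVD Ad σ φ ψ) (i : ι) :
    Ad.adjoint (ψ i) = (σ i : 𝕜) • φ i := by
  classical
  refine ext_inner_right 𝕜 fun x => ?_
  rw [ContinuousLinearMap.adjoint_inner_left, inner_smul_left, RCLike.conj_ofReal]
  have h1 := ((h.hasSum x).mapL (innerSL 𝕜 (ψ i)))
  refine h1.unique ?_
  have h2 := hasSum_single (f := fun j => innerSL 𝕜 (ψ i) ((σ j : 𝕜) • inner 𝕜 (φ j) x • ψ j)) i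
    (fun j hj => by simp [h.right_orthonormal.2 hj.symm])
  simpa [inner_self_eq_norm_sq_to_K, h.right_orthonormal.1 i] using h2

theorem isStarProjection_spanProj [CompleteSpace E] (hφ : Orthonormal 𝕜 φ) (s : Finset ι) :
    IsStarProjection (spanProj 𝕜 φ s) := by
  refine ⟨?_, ?_⟩
  · ext1 x
    change spanProj 𝕜 φ s (spanProj 𝕜 φ s x) = spanProj 𝕜 φ s x
    rw [spanProj_apply (x := spanProj 𝕜 φ s x), spanProj_apply (x := x)]
    refine Finset.sum_congr rfl fun i hi => ?_
    rw [← spanProj_apply, inner_spanProj hφ hi]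
  · rw [isSelfAdjoint_iff, spanProj, star_sum]
    refine Finset.sum_congr rfl fun i _ => ?_
    rw [ContinuousLinearMap.star_eq_adjoint, InnerProductSpace.adjoint_rankOne]

end SVD

theorem IsSVD.isReducing {𝕜 : Type*} [RCLike 𝕜] {n : ℕ}
    {E : Type*} [NormedAddCommGroup E] [InnerProductSpace 𝕜 E] [CompleteSpace E]
    {Y : Fin n → Type*} [∀ i, NormedAddCommGroup (Y i)] [∀ i, InnerProductSpace 𝕜 (Y i)]
    [∀ i, CompleteSpace (Y i)] {Ad : E →L[𝕜] PiLp 2 Y} {ι : Type*} {σ : ι → ℝ} {φ : ι → E}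
    {ψ : ι → PiLp 2 Y} (h : IsSVD (𝕜 := 𝕜) Ad σ φ ψ) (s : Finset ι) :
    IsReducing Ad (spanProj 𝕜 φ s) := by
  refine ⟨isStarProjection_spanProj h.left_orthonormal s, fun x => ?_⟩
  have h1 : ∀ i, normalOp Ad (φ i) = (((n : ℝ)⁻¹ * σ i ^ 2 : ℝ) : 𝕜) • φ i := fun i => by
    rw [normalOp_apply, h.apply_left, map_smul, h.adjoint_right, smul_smul, smul_smul]
    congr 1
    push_cast
    ring
  rw [spanProj_apply, spanProj_apply, map_sum]
  refine Finset.sum_congr rfl fun i _ => ?_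
  have h2 : inner 𝕜 (φ i) (normalOp Ad x) = inner 𝕜 (normalOp Ad (φ i)) x :=
    ((normalOp_isPositive Ad).isSelfAdjoint.isSymmetric (φ i) x).symm
  rw [h2, map_smul, h1, inner_smul_left, RCLike.conj_ofReal, smul_smul, mul_comm]

/-! ### Powers of `δ` at the prescribed stopping indices. -/

section Rates

variable {ν δ : ℝ}

/-- An a priori lower bound on the stopping index makes every rate `k ^ (-s)`, `s ≥ μ`, of order
`δ ^ η`. -/
theorem rpow_neg_le_of_stopping_ge (hν : 0 < ν) (hδ : δ ∈ Set.Ioo (0 : ℝ) 1) {μ : ℝ} (hμ : 0 < μ)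
    {k : ℕ} (hk : δ ^ (-(2 * ν / ((1 + 2 * ν) * μ))) ≤ (k : ℝ)) :
    0 < k ∧ ∀ s, μ ≤ s → (k : ℝ) ^ (-s) ≤ δ ^ (2 * ν / (1 + 2 * ν)) := by
  have h1 : (1 : ℝ) ≤ k :=
    (Real.one_le_rpow_of_pos_of_le_one_of_nonpos hδ.1 hδ.2.le
      (neg_nonpos.2 (by positivity))).trans hk
  refine ⟨by exact_mod_cast zero_lt_one.trans_le h1, fun s hs => ?_⟩
  calc (k : ℝ) ^ (-s) ≤ (k : ℝ) ^ (-μ) := Real.rpow_le_rpow_of_exponent_le h1 (by linarith)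
    _ ≤ (δ ^ (-(2 * ν / ((1 + 2 * ν) * μ)))) ^ (-μ) :=
        Real.rpow_le_rpow_of_nonpos (Real.rpow_pos_of_pos hδ.1 _) hk (by linarith)
    _ = δ ^ (2 * ν / (1 + 2 * ν)) := by
        rw [← Real.rpow_mul hδ.1.le]
        congr 1
        field_simp

theorem le_rpow_rate (hν : 0 < ν) (hδ : δ ∈ Set.Ioo (0 : ℝ) 1) : δ ≤ δ ^ (2 * ν / (1 + 2 * ν)) := by
  calc δ = δ ^ (1 : ℝ) := (Real.rpow_one δ).symm
    _ ≤ _ := Real.rpow_le_rpow_of_exponent_ge hδ.1 hδ.2.le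
        ((div_le_one (by positivity)).2 (by linarith))

theorem rpow_cutoff (hν : 0 < ν) (hδ : 0 < δ) {a b : ℝ} (ha : 0 < a) (hb : 0 ≤ b) :
    (b * (a * δ ^ ((1 + 2 * ν)⁻¹)) ^ 2) ^ ν = (b * a ^ 2) ^ ν * δ ^ (2 * ν / (1 + 2 * ν)) := by
  rw [mul_pow, ← mul_assoc, Real.mul_rpow (by positivity) (by positivity), ← Real.rpow_natCast,
    ← Real.rpow_natCast, ← Real.rpow_mul hδ.le, ← Real.rpow_mul hδ.le]
  congr 2
  push_cast
  field_simp

/-- The choice `b = 1/(1+2ν)` equates `1 - b`, the exponent of the amplified noise, with `2νb`, that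
of the truncation error. -/
theorem div_cutoff (hν : 0 < ν) (hδ : 0 < δ) {a : ℝ} (ha : 0 < a) :
    δ / (a * δ ^ ((1 + 2 * ν)⁻¹)) = a⁻¹ * δ ^ (2 * ν / (1 + 2 * ν)) := by
  have e : 2 * ν / (1 + 2 * ν) = 1 - (1 + 2 * ν)⁻¹ := by field_simp; ring
  rw [e, Real.rpow_sub hδ, Real.rpow_one]
  field_simp

theorem rpow_neg_le_of_exact_stopping (hν : 0 < ν) (hδ : 0 < δ) {κ : ℝ} (hκ : 0 < κ) {k : ℕ}
    (hk : κ * δ ^ (-(2 / (1 + 2 * ν))) ≤ (k : ℝ)) :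
    0 < k ∧ (k : ℝ) ^ (-ν) ≤ κ ^ (-ν) * δ ^ (2 * ν / (1 + 2 * ν)) := by
  have h0 : 0 < κ * δ ^ (-(2 / (1 + 2 * ν))) := mul_pos hκ (Real.rpow_pos_of_pos hδ _)
  refine ⟨by exact_mod_cast h0.trans_le hk, ?_⟩
  refine (Real.rpow_le_rpow_of_nonpos h0 hk (by linarith)).trans_eq ?_
  rw [Real.mul_rpow hκ.le (by positivity), ← Real.rpow_mul hδ.le]
  congr 2
  field_simp

theorem sqrt_mul_le_of_exact_stopping (hν : 0 < ν) (hδ : 0 < δ) {κ : ℝ} (hκ : 0 < κ) {k : ℕ}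
    (hk : (k : ℝ) ≤ κ * δ ^ (-(2 / (1 + 2 * ν)))) :
    √(k : ℝ) * δ ≤ √κ * δ ^ (2 * ν / (1 + 2 * ν)) := by
  calc √(k : ℝ) * δ ≤ √(κ * δ ^ (-(2 / (1 + 2 * ν)))) * δ := by gcongr
    _ = √κ * (δ ^ (-(2 / (1 + 2 * ν)) * (1 / 2)) * δ ^ (1 : ℝ)) := by
        rw [Real.sqrt_mul hκ.le, Real.sqrt_eq_rpow (δ ^ _), ← Real.rpow_mul hδ.le, Real.rpow_one,
          mul_assoc]
    _ = _ := by
        rw [← Real.rpow_add hδ]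
        congr 2
        field_simp
        ring

theorem sqrt_div_succ_le {D : ℝ} (hD : 0 ≤ D) {k : ℕ} (hk : 0 < k) :
    √(D / (k + 1)) ≤ √D * (k : ℝ) ^ (-(1 / 2) : ℝ) := by
  have hk' : (0 : ℝ) < k := by exact_mod_cast hk
  calc √(D / (k + 1)) ≤ √(D / k) := by gcongr; linarith
    _ = _ := by
      rw [Real.sqrt_div hD, Real.rpow_neg hk'.le, ← Real.sqrt_eq_rpow, div_eq_mul_inv]

/-- Trades the logarithm for an arbitrarily small power, at a constant that blows up like `1/ε`. -/
theorem log_div_sqrt_le {ε : ℝ} (hε : 0 < ε) {k : ℕ} (hk : 0 < k) :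
    (9 + Real.log k) / √((k : ℝ) + 1) ≤ (9 + 1 / ε) * (k : ℝ) ^ (-(1 / 2 - ε)) := by
  have hk1 : (1 : ℝ) ≤ k := by exact_mod_cast hk
  have hk' : (0 : ℝ) < k := by linarith
  have h1 := Real.log_le_rpow_div hk'.le hε
  have h2 := Real.one_le_rpow hk1 hε.le
  have h3 : 9 + Real.log k ≤ (9 + 1 / ε) * (k : ℝ) ^ ε := by
    rw [add_mul, one_div_mul_eq_div]
    linarith
  calc (9 + Real.log k) / √((k : ℝ) + 1) ≤ (9 + 1 / ε) * (k : ℝ) ^ ε / √(k : ℝ) := by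
        gcongr
        linarith
    _ = _ := by
        rw [neg_sub, Real.rpow_sub hk', ← Real.sqrt_eq_rpow, mul_div_assoc]

end Rates

/-! ### Assembly: Landweber rates combined with the stochastic perturbation. -/

variable {𝕜 : Type*} [RCLike 𝕜] {n : ℕ}
  {E : Type*} [NormedAddCommGroup E] [InnerProductSpace 𝕜 E] [CompleteSpace E]
  {Y : Fin n → Type*} [∀ i, NormedAddCommGroup (Y i)] [∀ i, InnerProductSpace 𝕜 (Y i)]
  [∀ i, CompleteSpace (Y i)] {Ad : E →L[𝕜] PiLp 2 Y} {A : E →L[𝕜] PiLp 2 Y} {c₀ ν δ : ℝ}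
  {yd ξ : PiLp 2 Y} {x0 xd w : E} {M k : ℕ}

/-- The error of the (full gradient) Landweber method. -/
def landweberErr (A : E →L[𝕜] PiLp 2 Y) (ξ : PiLp 2 Y) (x0 xd : E) (c₀ : ℝ) (k : ℕ) : E :=
  polyOp (normalOp A) (resPoly c₀ k) (x0 - xd)
    + polyOp (normalOp A) (geoPoly c₀ k) ((c₀ : 𝕜) • (n : 𝕜)⁻¹ • A.adjoint ξ)

theorem IsReducing.norm_landweberErr_le {P : E →L[𝕜] E} (h : IsReducing Ad P) {τ : ℝ} (hτ : 0 ≤ τ)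
    (hcut : ∀ x, ‖Ad (x - P x)‖ ≤ τ * ‖x‖) (hc : 0 < c₀)
    (hcB : c₀ * ‖normalOp (Ad.comp P)‖ ≤ 1) (hν : 0 < ν)
    (hsource : xd - x0 = fracPow (normalOp Ad) ν w) (hk : 0 < k) {N : ℝ}
    (hN : ‖polyOp (normalOp (Ad.comp P)) (geoPoly c₀ k)
      ((c₀ : 𝕜) • (n : 𝕜)⁻¹ • (Ad.comp P).adjoint ξ)‖ ≤ N) :
    ‖landweberErr (Ad.comp P) ξ x0 xd c₀ k‖
      ≤ (ν ^ ν * c₀ ^ (-ν) * (k : ℝ) ^ (-ν) + ((n : ℝ)⁻¹ * τ ^ 2) ^ ν) * ‖w‖ + N := by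
  refine (norm_add_le _ _).trans (add_le_add ?_ hN)
  rw [← neg_sub, hsource, map_neg, norm_neg]
  exact h.norm_resPoly_fracPow_le hτ hcut hc hcB hν hk w

/-- Landweber error for the truncated singular value decomposition. -/
theorem IsSVD.norm_landweberErr_truncSVD_le (hn : 0 < n) {ι : Type*} {σ : ι → ℝ} {φ : ι → E}
    {ψ : ι → PiLp 2 Y} (h : IsSVD (𝕜 := 𝕜) Ad σ φ ψ) (hAd : IsCompactOperator Ad) {a : ℝ}
    (ha : 0 < a) (hδ : 0 < δ) (hξ : ‖ξ‖ = δ)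
    (hA : A = truncSVD σ φ ψ (a * δ ^ ((1 + 2 * ν)⁻¹))) (hc : 0 < c₀)
    (hcB : c₀ * ‖normalOp A‖ ≤ 1) (hν : 0 < ν)
    (hsource : xd - x0 = fracPow (normalOp Ad) ν w) (hk : 0 < k) :
    ‖landweberErr A ξ x0 xd c₀ k‖ ≤ ν ^ ν * c₀ ^ (-ν) * ‖w‖ * (k : ℝ) ^ (-ν)
      + (((n : ℝ)⁻¹ * a ^ 2) ^ ν * ‖w‖ + a⁻¹) * δ ^ (2 * ν / (1 + 2 * ν)) := by
  have hτ : 0 < a * δ ^ ((1 + 2 * ν)⁻¹) := mul_pos ha (Real.rpow_pos_of_pos hδ _)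
  have hf := h.finite_le hAd hτ
  rw [h.truncSVD_eq hf] at hA
  subst hA
  have hR := h.isReducing hf.toFinset
  have hcut : ∀ x, ‖Ad (x - spanProj 𝕜 φ hf.toFinset x)‖ ≤ a * δ ^ ((1 + 2 * ν)⁻¹) * ‖x‖ := by
    intro x
    refine (h.norm_apply_sub_spanProj_le hτ.le hf x).trans ?_
    gcongr
    exact hR.one_sub.norm_apply_le x
  have hlow := h.le_norm_apply_spanProj hτ.le (s := hf.toFinset) fun i hi => hf.mem_toFinset.1 hi
  refine (hR.norm_landweberErr_le hτ.le hcut hc hcB hν hsource hk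
    (hR.norm_geoPoly_noise_le_div hn hτ hlow hc hcB k ξ)).trans_eq ?_
  rw [hξ, div_cutoff hν hδ ha, rpow_cutoff hν hδ ha (by positivity)]
  ring

theorem IsSVD.adjoint_residual_truncSVD (hn : 0 < n) {ι : Type*} {σ : ι → ℝ} {φ : ι → E}
    {ψ : ι → PiLp 2 Y} (h : IsSVD (𝕜 := 𝕜) Ad σ φ ψ) (hAd : IsCompactOperator Ad) {τ : ℝ}
    (hτ : 0 < τ) (hA : A = truncSVD σ φ ψ τ) (x : E) : A.adjoint (A x - Ad x) = 0 := by
  rw [hA, h.truncSVD_eq (h.finite_le hAd hτ)]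
  exact (h.isReducing _).adjoint_residual_eq_zero hn x

/-- Landweber error for exact operators with a stopping index of exact order. -/
theorem norm_landweberErr_le_of_exact_stopping (hn : 0 < n) (hδ : 0 < δ) (hξ : ‖ξ‖ = δ)
    (hc : 0 < c₀) (hcB : c₀ * ‖normalOp Ad‖ ≤ 1) (hν : 0 < ν)
    (hsource : xd - x0 = fracPow (normalOp Ad) ν w) {κ₁ κ₂ : ℝ} (hκ₁ : 0 < κ₁) (hκ₂ : 0 < κ₂)
    (h1 : κ₁ * δ ^ (-(2 / (1 + 2 * ν))) ≤ (k : ℝ)) (h2 : (k : ℝ) ≤ κ₂ * δ ^ (-(2 / (1 + 2 * ν)))) :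
    ‖landweberErr Ad ξ x0 xd c₀ k‖
      ≤ (ν ^ ν * c₀ ^ (-ν) * ‖w‖ * κ₁ ^ (-ν) + √c₀ * √κ₂) * δ ^ (2 * ν / (1 + 2 * ν)) := by
  obtain ⟨hk, hk'⟩ := rpow_neg_le_of_exact_stopping hν hδ hκ₁ h1
  have h3 := (isReducing_one Ad).norm_landweberErr_le (ξ := ξ) (x0 := x0) (xd := xd) (w := w)
    le_rfl (by simp) hc hcB hν hsource hk (norm_geoPoly_noise_le hn hc hcB k ξ)
  have e : Ad.comp (1 : E →L[𝕜] E) = Ad := rfl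
  rw [e, hξ, Real.sqrt_mul hc.le, mul_assoc (√c₀)] at h3
  have h4 := sqrt_mul_le_of_exact_stopping hν hδ hκ₂ h2
  have h5 : ((n : ℝ)⁻¹ * (0 : ℝ) ^ 2) ^ ν = 0 := by simp [Real.zero_rpow hν.ne']
  rw [h5, add_zero] at h3
  refine h3.trans ?_
  have h6 := mul_le_mul_of_nonneg_left h4 (Real.sqrt_nonneg c₀)
  have h7 := mul_le_mul_of_nonneg_left hk'
    (by positivity : 0 ≤ ν ^ ν * c₀ ^ (-ν) * ‖w‖)
  linarith

/-- The variance constant of SVRG. -/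
def varianceConst (n : ℕ) (c₀ : ℝ) (M : ℕ) (ρ : ℝ) : ℝ :=
  900 * c₀ * n * M ^ 2 * ((n : ℝ)⁻¹ * (√(n / c₀) * ρ + 1) ^ 2)

/-- Root mean square error of SVRG, given a bound on the Landweber error. -/
theorem rmsErrorLE_of_landweberErr_le {Ω : Type*} [MeasurableSpace Ω] {P : Measure Ω}
    [IsProbabilityMeasure P] {I : ℕ → Ω → Fin n} (hn : 0 < n) (hM : 0 < M)
    (hI : IsUniformSampling P I) (hA : A.adjoint (A xd - yd) = 0) (h : StepOKExp A M c₀)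
    (hξ : ‖ξ‖ ≤ 1) (hk : 0 < k) {b r : ℝ} (hb : ‖landweberErr A ξ x0 xd c₀ k‖ ≤ b)
    (hr : b + √(varianceConst n c₀ M ‖x0 - xd‖) * (k : ℝ) ^ (-(1 / 2) : ℝ) ≤ r) :
    RMSErrorLE P (fun ω => iterate A (yd + ξ) x0 c₀ M (fun j => I j ω) k) xd r := by
  have hdep : DependsOn (fun j => ‖err A (yd + ξ) x0 xd c₀ M j k‖ ^ 2) (Set.Iio k) := by
    intro j j' hj
    have := dependsOn_err (ξ := ξ) (x0 := x0) (c₀ := c₀) hM hA k hj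
    simp only at this
    simp only [this]
  refine ⟨integrable_of_dependsOn hn hI hdep, ?_⟩
  have hD : 0 ≤ varianceConst n c₀ M ‖x0 - xd‖ := by
    have := h.1
    rw [varianceConst]
    positivity
  have h1 := expect_err_sq_le (x0 := x0) hn hM hI hA h le_rfl hξ k
  -- Passing from squares to norms by `√(x² + v) ≤ x + √v`.
  refine le_trans (Real.sqrt_le_iff.2 ⟨add_nonneg (norm_nonneg _) (Real.sqrt_nonneg _), ?_⟩)
    ((add_le_add hb (sqrt_div_succ_le hD hk)).trans hr)
  refine h1.trans ?_
  change ‖landweberErr A ξ x0 xd c₀ k‖ ^ 2 + varianceConst n c₀ M ‖x0 - xd‖ / (k + 1) ≤ _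
  rw [add_sq, Real.sq_sqrt (by positivity)]
  have : 0 ≤ 2 * ‖landweberErr A ξ x0 xd c₀ k‖ * √(varianceConst n c₀ M ‖x0 - xd‖ / (k + 1)) := by
    positivity
  linarith

end SVRG

end

theorem corollary2p2 {𝕜 : Type*} [RCLike 𝕜] {n : ℕ} (hn : 0 < n)
    {X : Type*} [NormedAddCommGroup X] [InnerProductSpace 𝕜 X] [CompleteSpace X]
    {Y : Fin n → Type*} [∀ i, NormedAddCommGroup (Y i)] [∀ i, InnerProductSpace 𝕜 (Y i)]
    [∀ i, CompleteSpace (Y i)]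
    (Ad : X →L[𝕜] PiLp 2 Y) (yd : PiLp 2 Y) (x0 xd : X)
    (hxd : SVRG.IsMinNormSolution Ad yd x0 xd)
    (ν : ℝ) (hν : 0 < ν) (w : X) (hw : w ∈ (LinearMap.ker Ad.toLinearMap)ᗮ)
    (hsource : xd - x0 = SVRG.fracPow (SVRG.normalOp Ad) ν w)
    (M : ℕ) (hM : 0 < M) (c₀ : ℝ)
    {Ω : Type*} [MeasurableSpace Ω] (P : MeasureTheory.Measure Ω)
    [MeasureTheory.IsProbabilityMeasure P] (I : ℕ → Ω → Fin n)
    (hI : SVRG.IsUniformSampling P I) :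
    -- rSVRG
    (∀ (a : ℝ), 0 < a → IsCompactOperator Ad →
      ∀ {ι : Type*} (σ : ι → ℝ) (φ : ι → X) (ψ : ι → PiLp 2 Y), SVRG.IsSVD (𝕜 := 𝕜) Ad σ φ ψ →
      (∃ C : ℝ, ∀ δ ∈ Set.Ioo (0 : ℝ) 1, ∀ ξ : PiLp 2 Y, ‖ξ‖ = δ →
        ∀ A : X →L[𝕜] PiLp 2 Y, A = SVRG.truncSVD σ φ ψ (a * δ ^ ((1 + 2 * ν)⁻¹)) →
        SVRG.StepOKExp A M c₀ →
        ∀ k : ℕ, δ ^ (-(2 * ν / ((1 + 2 * ν) * min ν (1 / 2)))) ≤ (k : ℝ) →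
          SVRG.RMSErrorLE P
            (fun ω => SVRG.iterate A (yd + ξ) x0 c₀ M (fun j => I j ω) k) xd
            (C * δ ^ (2 * ν / (1 + 2 * ν)))) ∧
      (∀ ε ∈ Set.Ioo (0 : ℝ) (1 / 2), ∃ C : ℝ, ∀ δ ∈ Set.Ioo (0 : ℝ) 1,
        ∀ ξ : PiLp 2 Y, ‖ξ‖ = δ →
        ∀ A : X →L[𝕜] PiLp 2 Y, A = SVRG.truncSVD σ φ ψ (a * δ ^ ((1 + 2 * ν)⁻¹)) →
        SVRG.StepOKPath A M c₀ →
        ∀ k : ℕ, δ ^ (-(2 * ν / ((1 + 2 * ν) * min ν (1 / 2 - ε)))) ≤ (k : ℝ) →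
        ∀ i : ℕ → Fin n,
          ‖SVRG.iterate A (yd + ξ) x0 c₀ M i k - xd‖ ≤ C * δ ^ (2 * ν / (1 + 2 * ν)))) ∧
    -- SVRG, with a stopping index of exact order `δ ^ (-2 / (1 + 2ν))`
    (∀ κ₁ κ₂ : ℝ, 0 < κ₁ → κ₁ ≤ κ₂ →
      (ν ≤ 1 / 2 → SVRG.StepOKExp Ad M c₀ →
        ∃ C : ℝ, ∀ δ ∈ Set.Ioo (0 : ℝ) 1, ∀ ξ : PiLp 2 Y, ‖ξ‖ = δ →
        ∀ k : ℕ, κ₁ * δ ^ (-(2 / (1 + 2 * ν))) ≤ (k : ℝ) →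
          (k : ℝ) ≤ κ₂ * δ ^ (-(2 / (1 + 2 * ν))) →
          SVRG.RMSErrorLE P
            (fun ω => SVRG.iterate Ad (yd + ξ) x0 c₀ M (fun j => I j ω) k) xd
            (C * δ ^ (2 * ν / (1 + 2 * ν)))) ∧
      (ν < 1 / 2 → SVRG.StepOKPath Ad M c₀ →
        ∃ C : ℝ, ∀ δ ∈ Set.Ioo (0 : ℝ) 1, ∀ ξ : PiLp 2 Y, ‖ξ‖ = δ →
        ∀ k : ℕ, κ₁ * δ ^ (-(2 / (1 + 2 * ν))) ≤ (k : ℝ) →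
          (k : ℝ) ≤ κ₂ * δ ^ (-(2 / (1 + 2 * ν))) →
        ∀ i : ℕ → Fin n,
          ‖SVRG.iterate Ad (yd + ξ) x0 c₀ M i k - xd‖ ≤ C * δ ^ (2 * ν / (1 + 2 * ν)))) := by
  have hy : yd = Ad xd := hxd.1.symm
  subst hy
  refine ⟨fun a ha hAd ι σ φ ψ hsvd => ⟨?_, fun ε hε => ?_⟩, fun κ₁ κ₂ hκ₁ hκ => ⟨?_, ?_⟩⟩
  · refine ⟨ν ^ ν * c₀ ^ (-ν) * ‖w‖ + (((n : ℝ)⁻¹ * a ^ 2) ^ ν * ‖w‖ + a⁻¹)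
      + √(SVRG.varianceConst n c₀ M ‖x0 - xd‖), ?_⟩
    intro δ hδ ξ hξ A hA hstep k hk
    obtain ⟨hk0, hrate⟩ := SVRG.rpow_neg_le_of_stopping_ge hν hδ (lt_min hν (by norm_num)) hk
    have hc := hstep.1
    have hcB := SVRG.mul_norm_normalOp_le hn hc hstep.mul_maxSq_le
    have hτ : 0 < a * δ ^ ((1 + 2 * ν)⁻¹) := mul_pos ha (Real.rpow_pos_of_pos hδ.1 _)
    refine SVRG.rmsErrorLE_of_landweberErr_le hn hM hI
      (hsvd.adjoint_residual_truncSVD hn hAd hτ hA xd) hstep (hξ.trans_le hδ.2.le) hk0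
      (hsvd.norm_landweberErr_truncSVD_le hn hAd ha hδ.1 hξ hA hc hcB hν hsource hk0) ?_
    have h1 := mul_le_mul_of_nonneg_left (hrate ν (min_le_left _ _))
      (by positivity : 0 ≤ ν ^ ν * c₀ ^ (-ν) * ‖w‖)
    have h2 := mul_le_mul_of_nonneg_left (hrate (1 / 2) (min_le_right _ _))
      (Real.sqrt_nonneg (SVRG.varianceConst n c₀ M ‖x0 - xd‖))
    linarith
  -- The constant has to be chosen before any step size condition is available; if `c₀ ≤ 0`, no
  -- operator satisfies that condition.
  · rcases le_or_gt c₀ 0 with hc | hc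
    · exact ⟨0, fun δ _ ξ _ A _ hstep => absurd hstep.1 hc.not_gt⟩
    obtain ⟨C, hC0, hC⟩ := SVRG.exists_norm_err_le 𝕜 hn X Y hM hc (norm_nonneg (x0 - xd))
    refine ⟨ν ^ ν * c₀ ^ (-ν) * ‖w‖ + (((n : ℝ)⁻¹ * a ^ 2) ^ ν * ‖w‖ + a⁻¹)
      + C * (9 + 1 / ε + 8), ?_⟩
    intro δ hδ ξ hξ A hA hstep k hk j
    have hμ : 0 < min ν (1 / 2 - ε) := lt_min hν (by linarith [hε.2])
    obtain ⟨hk0, hrate⟩ := SVRG.rpow_neg_le_of_stopping_ge hν hδ hμ hk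
    have hcB := SVRG.mul_norm_normalOp_le hn hc hstep.mul_maxSq_le
    have hτ : 0 < a * δ ^ ((1 + 2 * ν)⁻¹) := mul_pos ha (Real.rpow_pos_of_pos hδ.1 _)
    have h0 := hC A (Ad xd) ξ x0 xd (hsvd.adjoint_residual_truncSVD hn hAd hτ hA xd) hstep le_rfl
      (hξ.trans_le hδ.2.le) j k
    have hb := hsvd.norm_landweberErr_truncSVD_le hn hAd ha hδ.1 hξ hA hc hcB hν hsource hk0
    refine h0.trans ((add_le_add_left hb _).trans ?_)
    have hε0 := hε.1
    have h1 := mul_le_mul_of_nonneg_left (hrate ν (min_le_left _ _))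
      (by positivity : 0 ≤ ν ^ ν * c₀ ^ (-ν) * ‖w‖)
    have h2 := (SVRG.log_div_sqrt_le hε.1 hk0).trans
      (mul_le_mul_of_nonneg_left (hrate (1 / 2 - ε) (min_le_right _ _)) (by positivity))
    have h3 := SVRG.le_rpow_rate hν hδ
    have h4 := mul_le_mul_of_nonneg_left
      (add_le_add h2 (mul_le_mul_of_nonneg_left h3 (by norm_num : (0 : ℝ) ≤ 8))) hC0
    rw [hξ]
    linarith
  · intro hν2 hstep
    have hc := hstep.1
    have hcB := SVRG.mul_norm_normalOp_le hn hc hstep.mul_maxSq_le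
    refine ⟨(ν ^ ν * c₀ ^ (-ν) * ‖w‖ * κ₁ ^ (-ν) + √c₀ * √κ₂)
      + √(SVRG.varianceConst n c₀ M ‖x0 - xd‖) * κ₁ ^ (-ν), ?_⟩
    intro δ hδ ξ hξ k hk1 hk2
    obtain ⟨hk0, hrate⟩ := SVRG.rpow_neg_le_of_exact_stopping hν hδ.1 hκ₁ hk1
    refine SVRG.rmsErrorLE_of_landweberErr_le hn hM hI (by simp) hstep (hξ.trans_le hδ.2.le) hk0
      (SVRG.norm_landweberErr_le_of_exact_stopping hn hδ.1 hξ hc hcB hν hsource hκ₁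
        (hκ₁.trans_le hκ) hk1 hk2) ?_
    have hk3 : (1 : ℝ) ≤ k := by exact_mod_cast hk0
    -- Here `ν ≤ 1/2` enters: the standard deviation `k^(-1/2)` must not exceed the bias rate
    -- `k^(-ν)`.
    have h1 := (Real.rpow_le_rpow_of_exponent_le hk3 (neg_le_neg hν2)).trans hrate
    have h2 := mul_le_mul_of_nonneg_left h1
      (Real.sqrt_nonneg (SVRG.varianceConst n c₀ M ‖x0 - xd‖))
    linarith
  · intro hν2 hstep
    have hc := hstep.1
    have hcB := SVRG.mul_norm_normalOp_le hn hc hstep.mul_maxSq_le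
    -- With `ε = 1/2 - ν` the logarithmic term becomes exactly `k^(-ν)`; the strict inequality
    -- leaves room for it.
    have hε : 0 < 1 / 2 - ν := by linarith
    obtain ⟨C, hC0, hC⟩ := SVRG.exists_norm_err_le 𝕜 hn X Y hM hc (norm_nonneg (x0 - xd))
    refine ⟨(ν ^ ν * c₀ ^ (-ν) * ‖w‖ * κ₁ ^ (-ν) + √c₀ * √κ₂)
      + C * ((9 + 1 / (1 / 2 - ν)) * κ₁ ^ (-ν) + 8), ?_⟩
    intro δ hδ ξ hξ k hk1 hk2 j
    obtain ⟨hk0, hrate⟩ := SVRG.rpow_neg_le_of_exact_stopping hν hδ.1 hκ₁ hk1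
    have h0 := hC Ad (Ad xd) ξ x0 xd (by simp) hstep le_rfl (hξ.trans_le hδ.2.le) j k
    have hb := SVRG.norm_landweberErr_le_of_exact_stopping hn hδ.1 hξ hc hcB hν hsource hκ₁
      (hκ₁.trans_le hκ) hk1 hk2
    refine h0.trans ((add_le_add_left hb _).trans ?_)
    have h2 := SVRG.log_div_sqrt_le hε hk0
    rw [sub_sub_cancel] at h2
    have h2' := h2.trans (mul_le_mul_of_nonneg_left hrate (by positivity))
    have h3 := SVRG.le_rpow_rate hν hδ
    have h4 := mul_le_mul_of_nonneg_left
      (add_le_add h2' (mul_le_mul_of_nonneg_left h3 (by norm_num : (0 : ℝ) ≤ 8))) hC0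
    rw [hξ]
    linarith
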